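/- All Hilbert spaces are finite-dimensional, all logarithms are to base $2$, $\|A\|_1=\operatorname{Tr}\sqrt{A^\dagger A}$, and $S$ denotes von Neumann entropy. A POVM on $\mathcal H$ is a family $\{\Lambda_x\}_{x\in\mathcal X}$ of positive operators, indexed by a finite set, with $\sum_x\Lambda_x=I$; for a sub-POVM one only asks $\sum_x\Lambda_x\le I$. A sub-POVM $\{\tilde\Lambda_x\}_{x\in\mathcal X}$ is $\epsilon$-faithful to a POVM $\{\Lambda_x\}_{x\in\mathcal X}$ with respect to a density operator $\rho$ if $$\sum_{x}\big\|\sqrt\rho\,(\Lambda_x-\tilde\Lambda_x)\sqrt\rho\big\|_1+\operatorname{Tr}\Big\{\Big(I-\sum_x\tilde\Lambda_x\Big)\rho\Big\}\le\epsilon .$$ **Protocols.** A distributed protocol with parameters $(n,\Theta_1,\Theta_2,N)$ (positive integers) on $\mathcal H_A\otimes\mathcal H_B$ with output set $\mathcal Z$ consists of finite sets $\mathcal L_1,\mathcal L_2$ with $|\mathcal L_i|\le\Theta_i$ and, for each value $\mu\in\{1,\dots,N\}$ of the common randomness, a sub-POVM $\{\Lambda^{A,(\mu)}_{l}\}_{l\in\mathcal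 L_1}$ on $\mathcal H_A^{\otimes n}$ (Alice), a sub-POVM $\{\Lambda^{B,(\mu)}_{l}\}_{l\in\mathcal L_2}$ on $\mathcal H_B^{\otimes n}$ (Bob), and a decoding map $f^{(\mu)}:\mathcal L_1\times\mathcal L_2\to\mathcal Z^n$ (Eve). Its overall sub-POVM is $$\tilde\Lambda_{z^n}=\frac1N\sum_{\mu=1}^{N}\ \sum_{(l_1,l_2):\,f^{(\mu)}(l_1,l_2)=z^n}\Lambda^{A,(\mu)}_{l_1}\otimes\Lambda^{B,(\mu)}_{l_2},\qquad z^n\in\mathcal Z^n .$$ **Achievability.** Given a density operator $\rho_{AB}$ and a POVM $M_{AB}=\{\Lambda^{AB}_z\}_{z\in\mathcal Z}$ on $\mathcal H_A\otimes\mathcal H_B$, a triple $(R_1,R_2,C)$ of real numbers is achievable if for every $\epsilon>0$ and all sufficiently large $n$ there is a distributed protocol with parameters $(n,\Theta_1,\Theta_2,N)$ whose overall sub-POVM is $\epsilon$-faithful to $M_{AB}^{\otimes n}$ with respect to $\rho_{AB}^{\otimes n}$ and such that $\frac1n\log_2N\le C+\epsilon$ and $\frac1n\log_2\Theta_i\le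 R_i+\epsilon$ for $i=1,2$. **Theorem.** Let $\rho_{AB}$ be a density operator and $M_{AB}=\{\Lambda^{AB}_z\}_{z\in\mathcal Z}$ a POVM on $\mathcal H_A\otimes\mathcal H_B$. Let $\bar M_A=\{\bar\Lambda^A_u\}_{u\in\mathcal U}$ and $\bar M_B=\{\bar\Lambda^B_v\}_{v\in\mathcal V}$ be POVMs on $\mathcal H_A$ and $\mathcal H_B$, and let $g:\mathcal U\times\mathcal V\to\mathcal Z$ be a function, with $\mathcal U,\mathcal V$ finite, such that $$\Lambda^{AB}_z=\sum_{(u,v):\,g(u,v)=z}\bar\Lambda^A_u\otimes\bar\Lambda^B_v\qquad\text{for all }z\in\mathcal Z .$$ Let $\Psi_{RAB}$ be any purification of $\rho_{AB}$ with finite-dimensional reference system $R$, and put $$\sigma_1^{RUB}=(\mathrm{id}_R\otimes\bar M_A\otimes\mathrm{id}_B)(\Psi_{RAB}),\quad \sigma_2^{RAV}=(\mathrm{id}_R\otimes\mathrm{id}_A\otimes\bar M_B)(\Psi_{RAB}),\quad \sigma_3^{RUV}=(\mathrm{id}_R\otimes\bar M_A\otimes\bar M_B)(\Psi_{RAB}),$$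 where applying a POVM $\{\Lambda_x\}$ to a subsystem $X$ of a state $\Psi_{TX}$ gives $\sum_x|x\rangle\langle x|\otimes\operatorname{Tr}_X\{(I_T\otimes\Lambda_x)\Psi_{TX}\}$. Write $I(X;Y)=S(X)+S(Y)-S(XY)$ and $S(X|Y)=S(XY)-S(Y)$ for the entropies of the reduced states. If $R_1,R_2,C$ are real numbers with $C\ge0$ and $$\begin{aligned} R_1&\ge I(U;RB)_{\sigma_1}-I(U;V)_{\sigma_3},\\ R_2&\ge I(V;RA)_{\sigma_2}-I(U;V)_{\sigma_3},\\ R_1+R_2&\ge I(U;RB)_{\sigma_1}+I(V;RA)_{\sigma_2}-I(U;V)_{\sigma_3},\\ R_1+C&\ge S(U|V)_{\sigma_3},\\ R_2+C&\ge S(V|U)_{\sigma_3},\\ R_1+R_2+C&\ge S(U,V)_{\sigma_3}, \end{aligned}$$ then $(R_1,R_2,C)$ is achievable. -/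

import Mathlib

open scoped Matrix Kronecker ComplexOrder MatrixOrder

noncomputable section

namespace DistMeas

/-! Operators on a finite-dimensional Hilbert space with a fixed orthonormal basis indexed by a
finite type `ι` are matrices `Matrix ι ι ℂ`; the tensor product of two such spaces is indexed by the
product type, and its `n`-fold tensor power by `Fin n → ι`. -/

/-- Density operators: positive, of unit trace. -/
def IsDensity {ι : Type*} [Fintype ι] (ρ : Matrix ι ι ℂ) : Prop :=
  ρ.PosSemidef ∧ ρ.trace = 1

/-- POVMs with outcomes in the finite set `X`. -/
def IsPOVM {ι X : Type*} [Fintype ι] [DecidableEq ι] [Fintype X]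
    (M : X → Matrix ι ι ℂ) : Prop :=
  (∀ x, (M x).PosSemidef) ∧ ∑ x, M x = 1

/-- Sub-POVMs: positive operators whose sum is at most the identity. -/
def IsSubPOVM {ι X : Type*} [Fintype ι] [DecidableEq ι] [Fintype X]
    (M : X → Matrix ι ι ℂ) : Prop :=
  (∀ x, (M x).PosSemidef) ∧ (1 - ∑ x, M x).PosSemidef

/-- The trace norm `Tr |A|` with `|A| = √(A† A)`. -/
def traceNorm {ι : Type*} [Fintype ι] [DecidableEq ι] (A : Matrix ι ι ℂ) : ℝ :=
  (CFC.sqrt (Aᴴ * A)).trace.re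

/-- The von Neumann entropy in bits, `-∑ λ log₂ λ` over the eigenvalues `λ` of `ρ` (with value `0`
on matrices that are not Hermitian). -/
def entropy {ι : Type*} [Fintype ι] [DecidableEq ι] (ρ : Matrix ι ι ℂ) : ℝ :=
  haveI := Classical.dec ρ.IsHermitian
  if h : ρ.IsHermitian then - ∑ i, h.eigenvalues i * Real.logb 2 (h.eigenvalues i) else 0

/-- Partial trace over the first tensor factor. -/
def trFst {ι κ : Type*} [Fintype ι] (X : Matrix (ι × κ) (ι × κ) ℂ) : Matrix κ κ ℂ :=
  Matrix.of fun k k' => ∑ i, X (i, k) (i, k')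

/-- Partial trace over the second tensor factor. -/
def trSnd {ι κ : Type*} [Fintype κ] (X : Matrix (ι × κ) (ι × κ) ℂ) : Matrix ι ι ℂ :=
  Matrix.of fun i i' => ∑ k, X (i, k) (i', k)

/-- Quantum mutual information `I(A;B) = S(A) + S(B) - S(AB)` of a bipartite operator. -/
def mutualInfo {ι κ : Type*} [Fintype ι] [DecidableEq ι] [Fintype κ] [DecidableEq κ]
    (σ : Matrix (ι × κ) (ι × κ) ℂ) : ℝ :=
  entropy (trSnd σ) + entropy (trFst σ) - entropy σ

/-- `S(A|B) = S(AB) - S(B)`. -/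
def condEntropyFst {ι κ : Type*} [Fintype ι] [DecidableEq ι] [Fintype κ] [DecidableEq κ]
    (σ : Matrix (ι × κ) (ι × κ) ℂ) : ℝ :=
  entropy σ - entropy (trFst σ)

/-- `S(B|A) = S(AB) - S(A)`. -/
def condEntropySnd {ι κ : Type*} [Fintype ι] [DecidableEq ι] [Fintype κ] [DecidableEq κ]
    (σ : Matrix (ι × κ) (ι × κ) ℂ) : ℝ :=
  entropy σ - entropy (trSnd σ)

/-- The operator `|ψ⟩⟨ψ|`. -/
def pureState {ι : Type*} (ψ : ι → ℂ) : Matrix ι ι ℂ := Matrix.vecMulVec ψ (star ψ)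

/-- `ψ`, a vector of `R ⊗ H`, purifies `ρ`. -/
def IsPurification {R ι : Type*} [Fintype R] (ψ : R × ι → ℂ) (ρ : Matrix ι ι ℂ) : Prop :=
  trFst (pureState ψ) = ρ

/-- The classical outcome together with the unmeasured system `T`, after `M` has been applied to the
second factor of `T ⊗ H`: `∑ x, |x⟩⟨x| ⊗ Tr_H {(I ⊗ M x) Ψ}`. -/
def postMeas {T ι X : Type*} [Fintype T] [DecidableEq T] [Fintype ι] [Fintype X] [DecidableEq X]
    (M : X → Matrix ι ι ℂ) (Ψ : Matrix (T × ι) (T × ι) ℂ) : Matrix (X × T) (X × T) ℂ :=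
  ∑ x, Matrix.single x x 1 ⊗ₖ trSnd (((1 : Matrix T T ℂ) ⊗ₖ M x) * Ψ)

/-- The tensor product of two measurements. -/
def tensorMeas {a b U V : Type*} (MA : U → Matrix a a ℂ) (MB : V → Matrix b b ℂ) :
    U × V → Matrix (a × b) (a × b) ℂ :=
  fun p => MA p.1 ⊗ₖ MB p.2

section AuxiliaryStates

variable {R a b U V : Type*} [Fintype R] [DecidableEq R] [Fintype a] [DecidableEq a] [Fintype b]
  [DecidableEq b] [Fintype U] [DecidableEq U] [Fintype V] [DecidableEq V]

/-- `σ₁ = (id_R ⊗ M_A ⊗ id_B)(Ψ_{RAB})`, with the registers in the order `U, (R, B)`. -/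
def sigma1 (MA : U → Matrix a a ℂ) (ψ : R × (a × b) → ℂ) :
    Matrix (U × (R × b)) (U × (R × b)) ℂ :=
  postMeas MA (pureState fun p : (R × b) × a => ψ (p.1.1, (p.2, p.1.2)))

/-- `σ₂ = (id_R ⊗ id_A ⊗ M_B)(Ψ_{RAB})`, with the registers in the order `V, (R, A)`. -/
def sigma2 (MB : V → Matrix b b ℂ) (ψ : R × (a × b) → ℂ) :
    Matrix (V × (R × a)) (V × (R × a)) ℂ :=
  postMeas MB (pureState fun p : (R × a) × b => ψ (p.1.1, (p.1.2, p.2)))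

/-- `σ₃ = (id_R ⊗ M_A ⊗ M_B)(Ψ_{RAB})`, with the registers in the order `(U, V), R`. -/
def sigma3 (MA : U → Matrix a a ℂ) (MB : V → Matrix b b ℂ) (ψ : R × (a × b) → ℂ) :
    Matrix ((U × V) × R) ((U × V) × R) ℂ :=
  postMeas (tensorMeas MA MB) (pureState ψ)

/-- The marginal of `σ₃` on the registers `U, V`. -/
def sigma3UV (MA : U → Matrix a a ℂ) (MB : V → Matrix b b ℂ) (ψ : R × (a × b) → ℂ) :
    Matrix (U × V) (U × V) ℂ :=
  trSnd (sigma3 MA MB ψ)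

end AuxiliaryStates

/-- `M_AB` is `M̄_A ⊗ M̄_B` followed by the function `g` (a separable decomposition with
deterministic integration). -/
def IsDeterministicIntegration {a b U V Z : Type*} [Fintype U] [Fintype V] [DecidableEq Z]
    (M : Z → Matrix (a × b) (a × b) ℂ) (MA : U → Matrix a a ℂ) (MB : V → Matrix b b ℂ)
    (g : U × V → Z) : Prop :=
  ∀ z, M z = ∑ u, ∑ v, if g (u, v) = z then MA u ⊗ₖ MB v else 0

/-- The operator `X 0 ⊗ ⋯ ⊗ X (n - 1)` on `(H_A ⊗ H_B)^{⊗ n}`, this space being identified with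
`H_A^{⊗ n} ⊗ H_B^{⊗ n}`. -/
def tensorAB {a b : Type*} {n : ℕ} (X : Fin n → Matrix (a × b) (a × b) ℂ) :
    Matrix ((Fin n → a) × (Fin n → b)) ((Fin n → a) × (Fin n → b)) ℂ :=
  Matrix.of fun p q => ∏ k, X k (p.1 k, p.2 k) (q.1 k, q.2 k)

/-- `ρ^{⊗ n}`. -/
def statePow {a b : Type*} (ρ : Matrix (a × b) (a × b) ℂ) (n : ℕ) :
    Matrix ((Fin n → a) × (Fin n → b)) ((Fin n → a) × (Fin n → b)) ℂ :=
  tensorAB fun _ : Fin n => ρ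

/-- `M^{⊗ n}`, with outcomes in `Zⁿ`. -/
def measPow {a b Z : Type*} (M : Z → Matrix (a × b) (a × b) ℂ) (n : ℕ) :
    (Fin n → Z) → Matrix ((Fin n → a) × (Fin n → b)) ((Fin n → a) × (Fin n → b)) ℂ :=
  fun z => tensorAB fun k => M (z k)

/-- `M'` is `ε`-faithful to `M` with respect to `ρ`. -/
def IsFaithful {ι X : Type*} [Fintype ι] [DecidableEq ι] [Fintype X]
    (ε : ℝ) (M M' : X → Matrix ι ι ℂ) (ρ : Matrix ι ι ℂ) : Prop :=
  ∑ x, traceNorm (CFC.sqrt ρ * (M x - M' x) * CFC.sqrt ρ)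
    + ((1 - ∑ x, M' x) * ρ).trace.re ≤ ε

/-- A distributed protocol with parameters `(n, Θ₁, Θ₂, N)`. The common randomness is `μ : Fin N`,
and the two sets of messages are finite sets of labels of sizes at most `Θ₁` and `Θ₂`. -/
structure Protocol (a b Z : Type*) [Fintype a] [DecidableEq a] [Fintype b] [DecidableEq b]
    (n Θ₁ Θ₂ N : ℕ) where
  L₁ : Finset ℕ
  L₂ : Finset ℕ
  card_L₁ : L₁.card ≤ Θ₁
  card_L₂ : L₂.card ≤ Θ₂
  alice : Fin N → L₁ → Matrix (Fin n → a) (Fin n → a) ℂ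
  bob : Fin N → L₂ → Matrix (Fin n → b) (Fin n → b) ℂ
  alice_subPOVM : ∀ μ, IsSubPOVM (alice μ)
  bob_subPOVM : ∀ μ, IsSubPOVM (bob μ)
  decode : Fin N → L₁ → L₂ → (Fin n → Z)

/-- The operators of the overall sub-POVM of a protocol. -/
def Protocol.overall {a b Z : Type*} [Fintype a] [DecidableEq a] [Fintype b] [DecidableEq b]
    [DecidableEq Z] {n Θ₁ Θ₂ N : ℕ} (P : Protocol a b Z n Θ₁ Θ₂ N) :
    (Fin n → Z) → Matrix ((Fin n → a) × (Fin n → b)) ((Fin n → a) × (Fin n → b)) ℂ :=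
  fun z => (1 / (N : ℂ)) • ∑ μ, ∑ l₁, ∑ l₂,
    if P.decode μ l₁ l₂ = z then P.alice μ l₁ ⊗ₖ P.bob μ l₂ else 0

/-- Achievability of a rate triple for the simulation of `M` on `ρ` with deterministic
processing. -/
def Achievable {a b Z : Type*} [Fintype a] [DecidableEq a] [Fintype b] [DecidableEq b]
    [Fintype Z] [DecidableEq Z] (ρ : Matrix (a × b) (a × b) ℂ)
    (M : Z → Matrix (a × b) (a × b) ℂ) (R₁ R₂ C : ℝ) : Prop :=
  ∀ ε : ℝ, 0 < ε → ∃ n₀ : ℕ, ∀ n : ℕ, n₀ ≤ n →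
    ∃ Θ₁ Θ₂ N : ℕ, 0 < Θ₁ ∧ 0 < Θ₂ ∧ 0 < N ∧
      ∃ P : Protocol a b Z n Θ₁ Θ₂ N,
        IsFaithful ε (measPow M n) P.overall (statePow ρ n) ∧
        1 / (n : ℝ) * Real.logb 2 N ≤ C + ε ∧
        1 / (n : ℝ) * Real.logb 2 Θ₁ ≤ R₁ + ε ∧
        1 / (n : ℝ) * Real.logb 2 Θ₂ ≤ R₂ + ε

end DistMeas

end

/-! Duality. The trace norm of `√ρ A √ρ`, for Hermitian `A`, is `Tr(A Y)` for some `Y` with `-ρ ≤ Y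
≤ ρ`. Faithfulness therefore follows from a linear bound on `∑ Tr((M_z - M'_z) Y_z)`, uniform over
families `Y` dominated by `ρ` (`isFaithful_of_trPair_le`). Measuring one side turns a dominated
family on `AB` into one dominated by the marginal of the other side. The two parties can then be
replaced one after the other, and two marginal simulations give a simulation of the product POVM
(`trPair_kronecker_close`).

One side. Codewords are drawn independently with the outcome probabilities `lam` of the POVM on the
state. The POVM is first trimmed to typical eigenvectors of the state and of the post-measurement
states, which bounds the normalized operators `E x` by `2^{n(I(U;RB)+η)}`
(`SpectralData.exists_isTrimmed`). If `T` is the average of `E` over a codebook, conjugation by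
`2(1+T)⁻¹` always gives a sub-POVM, and the error is controlled by `Tr((1-T)²ρ)`. A second-moment
computation thus replaces an operator Chernoff bound: a codebook of more than `2^{nI(U;RB)}` words
suffices for each value of the common randomness. All codebooks together must also reproduce the
distribution of the outcomes, which takes more than `2^{nS(U)}` words
(`expect_sum_abs_sub_freq_le`).

Binning. Each party sends only the bin of its codeword, and the decoder looks for a jointly typical
pair in the two bins. A wrong pair passes with probability about `2^{-nI(U;V)}`, even if it shares
one codeword with the right pair, so bins with `r₁ + r₂ < I(U;V)` are harmless
(`expect_wrong_pair_le`). All error terms are averaged over the codebooks by `exists_codebooks`, and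
a pair of codebooks no worse than the mean is kept.

Rates. It remains to find `c₁ + c₂ = C` and bin rates `r₁ + r₂ ≤ I(U;V)` with `R_i + r_i` above the
information rate and `c_i + R_i + r_i` above the outcome entropy on each side. `exists_rates` does
this by elimination. It needs `I(U;V) ≥ 0` and that the information about an outcome is at most its
entropy; Holevo's bound is needed besides to see that `R₁` and `R₂` are nonnegative. Holevo's bound
comes from the same trimmed operators: if the classical information were larger, they could not
carry the weight of the jointly typical pairs. The entropies of the auxiliary states become Shannon
entropies because `GGᴴ` and `GᴴG` have the same nonzero spectrum. -/

noncomputable section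

namespace DistMeas

set_option linter.unusedSectionVars false

/-! ### The real trace pairing -/

section Pairing

variable {ι κ X : Type*} [Fintype ι] [DecidableEq ι] [Fintype κ] [DecidableEq κ]

/-- The real part of the trace of a product. -/
def trPair (A B : Matrix ι ι ℂ) : ℝ := (A * B).trace.re

lemma trPair_comm (A B : Matrix ι ι ℂ) : trPair A B = trPair B A := by
  rw [trPair, trPair, Matrix.trace_mul_comm]

lemma trPair_add_left (A B C : Matrix ι ι ℂ) : trPair (A + B) C = trPair A C + trPair B C := by
  simp [trPair, add_mul]

lemma trPair_sub_left (A B C : Matrix ι ι ℂ) : trPair (A - B) C = trPair A C - trPair B C := by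
  simp [trPair, sub_mul]

lemma trPair_sub_right (A B C : Matrix ι ι ℂ) : trPair A (B - C) = trPair A B - trPair A C := by
  simp [trPair, mul_sub]

lemma trPair_neg_right (A B : Matrix ι ι ℂ) : trPair A (-B) = -trPair A B := by
  simp [trPair]

lemma trPair_smul_left (r : ℝ) (A B : Matrix ι ι ℂ) : trPair (r • A) B = r * trPair A B := by
  simp [trPair, Matrix.trace_smul]

@[simp] lemma trPair_zero_left (A : Matrix ι ι ℂ) : trPair 0 A = 0 := by simp [trPair]

@[simp] lemma trPair_zero_right (A : Matrix ι ι ℂ) : trPair A 0 = 0 := by simp [trPair]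

lemma trPair_sum_left (s : Finset X) (A : X → Matrix ι ι ℂ) (B : Matrix ι ι ℂ) :
    trPair (∑ x ∈ s, A x) B = ∑ x ∈ s, trPair (A x) B := by
  simp [trPair, Finset.sum_mul, Matrix.trace_sum]

lemma trPair_sum_right (s : Finset X) (A : X → Matrix ι ι ℂ) (B : Matrix ι ι ℂ) :
    trPair B (∑ x ∈ s, A x) = ∑ x ∈ s, trPair B (A x) := by
  simp [trPair, Finset.mul_sum, Matrix.trace_sum]

lemma exists_conjTranspose_mul_self {A : Matrix ι ι ℂ} (hA : 0 ≤ A) :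
    ∃ F : Matrix ι ι ℂ, A = Fᴴ * F :=
  CStarAlgebra.nonneg_iff_eq_star_mul_self.mp hA

lemma posSemidef_of_nonneg {A : Matrix ι ι ℂ} (hA : 0 ≤ A) : A.PosSemidef :=
  Matrix.nonneg_iff_posSemidef.mp hA

lemma conj_nonneg {A : Matrix ι ι ℂ} (hA : 0 ≤ A) (F : Matrix ι κ ℂ) : 0 ≤ Fᴴ * A * F :=
  ((posSemidef_of_nonneg hA).conjTranspose_mul_mul_same F).nonneg

lemma conj_nonneg' {A : Matrix ι ι ℂ} (hA : 0 ≤ A) (F : Matrix κ ι ℂ) : 0 ≤ F * A * Fᴴ :=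
  ((posSemidef_of_nonneg hA).mul_mul_conjTranspose_same F).nonneg

lemma conjTranspose_mul_self_nonneg (F : Matrix κ ι ℂ) : 0 ≤ Fᴴ * F :=
  (Matrix.posSemidef_conjTranspose_mul_self F).nonneg

lemma conj_mono {A B : Matrix ι ι ℂ} (h : A ≤ B) (F : Matrix ι κ ℂ) :
    Fᴴ * A * F ≤ Fᴴ * B * F := by
  rw [← sub_nonneg] at h ⊢
  simpa [Matrix.mul_sub, Matrix.sub_mul] using conj_nonneg h F

lemma smul_nonneg_of_nonneg {r : ℝ} (hr : 0 ≤ r) {A : Matrix ι ι ℂ} (hA : 0 ≤ A) : 0 ≤ r • A :=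
  ((posSemidef_of_nonneg hA).smul hr).nonneg

lemma smul_mono_right {r : ℝ} (hr : 0 ≤ r) {A B : Matrix ι ι ℂ} (h : A ≤ B) : r • A ≤ r • B := by
  rw [← sub_nonneg] at h ⊢
  simpa [smul_sub] using smul_nonneg_of_nonneg hr h

lemma smul_mono_left {r s : ℝ} (h : r ≤ s) {A : Matrix ι ι ℂ} (hA : 0 ≤ A) : r • A ≤ s • A := by
  rw [← sub_nonneg, ← sub_smul]
  exact smul_nonneg_of_nonneg (sub_nonneg.mpr h) hA

lemma conjTranspose_eq_of_nonneg {A : Matrix ι ι ℂ} (hA : 0 ≤ A) : Aᴴ = A := (posSemidef_of_nonneg hA).1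

lemma trPair_nonneg {A B : Matrix ι ι ℂ} (hA : 0 ≤ A) (hB : 0 ≤ B) : 0 ≤ trPair A B := by
  obtain ⟨F, rfl⟩ := exists_conjTranspose_mul_self hA
  have h := (posSemidef_of_nonneg (conj_nonneg' hB F)).trace_nonneg
  rw [trPair, Matrix.mul_assoc, Matrix.trace_mul_comm]
  exact (Complex.le_def.mp h).1

lemma trPair_mono_left {A B C : Matrix ι ι ℂ} (h : A ≤ B) (hC : 0 ≤ C) :
    trPair A C ≤ trPair B C := by
  have := trPair_nonneg (sub_nonneg.mpr h) hC
  rw [trPair_sub_left] at this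
  linarith

lemma trPair_mono_right {A B C : Matrix ι ι ℂ} (h : A ≤ B) (hC : 0 ≤ C) :
    trPair C A ≤ trPair C B := by
  rw [trPair_comm C, trPair_comm C]
  exact trPair_mono_left h hC

/-- `-ρ ≤ Y ≤ ρ`; these `Y` are the operators `√ρ K √ρ` with `K` a Hermitian contraction. -/
def IsDominated (Y ρ : Matrix ι ι ℂ) : Prop := -ρ ≤ Y ∧ Y ≤ ρ

lemma isDominated_self {ρ : Matrix ι ι ℂ} (hρ : 0 ≤ ρ) : IsDominated ρ ρ :=
  ⟨(neg_nonpos.mpr hρ).trans hρ, le_rfl⟩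

lemma isDominated_zero {ρ : Matrix ι ι ℂ} (hρ : 0 ≤ ρ) : IsDominated 0 ρ :=
  ⟨neg_nonpos.mpr hρ, hρ⟩

lemma IsDominated.neg {Y ρ : Matrix ι ι ℂ} (h : IsDominated Y ρ) : IsDominated (-Y) ρ :=
  ⟨neg_le_neg h.2, neg_le.mp h.1⟩

/-- Adding `Tr((B - A)(ρ + Y)) ≥ 0` and `Tr((B + A)(ρ - Y)) ≥ 0` cancels the cross terms. -/
lemma trPair_le_of_dominated {A B Y ρ : Matrix ι ι ℂ} (hA : IsDominated A B)
    (hY : IsDominated Y ρ) : trPair A Y ≤ trPair B ρ := by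
  have h1 := trPair_nonneg (sub_nonneg.mpr hA.2) (sub_nonneg.mpr hY.1)
  have h2 := trPair_nonneg (sub_nonneg.mpr hA.1) (sub_nonneg.mpr hY.2)
  have h3 (C : Matrix ι ι ℂ) : trPair (-B) C = -trPair B C := by simp [trPair]
  rw [trPair_sub_left, trPair_sub_right, trPair_sub_right, trPair_neg_right, trPair_neg_right] at h1
  rw [trPair_sub_left, trPair_sub_right, trPair_sub_right, h3, h3] at h2
  linarith

lemma trPair_le_self {A Y ρ : Matrix ι ι ℂ} (hA : 0 ≤ A) (hY : IsDominated Y ρ) :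
    trPair A Y ≤ trPair A ρ :=
  trPair_le_of_dominated (isDominated_self hA) hY

/-- Replacing `F` by `F - D` perturbs `Fᴴ F` little, if `Dᴴ D` is small. -/
lemma isDominated_gram_sub (F D : Matrix κ ι ℂ) {t : ℝ} (ht : 0 < t) :
    IsDominated (Fᴴ * F - (F - D)ᴴ * (F - D)) (t • (Fᴴ * F) + (t⁻¹ + 1) • (Dᴴ * D)) := by
  -- With `t = s²`, the two halves come from the squares of `s F ± s⁻¹ D`. The extra `+1` in the
  -- coefficient of `Dᴴ D` absorbs the quadratic term of the perturbation.
  obtain ⟨s, hs, rfl⟩ : ∃ s : ℝ, 0 < s ∧ t = s ^ 2 := ⟨√t, Real.sqrt_pos.mpr ht,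
    (Real.sq_sqrt ht.le).symm⟩
  have hc (r : ℝ) (A : Matrix κ ι ℂ) : (r • A)ᴴ = r • Aᴴ := by
    simp [Matrix.conjTranspose_smul]
  have hss : s * s⁻¹ = 1 := mul_inv_cancel₀ hs.ne'
  have hss' : s⁻¹ * s = 1 := inv_mul_cancel₀ hs.ne'
  have h1 : 0 ≤ (s • F - s⁻¹ • D)ᴴ * (s • F - s⁻¹ • D) := conjTranspose_mul_self_nonneg _
  have h2 : 0 ≤ (s • F + s⁻¹ • D)ᴴ * (s • F + s⁻¹ • D) := conjTranspose_mul_self_nonneg _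
  have h3 := conjTranspose_mul_self_nonneg D
  simp only [Matrix.conjTranspose_sub, Matrix.conjTranspose_add, hc, Matrix.sub_mul,
    Matrix.mul_sub, Matrix.add_mul, Matrix.mul_add, Matrix.smul_mul, Matrix.mul_smul, smul_sub, smul_add,
    smul_smul, hss, hss', one_smul] at h1 h2
  constructor
  · rw [← sub_nonneg]
    refine (add_nonneg h2 (smul_nonneg_of_nonneg (r := 0) le_rfl h3)).trans_eq ?_
    simp only [Matrix.conjTranspose_sub, Matrix.sub_mul, Matrix.mul_sub, add_smul, one_smul,
      sq, mul_inv]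
    module
  · rw [← sub_nonneg]
    refine (add_nonneg h1 (smul_nonneg_of_nonneg (r := 2) (by norm_num) h3)).trans_eq ?_
    simp only [Matrix.conjTranspose_sub, Matrix.sub_mul, Matrix.mul_sub, add_smul, one_smul,
      sq, mul_inv]
    module

/-- Parallelogram law: the difference of the two sides is `(F - G)ᴴ (F - G)`. -/
lemma conj_le_two_smul (F G : Matrix κ ι ℂ) :
    (F + G)ᴴ * (F + G) ≤ (2 : ℝ) • (Fᴴ * F) + (2 : ℝ) • (Gᴴ * G) := by
  rw [← sub_nonneg]
  refine (conjTranspose_mul_self_nonneg (F - G)).trans_eq ?_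
  simp only [Matrix.conjTranspose_sub, Matrix.conjTranspose_add, Matrix.sub_mul, Matrix.mul_sub,
    Matrix.add_mul, Matrix.mul_add]
  module

end Pairing

/-! ### Operators diagonal in a given basis -/

section Diagonal

variable {ι κ : Type*} [Fintype ι] [DecidableEq ι] [Fintype κ] [DecidableEq κ]

/-- The operator with eigenvalues `d` on the columns of `V`. -/
def diagIn (V : Matrix ι ι ℂ) (d : ι → ℝ) : Matrix ι ι ℂ :=
  V * Matrix.diagonal (fun i => (d i : ℂ)) * Vᴴ

lemma exists_eq_diagIn {A : Matrix ι ι ℂ} (hA : A.IsHermitian) :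
    ∃ (V : Matrix ι ι ℂ) (d : ι → ℝ), Vᴴ * V = 1 ∧ A = diagIn V d := by
  refine ⟨hA.eigenvectorUnitary, hA.eigenvalues, ?_, ?_⟩
  · exact (Unitary.mem_iff.mp hA.eigenvectorUnitary.2).1
  · conv_lhs => rw [hA.spectral_theorem]
    rw [Unitary.conjStarAlgAut_apply]
    rfl

variable {V : Matrix ι ι ℂ}

lemma mul_conjTranspose_of_isometry (hV : Vᴴ * V = 1) : V * Vᴴ = 1 :=
  mul_eq_one_comm.mp hV

lemma diagIn_mul (hV : Vᴴ * V = 1) (d e : ι → ℝ) :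
    diagIn V d * diagIn V e = diagIn V (fun i => d i * e i) := by
  have : diagIn V d * diagIn V e = V * Matrix.diagonal (fun i => (d i : ℂ)) * (Vᴴ * V) *
      Matrix.diagonal (fun i => (e i : ℂ)) * Vᴴ := by
    simp only [diagIn, Matrix.mul_assoc]
  rw [this, hV, Matrix.mul_one, Matrix.mul_assoc V, Matrix.diagonal_mul_diagonal]
  simp [diagIn]

lemma diagIn_one (hV : Vᴴ * V = 1) : diagIn V (fun _ => 1) = 1 := by
  simp [diagIn, mul_conjTranspose_of_isometry hV]

lemma diagIn_sub (d e : ι → ℝ) :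
    diagIn V d - diagIn V e = diagIn V (fun i => d i - e i) := by
  rw [diagIn, diagIn, diagIn, ← Matrix.sub_mul, ← Matrix.mul_sub, Matrix.diagonal_sub]
  simp

lemma diagIn_neg (d : ι → ℝ) : -diagIn V d = diagIn V (fun i => -d i) := by
  rw [diagIn, diagIn, ← Matrix.neg_mul, ← Matrix.mul_neg, Matrix.diagonal_neg]
  congr 3
  ext i
  simp

lemma smul_diagIn (r : ℝ) (d : ι → ℝ) : r • diagIn V d = diagIn V (fun i => r * d i) := by
  rw [diagIn, diagIn, ← Matrix.smul_mul, ← Matrix.mul_smul, ← Matrix.diagonal_smul]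
  congr 3
  ext i
  simp

lemma diagIn_nonneg {d : ι → ℝ} (hd : ∀ i, 0 ≤ d i) : 0 ≤ diagIn V d := by
  refine conj_nonneg' (Matrix.PosSemidef.nonneg ?_) V
  exact Matrix.PosSemidef.diagonal fun i => by simpa using hd i

lemma diagIn_mono {d e : ι → ℝ} (h : ∀ i, d i ≤ e i) : diagIn V d ≤ diagIn V e := by
  rw [← sub_nonneg, diagIn_sub]
  exact diagIn_nonneg fun i => sub_nonneg.mpr (h i)

lemma nonneg_of_diagIn_nonneg (hV : Vᴴ * V = 1) {d : ι → ℝ} (h : 0 ≤ diagIn V d) (i : ι) :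
    0 ≤ d i := by
  have h1 := conj_nonneg h V
  have h2 : Vᴴ * diagIn V d * V = Matrix.diagonal (fun i => (d i : ℂ)) := by
    have : Vᴴ * diagIn V d * V = (Vᴴ * V) * Matrix.diagonal (fun i => (d i : ℂ)) * (Vᴴ * V) := by
      simp only [diagIn, Matrix.mul_assoc]
    rw [this, hV, Matrix.one_mul, Matrix.mul_one]
  rw [h2] at h1
  have h3 := (posSemidef_of_nonneg h1).diag_nonneg (i := i)
  rw [Matrix.diagonal_apply_eq] at h3
  exact_mod_cast h3

lemma trace_diagIn (hV : Vᴴ * V = 1) (d : ι → ℝ) : (diagIn V d).trace = ∑ i, (d i : ℂ) := by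
  rw [diagIn, Matrix.trace_mul_comm, ← Matrix.mul_assoc, hV, Matrix.one_mul, Matrix.trace_diagonal]

lemma trPair_diagIn (hV : Vᴴ * V = 1) (d e : ι → ℝ) :
    trPair (diagIn V d) (diagIn V e) = ∑ i, d i * e i := by
  rw [trPair, diagIn_mul hV, trace_diagIn hV, ← Complex.ofReal_sum, Complex.ofReal_re]

lemma conjTranspose_diagIn (d : ι → ℝ) : (diagIn V d)ᴴ = diagIn V d := by
  simp only [diagIn, Matrix.conjTranspose_mul, Matrix.conjTranspose_conjTranspose,
    Matrix.diagonal_conjTranspose, Matrix.mul_assoc]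
  congr 3
  ext i
  simp

end Diagonal

/-! ### Trace norm and dominated operators -/

section TraceNorm

variable {ι : Type*} [Fintype ι] [DecidableEq ι]

lemma traceNorm_diagIn {V : Matrix ι ι ℂ} (hV : Vᴴ * V = 1) (d : ι → ℝ) :
    traceNorm (diagIn V d) = ∑ i, |d i| := by
  have h : CFC.sqrt ((diagIn V d)ᴴ * diagIn V d) = diagIn V (fun i => |d i|) := by
    refine CFC.sqrt_unique ?_ (diagIn_nonneg fun i => abs_nonneg _)
    rw [conjTranspose_diagIn, diagIn_mul hV, diagIn_mul hV]
    simp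
  rw [traceNorm, h, trace_diagIn hV, ← Complex.ofReal_sum, Complex.ofReal_re]

/-- The trace norm of a Hermitian operator is its pairing with its own sign `K`, a contraction.
Cyclicity moves the two square roots from `A` to `K`, and `√ρ K √ρ` is dominated by `ρ`. -/
lemma exists_dominated_traceNorm {ρ A : Matrix ι ι ℂ} (hρ : 0 ≤ ρ) (hA : A.IsHermitian) :
    ∃ Y, IsDominated Y ρ ∧ traceNorm (CFC.sqrt ρ * A * CFC.sqrt ρ) = trPair A Y := by
  set S := CFC.sqrt ρ
  have hS : 0 ≤ S := CFC.sqrt_nonneg ρ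
  have hSS : S * S = ρ := CFC.sqrt_mul_sqrt_self ρ hρ
  have hSh : Sᴴ = S := conjTranspose_eq_of_nonneg hS
  have hZ : (S * A * S).IsHermitian := by
    rw [Matrix.IsHermitian, Matrix.conjTranspose_mul, Matrix.conjTranspose_mul, hSh, hA,
      Matrix.mul_assoc]
  obtain ⟨V, d, hV, hd⟩ := exists_eq_diagIn hZ
  set K := diagIn V (fun i => (SignType.sign (d i) : ℝ))
  have hs (i : ι) : -1 ≤ (SignType.sign (d i) : ℝ) ∧ (SignType.sign (d i) : ℝ) ≤ 1 := by
    rcases SignType.trichotomy (SignType.sign (d i)) with h | h | h <;> simp [h]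
  have hK1 : K ≤ 1 := by
    rw [← diagIn_one hV]
    exact diagIn_mono fun i => (hs i).2
  have hK2 : -1 ≤ K := by
    rw [← diagIn_one hV, diagIn_neg]
    exact diagIn_mono fun i => (hs i).1
  refine ⟨S * K * S, ⟨?_, ?_⟩, ?_⟩
  · have := conj_mono hK2 S
    rwa [hSh, Matrix.mul_neg, Matrix.neg_mul, Matrix.mul_one, hSS] at this
  · have := conj_mono hK1 S
    rwa [hSh, Matrix.mul_one, hSS] at this
  · have h1 : trPair A (S * K * S) = trPair (S * A * S) K := by
      rw [trPair, trPair, ← Matrix.mul_assoc, Matrix.trace_mul_comm]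
      simp only [Matrix.mul_assoc]
    rw [h1, hd, traceNorm_diagIn hV, trPair_diagIn hV]
    simp

end TraceNorm

/-! ### Partial traces -/

section PartialTrace

variable {ι κ X : Type*} [Fintype ι] [DecidableEq ι] [Fintype κ] [DecidableEq κ]

/-- The operator on the first factor that is left when `N` is measured on the second factor. -/
def condFst (N : Matrix κ κ ℂ) (Y : Matrix (ι × κ) (ι × κ) ℂ) : Matrix ι ι ℂ :=
  trSnd (((1 : Matrix ι ι ℂ) ⊗ₖ N) * Y)

/-- The operator on the second factor that is left when `N` is measured on the first factor. -/
def condSnd (N : Matrix ι ι ℂ) (Y : Matrix (ι × κ) (ι × κ) ℂ) : Matrix κ κ ℂ :=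
  trFst ((N ⊗ₖ (1 : Matrix κ κ ℂ)) * Y)

lemma trace_mul_trSnd (A : Matrix ι ι ℂ) (Y : Matrix (ι × κ) (ι × κ) ℂ) :
    (A * trSnd Y).trace = ((A ⊗ₖ (1 : Matrix κ κ ℂ)) * Y).trace := by
  simp only [Matrix.trace, Matrix.diag_apply, Matrix.mul_apply, trSnd, Matrix.of_apply,
    Fintype.sum_prod_type, Matrix.kroneckerMap_apply, Matrix.one_apply, Finset.mul_sum, mul_ite,
    mul_one, mul_zero, ite_mul, zero_mul, Finset.sum_ite_eq, Finset.mem_univ, if_true]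
  exact Finset.sum_congr rfl fun i _ => Finset.sum_comm

lemma trace_mul_trFst (A : Matrix κ κ ℂ) (Y : Matrix (ι × κ) (ι × κ) ℂ) :
    (A * trFst Y).trace = (((1 : Matrix ι ι ℂ) ⊗ₖ A) * Y).trace := by
  simp only [Matrix.trace, Matrix.diag_apply, Matrix.mul_apply, trFst, Matrix.of_apply,
    Fintype.sum_prod_type, Matrix.kroneckerMap_apply, Matrix.one_apply, Finset.mul_sum, ite_mul,
    one_mul, zero_mul, Finset.sum_ite_irrel, Finset.sum_const_zero, Finset.sum_ite_eq,
    Finset.mem_univ, if_true]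
  rw [Finset.sum_comm (s := Finset.univ (α := ι))]
  exact Finset.sum_congr rfl fun k _ => Finset.sum_comm

lemma trPair_condFst (A : Matrix ι ι ℂ) (N : Matrix κ κ ℂ) (Y : Matrix (ι × κ) (ι × κ) ℂ) :
    trPair A (condFst N Y) = trPair (A ⊗ₖ N) Y := by
  rw [trPair, condFst, trace_mul_trSnd, ← Matrix.mul_assoc, ← Matrix.mul_kronecker_mul,
    Matrix.mul_one, Matrix.one_mul, trPair]

lemma trPair_condSnd (A : Matrix ι ι ℂ) (N : Matrix κ κ ℂ) (Y : Matrix (ι × κ) (ι × κ) ℂ) :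
    trPair N (condSnd A Y) = trPair (A ⊗ₖ N) Y := by
  rw [trPair, condSnd, trace_mul_trFst, ← Matrix.mul_assoc, ← Matrix.mul_kronecker_mul,
    Matrix.mul_one, Matrix.one_mul, trPair]

lemma trSnd_nonneg {Y : Matrix (ι × κ) (ι × κ) ℂ} (hY : 0 ≤ Y) : 0 ≤ trSnd Y := by
  have h : trSnd Y = ∑ k, Y.submatrix (fun i => (i, k)) (fun i => (i, k)) := by
    ext i j
    simp [trSnd, Matrix.sum_apply]
  rw [h]
  exact Finset.sum_nonneg fun k _ => ((posSemidef_of_nonneg hY).submatrix _).nonneg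

lemma trFst_nonneg {Y : Matrix (ι × κ) (ι × κ) ℂ} (hY : 0 ≤ Y) : 0 ≤ trFst Y := by
  have h : trFst Y = ∑ i, Y.submatrix (fun k => (i, k)) (fun k => (i, k)) := by
    ext i j
    simp [trFst, Matrix.sum_apply]
  rw [h]
  exact Finset.sum_nonneg fun k _ => ((posSemidef_of_nonneg hY).submatrix _).nonneg

/-- Cyclicity on the traced-out factor: half of `Cᴴ C` moves to the other side of `Y`, so that
positivity in `Y` becomes visible. -/
lemma condFst_gram (C : Matrix κ κ ℂ) (Y : Matrix (ι × κ) (ι × κ) ℂ) :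
    condFst (Cᴴ * C) Y =
      trSnd (((1 : Matrix ι ι ℂ) ⊗ₖ C) * Y * ((1 : Matrix ι ι ℂ) ⊗ₖ C)ᴴ) := by
  refine Matrix.ext_iff_trace_mul_left.mpr fun A => ?_
  rw [condFst, trace_mul_trSnd, trace_mul_trSnd, ← Matrix.mul_assoc,
    ← Matrix.mul_assoc _ _ (_ᴴ), Matrix.trace_mul_comm _ (_ᴴ), ← Matrix.mul_assoc,
    ← Matrix.mul_assoc, Matrix.conjTranspose_kronecker]
  simp only [← Matrix.mul_kronecker_mul, Matrix.mul_one, Matrix.one_mul,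
    Matrix.conjTranspose_one]

lemma condSnd_gram (C : Matrix ι ι ℂ) (Y : Matrix (ι × κ) (ι × κ) ℂ) :
    condSnd (Cᴴ * C) Y =
      trFst ((C ⊗ₖ (1 : Matrix κ κ ℂ)) * Y * (C ⊗ₖ (1 : Matrix κ κ ℂ))ᴴ) := by
  refine Matrix.ext_iff_trace_mul_left.mpr fun A => ?_
  rw [condSnd, trace_mul_trFst, trace_mul_trFst, ← Matrix.mul_assoc,
    ← Matrix.mul_assoc _ _ (_ᴴ), Matrix.trace_mul_comm _ (_ᴴ), ← Matrix.mul_assoc,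
    ← Matrix.mul_assoc, Matrix.conjTranspose_kronecker]
  simp only [← Matrix.mul_kronecker_mul, Matrix.mul_one, Matrix.one_mul,
    Matrix.conjTranspose_one]

lemma condFst_nonneg {N : Matrix κ κ ℂ} {Y : Matrix (ι × κ) (ι × κ) ℂ} (hN : 0 ≤ N)
    (hY : 0 ≤ Y) : 0 ≤ condFst N Y := by
  obtain ⟨C, rfl⟩ := exists_conjTranspose_mul_self hN
  rw [condFst_gram]
  exact trSnd_nonneg (conj_nonneg' hY _)

lemma condSnd_nonneg {N : Matrix ι ι ℂ} {Y : Matrix (ι × κ) (ι × κ) ℂ} (hN : 0 ≤ N)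
    (hY : 0 ≤ Y) : 0 ≤ condSnd N Y := by
  obtain ⟨C, rfl⟩ := exists_conjTranspose_mul_self hN
  rw [condSnd_gram]
  exact trFst_nonneg (conj_nonneg' hY _)

lemma kronecker_nonneg {A : Matrix ι ι ℂ} {B : Matrix κ κ ℂ} (hA : 0 ≤ A) (hB : 0 ≤ B) :
    0 ≤ A ⊗ₖ B :=
  ((posSemidef_of_nonneg hA).kronecker (posSemidef_of_nonneg hB)).nonneg

lemma condFst_add_right (N : Matrix κ κ ℂ) (Y Y' : Matrix (ι × κ) (ι × κ) ℂ) :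
    condFst N (Y + Y') = condFst N Y + condFst N Y' := by
  ext i j
  simp [condFst, trSnd, Matrix.mul_add, Finset.sum_add_distrib]

lemma condSnd_add_right (N : Matrix ι ι ℂ) (Y Y' : Matrix (ι × κ) (ι × κ) ℂ) :
    condSnd N (Y + Y') = condSnd N Y + condSnd N Y' := by
  ext i j
  simp [condSnd, trFst, Matrix.mul_add, Finset.sum_add_distrib]

lemma condFst_sub_right (N : Matrix κ κ ℂ) (Y Y' : Matrix (ι × κ) (ι × κ) ℂ) :
    condFst N (Y - Y') = condFst N Y - condFst N Y' := by
  ext i j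
  simp [condFst, trSnd, Matrix.mul_sub, Finset.sum_sub_distrib]

lemma condSnd_sub_right (N : Matrix ι ι ℂ) (Y Y' : Matrix (ι × κ) (ι × κ) ℂ) :
    condSnd N (Y - Y') = condSnd N Y - condSnd N Y' := by
  ext i j
  simp [condSnd, trFst, Matrix.mul_sub, Finset.sum_sub_distrib]

lemma condFst_sum_left (s : Finset X) (N : X → Matrix κ κ ℂ) (Y : Matrix (ι × κ) (ι × κ) ℂ) :
    condFst (∑ x ∈ s, N x) Y = ∑ x ∈ s, condFst (N x) Y := by
  refine Matrix.ext_iff_trace_mul_left.mpr fun A => ?_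
  simp only [Finset.mul_sum, Matrix.trace_sum, condFst, trace_mul_trSnd, ← Matrix.mul_assoc,
    ← Matrix.mul_kronecker_mul, Matrix.mul_one, Matrix.one_mul]
  rw [← Matrix.trace_sum, ← Finset.sum_mul]
  congr 2
  ext ⟨i, k⟩ ⟨j, l⟩
  simp [Matrix.sum_apply, Finset.mul_sum]

lemma condSnd_sum_left (s : Finset X) (N : X → Matrix ι ι ℂ) (Y : Matrix (ι × κ) (ι × κ) ℂ) :
    condSnd (∑ x ∈ s, N x) Y = ∑ x ∈ s, condSnd (N x) Y := by
  refine Matrix.ext_iff_trace_mul_left.mpr fun A => ?_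
  simp only [Finset.mul_sum, Matrix.trace_sum, condSnd, trace_mul_trFst, ← Matrix.mul_assoc,
    ← Matrix.mul_kronecker_mul, Matrix.mul_one, Matrix.one_mul]
  rw [← Matrix.trace_sum, ← Finset.sum_mul]
  congr 2
  ext ⟨i, k⟩ ⟨j, l⟩
  simp [Matrix.sum_apply, Finset.sum_mul]

lemma condFst_mono_left {N N' : Matrix κ κ ℂ} {Y : Matrix (ι × κ) (ι × κ) ℂ} (h : N ≤ N')
    (hY : 0 ≤ Y) : condFst N Y ≤ condFst N' Y := by
  have h1 := condFst_nonneg (sub_nonneg.mpr h) hY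
  have h2 : condFst N' Y = condFst N Y + condFst (N' - N) Y := by
    have := condFst_sum_left (Finset.univ : Finset (Fin 2)) ![N, N' - N] Y
    simpa [Fin.sum_univ_two] using this
  rw [h2]
  exact le_add_of_nonneg_right h1

lemma condSnd_mono_left {N N' : Matrix ι ι ℂ} {Y : Matrix (ι × κ) (ι × κ) ℂ} (h : N ≤ N')
    (hY : 0 ≤ Y) : condSnd N Y ≤ condSnd N' Y := by
  have h1 := condSnd_nonneg (sub_nonneg.mpr h) hY
  have h2 : condSnd N' Y = condSnd N Y + condSnd (N' - N) Y := by
    have := condSnd_sum_left (Finset.univ : Finset (Fin 2)) ![N, N' - N] Y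
    simpa [Fin.sum_univ_two] using this
  rw [h2]
  exact le_add_of_nonneg_right h1

lemma condFst_one (Y : Matrix (ι × κ) (ι × κ) ℂ) : condFst 1 Y = trSnd Y := by
  simp [condFst]

lemma condSnd_one (Y : Matrix (ι × κ) (ι × κ) ℂ) : condSnd 1 Y = trFst Y := by
  simp [condSnd]

/-- Measuring a sub-POVM on the second factor maps dominated families to dominated operators. -/
lemma isDominated_sum_condFst [Fintype X] {N : X → Matrix κ κ ℂ} (hN : ∀ x, 0 ≤ N x)
    (hN1 : ∑ x, N x ≤ 1) {ρ : Matrix (ι × κ) (ι × κ) ℂ} (hρ : 0 ≤ ρ)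
    {Y : X → Matrix (ι × κ) (ι × κ) ℂ} (hY : ∀ x, IsDominated (Y x) ρ) :
    IsDominated (∑ x, condFst (N x) (Y x)) (trSnd ρ) := by
  have h1 : ∑ x, condFst (N x) ρ ≤ trSnd ρ := by
    rw [← condFst_sum_left, ← condFst_one]
    exact condFst_mono_left hN1 hρ
  constructor
  · refine (neg_le_neg h1).trans ?_
    rw [← Finset.sum_neg_distrib]
    refine Finset.sum_le_sum fun x _ => ?_
    have := condFst_nonneg (hN x) (sub_nonneg.mpr (hY x).1)
    rw [sub_neg_eq_add, condFst_add_right] at this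
    exact neg_le_iff_add_nonneg.mpr this
  · refine le_trans (Finset.sum_le_sum fun x _ => ?_) h1
    have := condFst_nonneg (hN x) (sub_nonneg.mpr (hY x).2)
    rw [condFst_sub_right] at this
    exact sub_nonneg.mp this

lemma isDominated_sum_condSnd [Fintype X] {N : X → Matrix ι ι ℂ} (hN : ∀ x, 0 ≤ N x)
    (hN1 : ∑ x, N x ≤ 1) {ρ : Matrix (ι × κ) (ι × κ) ℂ} (hρ : 0 ≤ ρ)
    {Y : X → Matrix (ι × κ) (ι × κ) ℂ} (hY : ∀ x, IsDominated (Y x) ρ) :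
    IsDominated (∑ x, condSnd (N x) (Y x)) (trFst ρ) := by
  have h1 : ∑ x, condSnd (N x) ρ ≤ trFst ρ := by
    rw [← condSnd_sum_left, ← condSnd_one]
    exact condSnd_mono_left hN1 hρ
  constructor
  · refine (neg_le_neg h1).trans ?_
    rw [← Finset.sum_neg_distrib]
    refine Finset.sum_le_sum fun x _ => ?_
    have := condSnd_nonneg (hN x) (sub_nonneg.mpr (hY x).1)
    rw [sub_neg_eq_add, condSnd_add_right] at this
    exact neg_le_iff_add_nonneg.mpr this
  · refine le_trans (Finset.sum_le_sum fun x _ => ?_) h1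
    have := condSnd_nonneg (hN x) (sub_nonneg.mpr (hY x).2)
    rw [condSnd_sub_right] at this
    exact sub_nonneg.mp this

end PartialTrace

/-! ### Expectations over independent samples -/

section Expectation

variable {I L X : Type*} [Fintype I] [DecidableEq I] [Fintype L] [DecidableEq L] [Fintype X]
  [DecidableEq X]

/-- The expectation of `φ` over families of independent samples from the weights `p`. -/
def expect (p : X → ℝ) (φ : (I → X) → ℝ) : ℝ := ∑ c : I → X, (∏ i, p (c i)) * φ c

lemma expect_add (p : X → ℝ) (φ χ : (I → X) → ℝ) :
    expect p (fun c => φ c + χ c) = expect p φ + expect p χ := by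
  simp [expect, mul_add, Finset.sum_add_distrib]

lemma expect_sub (p : X → ℝ) (φ χ : (I → X) → ℝ) :
    expect p (fun c => φ c - χ c) = expect p φ - expect p χ := by
  simp [expect, mul_sub, Finset.sum_sub_distrib]

lemma expect_const_mul (p : X → ℝ) (r : ℝ) (φ : (I → X) → ℝ) :
    expect p (fun c => r * φ c) = r * expect p φ := by
  simp only [expect, Finset.mul_sum]
  exact Finset.sum_congr rfl fun c _ => by ring

lemma expect_sum {J : Type*} (p : X → ℝ) (s : Finset J) (φ : J → (I → X) → ℝ) :
    expect p (fun c => ∑ j ∈ s, φ j c) = ∑ j ∈ s, expect p (φ j) := by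
  simp only [expect, Finset.mul_sum]
  exact Finset.sum_comm

lemma expect_mono {p : X → ℝ} (hp : ∀ x, 0 ≤ p x) {φ χ : (I → X) → ℝ} (h : ∀ c, φ c ≤ χ c) :
    expect p φ ≤ expect p χ :=
  Finset.sum_le_sum fun c _ => mul_le_mul_of_nonneg_left (h c) (Finset.prod_nonneg fun _ _ => hp _)

lemma expect_prod (p : X → ℝ) (f : I → X → ℝ) :
    expect p (fun c => ∏ i, f i (c i)) = ∏ i, ∑ x, p x * f i x := by
  simp only [expect, ← Finset.prod_mul_distrib]
  rw [Finset.prod_univ_sum, Fintype.piFinset_univ]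

variable {p : X → ℝ}

lemma expect_const (hp1 : ∑ x, p x = 1) (r : ℝ) : expect p (fun _ : I → X => r) = r := by
  have h := expect_prod (I := I) p (fun _ _ => 1)
  simp only [Finset.prod_const_one, mul_one, hp1] at h
  have h2 := expect_const_mul (I := I) p r (fun _ => 1)
  rw [h] at h2
  simpa using h2

lemma expect_indicator (hp1 : ∑ x, p x = 1) (i : I) (a : X) :
    expect p (fun c : I → X => if c i = a then 1 else 0) = p a := by
  have h := expect_prod (I := I) p (fun j x => if j = i then (if x = a then 1 else 0) else 1)
  have h1 (c : I → X) : (∏ j, if j = i then (if c j = a then (1 : ℝ) else 0) else 1) =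
      if c i = a then 1 else 0 := by
    rw [Finset.prod_ite_eq' Finset.univ i (fun j => if c j = a then (1 : ℝ) else 0)]
    simp
  simp only [h1] at h
  rw [h, Finset.prod_eq_single i (fun j _ hj => by simp [hj, hp1]) (by simp)]
  simp

lemma expect_indicator_pair (hp1 : ∑ x, p x = 1) {i j : I} (hij : i ≠ j) (a b : X) :
    expect p (fun c : I → X => (if c i = a then 1 else 0) * (if c j = b then 1 else 0)) =
      p a * p b := by
  have h := expect_prod (I := I) p (fun k x => (if k = i then (if x = a then 1 else 0) else 1) *
    (if k = j then (if x = b then 1 else 0) else 1))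
  have h1 (c : I → X) : (∏ k, (if k = i then (if c k = a then (1 : ℝ) else 0) else 1) *
      (if k = j then (if c k = b then (1 : ℝ) else 0) else 1)) =
      (if c i = a then 1 else 0) * (if c j = b then 1 else 0) := by
    rw [Finset.prod_mul_distrib,
      Finset.prod_ite_eq' Finset.univ i (fun k => if c k = a then (1 : ℝ) else 0),
      Finset.prod_ite_eq' Finset.univ j (fun k => if c k = b then (1 : ℝ) else 0)]
    simp
  simp only [h1] at h
  rw [h, Finset.prod_eq_mul i j hij (fun k _ hk => by simp [hk.1, hk.2, hp1]) (by simp) (by simp)]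
  simp [hij, hij.symm]

lemma expect_apply (hp1 : ∑ x, p x = 1) (i : I) (φ : X → ℝ) :
    expect p (fun c : I → X => φ (c i)) = ∑ x, p x * φ x := by
  have h (c : I → X) : φ (c i) = ∑ a, φ a * (if c i = a then 1 else 0) := by simp
  simp only [h, expect_sum, expect_const_mul, expect_indicator hp1]
  simp [mul_comm]

lemma expect_apply_pair (hp1 : ∑ x, p x = 1) {i j : I} (hij : i ≠ j) (φ : X → X → ℝ) :
    expect p (fun c : I → X => φ (c i) (c j)) = ∑ x, ∑ y, p x * p y * φ x y := by
  have h (c : I → X) : φ (c i) (c j) =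
      ∑ a, ∑ b, φ a b * ((if c i = a then 1 else 0) * (if c j = b then 1 else 0)) := by simp
  simp only [h, expect_sum, expect_const_mul, expect_indicator_pair hp1 hij]
  simp [mul_comm]

/-- Second moments of sums over independent samples. -/
lemma expect_sum_pair (hp1 : ∑ x, p x = 1) {e : L → I} (he : Function.Injective e)
    (φ : X → X → ℝ) :
    expect p (fun c : I → X => ∑ l, ∑ m, φ (c (e l)) (c (e m))) =
      Fintype.card L * ∑ x, p x * φ x x +
        (Fintype.card L * (Fintype.card L - 1 : ℝ)) * ∑ x, ∑ y, p x * p y * φ x y := by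
  simp only [expect_sum]
  have h (l m : L) : expect p (fun c : I → X => φ (c (e l)) (c (e m))) =
      (∑ x, ∑ y, p x * p y * φ x y) +
        if l = m then (∑ x, p x * φ x x) - ∑ x, ∑ y, p x * p y * φ x y else 0 := by
    split_ifs with hlm
    · subst hlm
      rw [expect_apply hp1 (e l) (fun x => φ x x)]
      ring
    · rw [expect_apply_pair hp1 (fun h => hlm (he h)), add_zero]
  simp only [h, Finset.sum_add_distrib, Finset.sum_ite_eq, Finset.mem_univ, if_true,
    Finset.sum_const, Finset.card_univ, nsmul_eq_mul]
  ring

lemma expect_sq_sum (hp1 : ∑ x, p x = 1) (f : X → ℝ) (hf : ∑ x, p x * f x = 0) :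
    expect p (fun c : I → X => (∑ i, f (c i)) ^ 2) =
      Fintype.card I * ∑ x, p x * f x ^ 2 := by
  have h := expect_sum_pair hp1 (e := (id : I → I)) Function.injective_id (fun x y => f x * f y)
  have h1 : ∑ x, ∑ y, p x * p y * (f x * f y) = 0 := by
    have : ∑ x, ∑ y, p x * p y * (f x * f y) = (∑ x, p x * f x) * ∑ y, p y * f y := by
      rw [Finset.sum_mul_sum]
      exact Finset.sum_congr rfl fun x _ => Finset.sum_congr rfl fun y _ => by ring
    rw [this, hf, zero_mul]
  rw [h1, mul_zero, add_zero] at h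
  simp only [sq, ← h, Finset.sum_mul_sum, id]

/-- The weak law of large numbers, in Chebyshev's form. -/
lemma expect_deviation_le (hp : ∀ x, 0 ≤ p x) (hp1 : ∑ x, p x = 1) (h : X → ℝ) {δ : ℝ}
    (hδ : 0 < δ) [Nonempty I] :
    expect p (fun c : I → X =>
        if Fintype.card I * δ ≤ |∑ i, h (c i) - Fintype.card I * ∑ x, p x * h x| then 1 else 0) ≤
      (∑ x, p x * (h x - ∑ y, p y * h y) ^ 2) / (Fintype.card I * δ ^ 2) := by
  set m := ∑ x, p x * h x
  set N : ℝ := (Fintype.card I : ℝ) with hN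
  have hNpos : 0 < N := by
    rw [hN]
    exact_mod_cast Fintype.card_pos
  have h0 : ∑ x, p x * (h x - m) = 0 := by
    simp only [mul_sub, Finset.sum_sub_distrib, ← Finset.sum_mul, hp1]
    simp [m]
  have h1 := expect_sq_sum (I := I) hp1 (fun x => h x - m) h0
  have h2 : expect p (fun c : I → X => if N * δ ≤ |∑ i, h (c i) - N * m| then 1 else 0) ≤
      expect p (fun c : I → X => ((N * δ) ^ 2)⁻¹ * (∑ i, (h (c i) - m)) ^ 2) := by
    -- Markov's inequality for the square: the normalized square of the centred sum is at least one
    -- on the event.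
    refine expect_mono hp fun c => ?_
    have hs : ∑ i, (h (c i) - m) = ∑ i, h (c i) - N * m := by
      simp [Finset.sum_sub_distrib, hN]
    rw [hs]
    split_ifs with hc
    · rw [inv_mul_eq_div, one_le_div (by positivity)]
      rw [← sq_abs (_ - _)]
      exact pow_le_pow_left₀ (by positivity) hc 2
    · positivity
  refine h2.trans_eq ?_
  rw [expect_const_mul, h1, ← hN]
  field_simp

/-- Some outcome is at most the mean. -/
lemma exists_le_of_expect_le (hp : ∀ x, 0 ≤ p x) (hp1 : ∑ x, p x = 1) {φ : (I → X) → ℝ} {B : ℝ}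
    (h : expect p φ ≤ B) : ∃ c, φ c ≤ B := by
  by_contra! hc
  have h1 : expect p (fun c : I → X => φ c - B) ≤ 0 := by
    rw [expect_sub, expect_const hp1]
    linarith
  have h2 : ∀ c ∈ (Finset.univ : Finset (I → X)), 0 ≤ (∏ i, p (c i)) * (φ c - B) := fun c _ =>
    mul_nonneg (Finset.prod_nonneg fun _ _ => hp _) (sub_nonneg.mpr (hc c).le)
  have h3 := (Finset.sum_eq_zero_iff_of_nonneg h2).mp (le_antisymm h1 (Finset.sum_nonneg h2))
  have h4 := expect_const (I := I) hp1 1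
  have h5 : expect p (fun _ : I → X => (1 : ℝ)) = 0 := by
    refine Finset.sum_eq_zero fun c hcm => ?_
    have := (mul_eq_zero.mp (h3 c hcm)).resolve_right (sub_pos.mpr (hc c)).ne'
    rw [this, zero_mul]
  linarith

/-- The empirical frequency of `x`. -/
def freq (c : I → X) (x : X) : ℝ := (Fintype.card I : ℝ)⁻¹ * ∑ i, if c i = x then 1 else 0

/-- Soft covering of a distribution by independent samples. -/
lemma expect_sum_abs_sub_freq_le (hp : ∀ x, 0 ≤ p x) (hp1 : ∑ x, p x = 1) [Nonempty I]
    (S : Finset X) {D τ : ℝ} (hS : (S.card : ℝ) ≤ D) (hD : 0 < D) (hτ : 0 < τ) :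
    expect p (fun c : I → X => ∑ x, |p x - freq c x|) ≤
      τ + D / (Fintype.card I * τ) + 2 * ∑ x ∈ Sᶜ, p x := by
  set N : ℝ := (Fintype.card I : ℝ) with hN
  have hNpos : 0 < N := by
    rw [hN]
    exact_mod_cast Fintype.card_pos
  have hfreq (x : X) : expect p (fun c : I → X => freq c x) = p x := by
    simp only [freq, expect_const_mul, expect_sum, expect_indicator hp1]
    simp [← hN, hNpos.ne']
  have hvar (x : X) : expect p (fun c : I → X => (p x - freq c x) ^ 2) ≤ p x / N := by
    have h0 : ∑ y, p y * (p x - if y = x then 1 else 0) = 0 := by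
      simp [mul_sub, Finset.sum_sub_distrib, ← Finset.sum_mul, hp1]
    have h1 := expect_sq_sum (I := I) hp1 (fun y => p x - if y = x then 1 else 0) h0
    have h2 (c : I → X) : (p x - freq c x) ^ 2 =
        (N⁻¹) ^ 2 * (∑ i, (p x - if c i = x then 1 else 0)) ^ 2 := by
      rw [← mul_pow, Finset.sum_sub_distrib, mul_sub]
      simp [freq, ← hN, hNpos.ne']
    simp only [h2, expect_const_mul, h1]
    have h3 : ∑ y, p y * (p x - if y = x then 1 else 0) ^ 2 ≤ p x := by
      have (y : X) : p y * (p x - if y = x then 1 else 0) ^ 2 =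
          p y * p x ^ 2 - (if y = x then p y * (2 * p x - 1) else 0) := by
        split_ifs <;> ring
      simp only [this, Finset.sum_sub_distrib, ← Finset.sum_mul, hp1, Finset.sum_ite_eq',
        Finset.mem_univ, if_true]
      nlinarith [sq_nonneg (p x)]
    rw [← hN]
    calc N⁻¹ ^ 2 * (N * ∑ y, p y * (p x - if y = x then 1 else 0) ^ 2)
        = N⁻¹ * ∑ y, p y * (p x - if y = x then 1 else 0) ^ 2 := by field_simp
      _ ≤ N⁻¹ * p x := by gcongr
      _ = p x / N := by ring
  have habs (x : X) : expect p (fun c : I → X => |p x - freq c x|) ≤ 2 * p x := by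
    have h1 : expect p (fun c : I → X => |p x - freq c x|) ≤
        expect p (fun c : I → X => p x + freq c x) := by
      refine expect_mono hp fun c => ?_
      have : 0 ≤ freq c x := mul_nonneg (by positivity)
        (Finset.sum_nonneg fun i _ => by split_ifs <;> norm_num)
      rw [abs_le]
      constructor <;> linarith [hp x]
    rw [expect_add, expect_const hp1, hfreq] at h1
    linarith
  have habs' (x : X) : expect p (fun c : I → X => |p x - freq c x|) ≤
      τ / D + D / (N * τ) * p x := by
    have h1 : expect p (fun c : I → X => |p x - freq c x|) ≤
        expect p (fun c : I → X => τ / D + D / τ * (p x - freq c x) ^ 2) := by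
      refine expect_mono hp fun c => ?_
      rw [← sq_abs (_ - _)]
      set y := |p x - freq c x|
      -- Completing the square replaces Cauchy–Schwarz: a first moment is bounded by `τ/D`, which
      -- adds up to `τ` over at most `D` points, plus a multiple of the variance.
      have h2 : D / τ * (τ / D - y) ^ 2 = τ / D - 2 * y + D / τ * y ^ 2 := by
        field_simp
        ring
      have h3 : 0 ≤ D / τ * (τ / D - y) ^ 2 := by positivity
      have h4 : 0 ≤ y := abs_nonneg _
      linarith
    rw [expect_add, expect_const hp1, expect_const_mul] at h1
    refine h1.trans ?_
    have := mul_le_mul_of_nonneg_left (hvar x) (by positivity : 0 ≤ D / τ)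
    calc _ ≤ τ / D + D / τ * (p x / N) := by linarith
      _ = _ := by field_simp
  rw [expect_sum, ← Finset.sum_add_sum_compl S]
  refine add_le_add ?_ ?_
  · refine (Finset.sum_le_sum fun x _ => habs' x).trans ?_
    rw [Finset.sum_add_distrib, Finset.sum_const, nsmul_eq_mul, ← Finset.mul_sum]
    have h1 : ∑ x ∈ S, p x ≤ 1 := by
      rw [← hp1]
      exact Finset.sum_le_univ_sum_of_nonneg hp
    refine add_le_add ?_ ?_
    · calc (S.card : ℝ) * (τ / D) ≤ D * (τ / D) := by gcongr
        _ = τ := by field_simp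
    · exact mul_le_of_le_one_right (by positivity) h1
  · rw [Finset.mul_sum]
    exact Finset.sum_le_sum fun x _ => habs x

end Expectation

/-! ### Measurements from random codebooks, on one side -/

section Renormalization

variable {ι : Type*} [Fintype ι] [DecidableEq ι]

/-- `2 (1 + T)⁻¹`, which turns a positive operator `T` into `4 T (1 + T)⁻² ≤ 1` by conjugation. -/
def renorm (T : Matrix ι ι ℂ) : Matrix ι ι ℂ := (2 : ℝ) • (1 + T)⁻¹

lemma renorm_diagIn {V : Matrix ι ι ℂ} (hV : Vᴴ * V = 1) {d : ι → ℝ} (hd : ∀ i, 0 ≤ d i) :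
    renorm (diagIn V d) = diagIn V (fun i => 2 * (1 + d i)⁻¹) := by
  rw [renorm, ← smul_diagIn]
  congr 1
  refine Matrix.inv_eq_left_inv ?_
  have h1 : (1 : Matrix ι ι ℂ) + diagIn V d = diagIn V (fun i => 1 + d i) := by
    have := diagIn_sub (V := V) (fun i => 1 + d i) d
    simp only [add_sub_cancel_right, diagIn_one hV] at this
    rw [← this]
    abel
  rw [h1, diagIn_mul hV, ← diagIn_one hV]
  congr 1
  funext i
  exact inv_mul_cancel₀ (by linarith [hd i])

/-- All three operators commute, so only scalars are involved. With `w = 2/(1+d)` one has `w² d =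
4d/(1+d)² ≤ 1` and `(1-w)² d = (d/(1+d)²)(1-d)²`, and both bounds are the arithmetic-geometric
inequality. The normalization needs no spectral bound on `T`, and its cost is quadratic in `1 - T`.
-/
lemma renorm_spec {T : Matrix ι ι ℂ} (hT : 0 ≤ T) :
    (renorm T)ᴴ = renorm T ∧ renorm T * T * renorm T ≤ 1 ∧
      (1 - renorm T) * T * (1 - renorm T) ≤ (1 / 4 : ℝ) • ((1 - T) * (1 - T)) := by
  obtain ⟨V, d, hV, rfl⟩ := exists_eq_diagIn (posSemidef_of_nonneg hT).1
  have hd := nonneg_of_diagIn_nonneg hV hT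
  rw [renorm_diagIn hV hd]
  refine ⟨conjTranspose_diagIn _, ?_, ?_⟩
  · rw [diagIn_mul hV, diagIn_mul hV, ← diagIn_one hV]
    refine diagIn_mono fun i => ?_
    have h1 : 0 < 1 + d i := by linarith [hd i]
    have h2 : 2 * (1 + d i)⁻¹ * d i * (2 * (1 + d i)⁻¹) = 4 * d i / (1 + d i) ^ 2 := by
      field_simp
      ring
    rw [h2, div_le_one (by positivity)]
    nlinarith [sq_nonneg (1 - d i)]
  · rw [← diagIn_one hV, diagIn_sub, diagIn_sub, diagIn_mul hV, diagIn_mul hV, diagIn_mul hV,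
      smul_diagIn]
    refine diagIn_mono fun i => ?_
    have h1 : 0 < 1 + d i := by linarith [hd i]
    have h2 : (1 - 2 * (1 + d i)⁻¹) * d i * (1 - 2 * (1 + d i)⁻¹) =
        (d i / (1 + d i) ^ 2) * (1 - d i) ^ 2 := by
      field_simp
      ring
    have h3 : d i / (1 + d i) ^ 2 ≤ 1 / 4 := by
      rw [div_le_div_iff₀ (by positivity) (by norm_num)]
      nlinarith [sq_nonneg (1 - d i)]
    rw [h2, ← sq]
    exact mul_le_mul_of_nonneg_right h3 (sq_nonneg _)

/-- Conjugating a positive operator by a perturbation of the identity. -/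
lemma isDominated_sub_conj {E W : Matrix ι ι ℂ} (hE : 0 ≤ E) (hW : Wᴴ = W) {t : ℝ} (ht : 0 < t) :
    IsDominated (E - W * E * W) (t • E + (t⁻¹ + 1) • ((1 - W) * E * (1 - W))) := by
  obtain ⟨F, rfl⟩ := exists_conjTranspose_mul_self hE
  have h := isDominated_gram_sub F (F * (1 - W)) ht
  simpa only [Matrix.mul_sub, Matrix.mul_one, sub_sub_cancel, Matrix.conjTranspose_mul,
    Matrix.conjTranspose_sub, Matrix.conjTranspose_one, hW, Matrix.sub_mul, Matrix.one_mul,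
    Matrix.mul_assoc] using h

/-- Parallelogram law for the decomposition `W = 1 - (1 - W)`. -/
lemma conj_le_two_smul_add {E W : Matrix ι ι ℂ} (hE : 0 ≤ E) (hW : Wᴴ = W) :
    W * E * W ≤ (2 : ℝ) • E + (2 : ℝ) • ((1 - W) * E * (1 - W)) := by
  obtain ⟨F, rfl⟩ := exists_conjTranspose_mul_self hE
  have h := conj_le_two_smul F (-(F * (1 - W)))
  rw [Matrix.conjTranspose_neg, neg_mul_neg] at h
  simpa only [Matrix.mul_sub, Matrix.mul_one, sub_sub_cancel, Matrix.conjTranspose_mul,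
    Matrix.conjTranspose_sub, Matrix.conjTranspose_one, hW, Matrix.sub_mul, Matrix.one_mul,
    Matrix.mul_assoc, ← sub_eq_add_neg] using h

end Renormalization

/-- `E` is a family of operators, normalized with respect to `ρ`, such that `lam x • E x` is close
to the POVM `Λ` and whose second moment is at most `κ`. -/
structure IsTrimmed {ι X : Type*} [Fintype ι] [DecidableEq ι] [Fintype X]
    (ρ : Matrix ι ι ℂ) (Λ E : X → Matrix ι ι ℂ) (lam : X → ℝ) (κ δ : ℝ) : Prop where
  state_nonneg : 0 ≤ ρ
  trace_state : trPair 1 ρ = 1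
  povm_nonneg : ∀ x, 0 ≤ Λ x
  sum_povm : ∑ x, Λ x = 1
  lam_nonneg : ∀ x, 0 ≤ lam x
  sum_lam : ∑ x, lam x = 1
  nonneg : ∀ x, 0 ≤ E x
  sum_le : ∑ x, lam x • E x ≤ 1
  trPair_le : ∀ x, trPair (E x) ρ ≤ 1
  second_moment : ∑ x, lam x * trPair (E x * E x) ρ ≤ κ
  close : ∀ Y : X → Matrix ι ι ℂ, (∀ x, IsDominated (Y x) ρ) →
    ∑ x, trPair (Λ x - lam x • E x) (Y x) ≤ δ

section Codebook

variable {ι X M L : Type*} [Fintype ι] [DecidableEq ι] [Fintype X] [DecidableEq X]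
  [Fintype M] [DecidableEq M] [Fintype L] [DecidableEq L]

/-- The average of the operators of the codewords. -/
def bookSum (E : X → Matrix ι ι ℂ) (c : M × L → X) (μ : M) : Matrix ι ι ℂ :=
  (Fintype.card L : ℝ)⁻¹ • ∑ l, E (c (μ, l))

/-- The sub-POVM built from a codebook. -/
def bookMeas (E : X → Matrix ι ι ℂ) (c : M × L → X) (μ : M) (l : L) : Matrix ι ι ℂ :=
  (Fintype.card L : ℝ)⁻¹ • (renorm (bookSum E c μ) * E (c (μ, l)) * renorm (bookSum E c μ))

/-- The deviation of `bookMeas` from the operators of the codewords. -/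
def bookDev (E : X → Matrix ι ι ℂ) (c : M × L → X) (μ : M) (l : L) : Matrix ι ι ℂ :=
  (Fintype.card L : ℝ)⁻¹ •
    ((1 - renorm (bookSum E c μ)) * E (c (μ, l)) * (1 - renorm (bookSum E c μ)))

/-- The weight of the deviation on the state `ρ`. -/
def bookDefect (ρ : Matrix ι ι ℂ) (E : X → Matrix ι ι ℂ) (c : M × L → X) : ℝ :=
  (Fintype.card M : ℝ)⁻¹ * ∑ μ, ∑ l, trPair (bookDev E c μ l) ρ

variable {ρ : Matrix ι ι ℂ} {Λ E : X → Matrix ι ι ℂ} {lam : X → ℝ} {κ δ : ℝ}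

lemma bookSum_nonneg (hE : ∀ x, 0 ≤ E x) (c : M × L → X) (μ : M) : 0 ≤ bookSum E c μ :=
  smul_nonneg_of_nonneg (by positivity) (Finset.sum_nonneg fun l _ => hE _)

lemma bookMeas_nonneg (hE : ∀ x, 0 ≤ E x) (c : M × L → X) (μ : M) (l : L) :
    0 ≤ bookMeas E c μ l := by
  refine smul_nonneg_of_nonneg (by positivity) ?_
  have h := conj_nonneg (hE (c (μ, l))) (renorm (bookSum E c μ))
  rwa [(renorm_spec (bookSum_nonneg hE c μ)).1] at h

lemma bookDev_nonneg (hE : ∀ x, 0 ≤ E x) (c : M × L → X) (μ : M) (l : L) :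
    0 ≤ bookDev E c μ l := by
  refine smul_nonneg_of_nonneg (by positivity) ?_
  have h := conj_nonneg (hE (c (μ, l))) (1 - renorm (bookSum E c μ))
  rwa [Matrix.conjTranspose_sub, Matrix.conjTranspose_one,
    (renorm_spec (bookSum_nonneg hE c μ)).1] at h

lemma sum_bookMeas_le (hE : ∀ x, 0 ≤ E x) (c : M × L → X) (μ : M) :
    ∑ l, bookMeas E c μ l ≤ 1 := by
  refine le_of_eq_of_le ?_ (renorm_spec (bookSum_nonneg hE c μ)).2.1
  simp only [bookMeas]
  rw [← Finset.smul_sum, ← Finset.sum_mul, ← Finset.mul_sum, ← Matrix.smul_mul, ← Matrix.mul_smul]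
  rfl

/-- This crude bound is meant for decoding errors: there only the order of magnitude of a weight
matters, and the renormalization, which depends on the whole codebook, must be removed before
averaging over independent codewords. -/
lemma bookMeas_le (hE : ∀ x, 0 ≤ E x) (c : M × L → X) (μ : M) (l : L) :
    bookMeas E c μ l ≤
      (2 * (Fintype.card L : ℝ)⁻¹) • E (c (μ, l)) + (2 : ℝ) • bookDev E c μ l := by
  have h := conj_le_two_smul_add (hE (c (μ, l))) (renorm_spec (bookSum_nonneg hE c μ)).1
  refine (smul_mono_right (by positivity) h).trans_eq ?_
  rw [bookDev]
  module

/-- Summed over the codewords of one book, the deviations collapse to `(1 - W) T (1 - W)`, to which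
the spectral bound on the renormalization applies. -/
lemma bookDefect_le (hρ : 0 ≤ ρ) (hE : ∀ x, 0 ≤ E x) (c : M × L → X) :
    bookDefect ρ E c ≤ (Fintype.card M : ℝ)⁻¹ * ∑ μ,
      (1 / 4) * trPair ((1 - bookSum E c μ) * (1 - bookSum E c μ)) ρ := by
  refine mul_le_mul_of_nonneg_left (Finset.sum_le_sum fun μ _ => ?_) (by positivity)
  rw [← trPair_sum_left, ← trPair_smul_left]
  refine trPair_mono_left (le_of_eq_of_le ?_ (renorm_spec (bookSum_nonneg hE c μ)).2.2) hρ
  simp only [bookDev]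
  rw [← Finset.smul_sum, ← Finset.sum_mul, ← Finset.mul_sum, ← Matrix.smul_mul, ← Matrix.mul_smul]
  rfl

/-- The closeness condition is tested on the constant family `ρ`. -/
lemma IsTrimmed.trPair_sum_ge (h : IsTrimmed ρ Λ E lam κ δ) :
    1 - δ ≤ trPair (∑ x, lam x • E x) ρ := by
  have h1 := h.close (fun _ => ρ) (fun _ => isDominated_self h.state_nonneg)
  simp only [trPair_sub_left, Finset.sum_sub_distrib] at h1
  rw [← trPair_sum_left, ← trPair_sum_left, h.sum_povm, h.trace_state] at h1
  linarith

/-- Expand the square. The diagonal terms of the second moment contribute `κ/N`; by independence the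
others give at most `Tr(T̄²ρ)` for the mean `T̄`. As `0 ≤ T̄ ≤ 1`, the rest is at most `1 - Tr(T̄ρ)
≤ δ`. -/
lemma IsTrimmed.expect_bookSum (h : IsTrimmed ρ Λ E lam κ δ) [Nonempty L] (μ : M) :
    expect lam (fun c : M × L → X =>
      trPair ((1 - bookSum E c μ) * (1 - bookSum E c μ)) ρ) ≤ δ + κ / Fintype.card L := by
  set N : ℝ := (Fintype.card L : ℝ) with hN
  have hNpos : 0 < N := by
    rw [hN]
    exact_mod_cast Fintype.card_pos
  set T : Matrix ι ι ℂ := ∑ x, lam x • E x with hT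
  have hinj : Function.Injective (fun l : L => (μ, l)) := fun l m hlm => (Prod.mk.inj hlm).2
  have hmean : expect lam (fun c : M × L → X => ∑ l, trPair (E (c (μ, l))) ρ) =
      N * trPair T ρ := by
    rw [expect_sum]
    have (l : L) : expect lam (fun c : M × L → X => trPair (E (c (μ, l))) ρ) = trPair T ρ := by
      rw [expect_apply h.sum_lam (μ, l) (fun x => trPair (E x) ρ), hT, trPair_sum_left]
      simp only [trPair_smul_left]
    simp [this, ← hN]
  have hsq : expect lam (fun c : M × L → X =>
      ∑ l, ∑ m, trPair (E (c (μ, l)) * E (c (μ, m))) ρ) ≤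
      N * κ + (N * (N - 1)) * trPair (T * T) ρ := by
    rw [expect_sum_pair h.sum_lam hinj (fun x y => trPair (E x * E y) ρ), ← hN]
    refine add_le_add (mul_le_mul_of_nonneg_left h.second_moment hNpos.le) (le_of_eq ?_)
    congr 1
    rw [hT, Finset.sum_mul_sum, trPair_sum_left]
    refine Finset.sum_congr rfl fun x _ => ?_
    rw [trPair_sum_left]
    refine Finset.sum_congr rfl fun y _ => ?_
    rw [Matrix.smul_mul, Matrix.mul_smul, trPair_smul_left, trPair_smul_left, mul_assoc]
  have hexp (c : M × L → X) : trPair ((1 - bookSum E c μ) * (1 - bookSum E c μ)) ρ =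
      1 - (2 * N⁻¹) * (∑ l, trPair (E (c (μ, l))) ρ) +
        (N⁻¹ * N⁻¹) * ∑ l, ∑ m, trPair (E (c (μ, l)) * E (c (μ, m))) ρ := by
    have h1 : (1 - bookSum E c μ) * (1 - bookSum E c μ) =
        1 - (2 * N⁻¹) • (∑ l, E (c (μ, l))) +
          (N⁻¹ * N⁻¹) • ∑ l, ∑ m, E (c (μ, l)) * E (c (μ, m)) := by
      rw [← Finset.sum_mul_sum, bookSum, ← hN]
      simp only [Matrix.mul_sub, Matrix.sub_mul, Matrix.smul_mul, Matrix.mul_smul, Matrix.mul_one,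
        Matrix.one_mul]
      module
    rw [h1, trPair_add_left, trPair_sub_left, trPair_smul_left, trPair_smul_left, trPair_sum_left,
      trPair_sum_left, h.trace_state]
    simp only [trPair_sum_left]
  have hTT : trPair (T * T) ρ ≥ 0 := by
    have hTn : 0 ≤ T := Finset.sum_nonneg fun x _ =>
      smul_nonneg_of_nonneg (h.lam_nonneg x) (h.nonneg x)
    have := conjTranspose_mul_self_nonneg T
    rw [conjTranspose_eq_of_nonneg hTn] at this
    exact trPair_nonneg this h.state_nonneg
  have hT2 : trPair (T * T) ρ ≤ trPair T ρ := by
    refine trPair_mono_left ?_ h.state_nonneg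
    have hTn : 0 ≤ T := Finset.sum_nonneg fun x _ =>
      smul_nonneg_of_nonneg (h.lam_nonneg x) (h.nonneg x)
    obtain ⟨V, d, hV, hd⟩ := exists_eq_diagIn (posSemidef_of_nonneg hTn).1
    have h0 := hTn
    have h1 := h.sum_le
    rw [← hT, ← sub_nonneg, hd, ← diagIn_one hV, diagIn_sub] at h1
    rw [hd] at h0
    rw [hd, diagIn_mul hV]
    refine diagIn_mono fun i => ?_
    have e0 := nonneg_of_diagIn_nonneg hV h0 i
    have e1 := nonneg_of_diagIn_nonneg hV h1 i
    nlinarith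
  simp only [hexp]
  rw [expect_add, expect_sub, expect_const h.sum_lam, expect_const_mul, expect_const_mul, hmean]
  have h1 := mul_le_mul_of_nonneg_left hsq (by positivity : 0 ≤ N⁻¹ * N⁻¹)
  have h2 : N⁻¹ * N⁻¹ * (N * κ + (N * (N - 1)) * trPair (T * T) ρ) =
      κ / N + trPair (T * T) ρ - N⁻¹ * trPair (T * T) ρ := by
    field_simp
    ring
  have h3 : 2 * N⁻¹ * (N * trPair T ρ) = 2 * trPair T ρ := by field_simp
  have h4 : 0 ≤ N⁻¹ * trPair (T * T) ρ := by positivity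
  have h5 := h.trPair_sum_ge
  rw [← hT] at h5
  rw [h3]
  linarith

lemma IsTrimmed.expect_bookDefect (h : IsTrimmed ρ Λ E lam κ δ) [Nonempty M] [Nonempty L] :
    expect lam (fun c : M × L → X => bookDefect ρ E c) ≤ δ + κ / Fintype.card L := by
  refine (expect_mono h.lam_nonneg fun c => bookDefect_le h.state_nonneg h.nonneg c).trans ?_
  rw [expect_const_mul, expect_sum]
  have hM : 0 < (Fintype.card M : ℝ) := by exact_mod_cast Fintype.card_pos
  -- The factor `1/4` is discarded at the end, which requires the bound to be nonnegative.
  have h0 : 0 ≤ δ + κ / Fintype.card L := by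
    obtain ⟨μ⟩ := ‹Nonempty M›
    refine le_trans ?_ (h.expect_bookSum μ)
    refine (expect_const h.sum_lam 0).symm.trans_le (expect_mono h.lam_nonneg fun c => ?_)
    have h1 : (1 - bookSum E c μ)ᴴ = 1 - bookSum E c μ := by
      rw [Matrix.conjTranspose_sub, Matrix.conjTranspose_one,
        conjTranspose_eq_of_nonneg (bookSum_nonneg h.nonneg c μ)]
    have h2 := conjTranspose_mul_self_nonneg (1 - bookSum E c μ)
    rw [h1] at h2
    exact trPair_nonneg h2 h.state_nonneg
  rw [inv_mul_le_iff₀ hM]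
  refine (Finset.sum_le_card_nsmul _ _ (δ + κ / Fintype.card L) fun μ _ => ?_).trans_eq (by simp [mul_add])
  rw [expect_const_mul]
  linarith [h.expect_bookSum (L := L) μ]

/-- The measurement built from a codebook simulates the POVM. -/
lemma IsTrimmed.close_bookMeas (h : IsTrimmed ρ Λ E lam κ δ) [Nonempty M] [Nonempty L]
    (c : M × L → X) {t : ℝ} (ht : 0 < t) {Y : X → Matrix ι ι ℂ}
    (hY : ∀ x, IsDominated (Y x) ρ) :
    ∑ x, trPair (Λ x) (Y x) -
        (Fintype.card M : ℝ)⁻¹ * ∑ μ, ∑ l, trPair (bookMeas E c μ l) (Y (c (μ, l))) ≤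
      δ + ∑ x, |lam x - freq c x| + t + (t⁻¹ + 1) * bookDefect ρ E c := by
  set m : ℝ := (Fintype.card M : ℝ) with hm
  set N : ℝ := (Fintype.card L : ℝ) with hN
  have hNpos : 0 < N := by
    rw [hN]
    exact_mod_cast Fintype.card_pos
  have hmpos : 0 < m := by
    rw [hm]
    exact_mod_cast Fintype.card_pos
  have h1 := h.close Y hY
  simp only [trPair_sub_left, Finset.sum_sub_distrib, trPair_smul_left] at h1
  -- Each `Tr(E x · Y x)` lies in `[-1, 1]`, so passing from the true to the empirical frequencies
  -- costs at most their `ℓ¹` distance.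
  have h2 : ∑ x, lam x * trPair (E x) (Y x) - ∑ x, freq c x * trPair (E x) (Y x) ≤
      ∑ x, |lam x - freq c x| := by
    rw [← Finset.sum_sub_distrib]
    refine Finset.sum_le_sum fun x _ => ?_
    rw [← sub_mul]
    refine (le_abs_self _).trans ?_
    rw [abs_mul]
    refine mul_le_of_le_one_right (abs_nonneg _) (abs_le.mpr ⟨?_, ?_⟩)
    · have := trPair_le_self (h.nonneg x) (hY x).neg
      rw [trPair_neg_right] at this
      linarith [h.trPair_le x]
    · exact (trPair_le_self (h.nonneg x) (hY x)).trans (h.trPair_le x)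
  have h3 : ∑ x, freq c x * trPair (E x) (Y x) =
      m⁻¹ * ∑ μ, ∑ l, N⁻¹ * trPair (E (c (μ, l))) (Y (c (μ, l))) := by
    simp only [freq, Fintype.card_prod, Nat.cast_mul, mul_inv, ← hm, ← hN, Fintype.sum_prod_type,
      Finset.mul_sum, Finset.sum_mul]
    rw [Finset.sum_comm]
    refine Finset.sum_congr rfl fun μ _ => ?_
    rw [Finset.sum_comm]
    refine Finset.sum_congr rfl fun l _ => ?_
    simp [mul_assoc]
  have h4 (μ : M) (l : L) : N⁻¹ * trPair (E (c (μ, l))) (Y (c (μ, l))) -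
      trPair (bookMeas E c μ l) (Y (c (μ, l))) ≤
      N⁻¹ * t + (t⁻¹ + 1) * trPair (bookDev E c μ l) ρ := by
    have e1 := trPair_le_of_dominated (isDominated_sub_conj (h.nonneg (c (μ, l)))
      (renorm_spec (bookSum_nonneg h.nonneg c μ)).1 ht) (hY (c (μ, l)))
    rw [trPair_sub_left, trPair_add_left, trPair_smul_left, trPair_smul_left] at e1
    have e2 := mul_le_mul_of_nonneg_left (h.trPair_le (c (μ, l))) ht.le
    rw [bookMeas, bookDev, trPair_smul_left, trPair_smul_left, ← hN]
    have e3 := mul_le_mul_of_nonneg_left (e1.trans (add_le_add_left e2 _))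
      (inv_nonneg.mpr hNpos.le)
    linarith
  have h5 : m⁻¹ * ∑ μ, ∑ l, N⁻¹ * trPair (E (c (μ, l))) (Y (c (μ, l))) -
      m⁻¹ * ∑ μ, ∑ l, trPair (bookMeas E c μ l) (Y (c (μ, l))) ≤
      t + (t⁻¹ + 1) * bookDefect ρ E c := by
    rw [← mul_sub, ← Finset.sum_sub_distrib]
    simp only [← Finset.sum_sub_distrib]
    refine (mul_le_mul_of_nonneg_left (Finset.sum_le_sum fun μ _ => Finset.sum_le_sum fun l _ =>
      h4 μ l) (by positivity)).trans_eq ?_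
    simp only [Finset.sum_add_distrib, Finset.sum_const, Finset.card_univ, nsmul_eq_mul, ← hm,
      ← hN, ← Finset.mul_sum, bookDefect]
    field_simp
  linarith

end Codebook

/-! ### Two distributed measurements, binning and decoding -/

section Hybrid

variable {ι κ X W I J : Type*} [Fintype ι] [DecidableEq ι] [Fintype κ] [DecidableEq κ]
  [Fintype X] [Fintype W] [Fintype I] [Fintype J]

/-- Simulations of `ΛA` and `ΛB` on the marginals give one of `ΛA ⊗ ΛB`. -/
lemma trPair_kronecker_close {ρ : Matrix (ι × κ) (ι × κ) ℂ} (hρ : 0 ≤ ρ)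
    {ΛA : X → Matrix ι ι ℂ} {ΛB : W → Matrix κ κ ℂ} (hΛB : ∀ w, 0 ≤ ΛB w) (hΛB1 : ∑ w, ΛB w ≤ 1)
    {A : I → Matrix ι ι ℂ} (hA : ∀ i, 0 ≤ A i) (hA1 : ∑ i, A i ≤ 1) {B : J → Matrix κ κ ℂ}
    {f : I → X} {g : J → W} {ΔA ΔB : ℝ}
    (hcA : ∀ Y : X → Matrix ι ι ℂ, (∀ x, IsDominated (Y x) (trSnd ρ)) →
      ∑ x, trPair (ΛA x) (Y x) - ∑ i, trPair (A i) (Y (f i)) ≤ ΔA)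
    (hcB : ∀ Y : W → Matrix κ κ ℂ, (∀ w, IsDominated (Y w) (trFst ρ)) →
      ∑ w, trPair (ΛB w) (Y w) - ∑ j, trPair (B j) (Y (g j)) ≤ ΔB)
    {Y : X → W → Matrix (ι × κ) (ι × κ) ℂ} (hY : ∀ x w, IsDominated (Y x w) ρ) :
    ∑ x, ∑ w, trPair (ΛA x ⊗ₖ ΛB w) (Y x w) -
      ∑ i, ∑ j, trPair (A i ⊗ₖ B j) (Y (f i) (g j)) ≤ ΔA + ΔB := by
  -- A hybrid argument: Alice's operators are replaced while Bob's are still exact, then Bob's are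
  -- replaced while Alice's are already simulated. The two differences telescope.
  have h1 := hcA (fun x => ∑ w, condFst (ΛB w) (Y x w))
    (fun x => isDominated_sum_condFst hΛB hΛB1 hρ (hY x))
  have h2 := hcB (fun w => ∑ i, condSnd (A i) (Y (f i) w))
    (fun w => isDominated_sum_condSnd hA hA1 hρ (fun i => hY (f i) w))
  simp only [trPair_sum_right, trPair_condFst] at h1
  simp only [trPair_sum_right, trPair_condSnd] at h2
  rw [Finset.sum_comm (s := Finset.univ (α := W)), Finset.sum_comm (s := Finset.univ (α := J))]
    at h2
  linarith

end Hybrid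

section Kronecker

variable {ι κ X W : Type*} [Fintype ι] [DecidableEq ι] [Fintype κ] [DecidableEq κ]
  [Fintype X] [Fintype W] {ρ : Matrix (ι × κ) (ι × κ) ℂ}

lemma trPair_kronecker_nonneg (hρ : 0 ≤ ρ) {A : Matrix ι ι ℂ} {B : Matrix κ κ ℂ} (hA : 0 ≤ A)
    (hB : 0 ≤ B) : 0 ≤ trPair (A ⊗ₖ B) ρ :=
  trPair_nonneg (kronecker_nonneg hA hB) hρ

lemma trPair_kronecker_mono_left (hρ : 0 ≤ ρ) {A A' : Matrix ι ι ℂ} {B : Matrix κ κ ℂ}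
    (hA : A ≤ A') (hB : 0 ≤ B) : trPair (A ⊗ₖ B) ρ ≤ trPair (A' ⊗ₖ B) ρ := by
  rw [← trPair_condFst, ← trPair_condFst]
  exact trPair_mono_left hA (condFst_nonneg hB hρ)

lemma trPair_kronecker_mono_right (hρ : 0 ≤ ρ) {A : Matrix ι ι ℂ} {B B' : Matrix κ κ ℂ}
    (hA : 0 ≤ A) (hB : B ≤ B') : trPair (A ⊗ₖ B) ρ ≤ trPair (A ⊗ₖ B') ρ := by
  rw [← trPair_condSnd, ← trPair_condSnd]
  exact trPair_mono_left hB (condSnd_nonneg hA hρ)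

lemma trPair_kronecker_one (A : Matrix ι ι ℂ) :
    trPair (A ⊗ₖ (1 : Matrix κ κ ℂ)) ρ = trPair A (trSnd ρ) := by
  rw [← trPair_condFst, condFst_one]

lemma trPair_one_kronecker (B : Matrix κ κ ℂ) :
    trPair ((1 : Matrix ι ι ℂ) ⊗ₖ B) ρ = trPair B (trFst ρ) := by
  rw [← trPair_condSnd, condSnd_one]

lemma trPair_sum_kronecker (s : Finset X) (A : X → Matrix ι ι ℂ) (B : Matrix κ κ ℂ) :
    trPair ((∑ x ∈ s, A x) ⊗ₖ B) ρ = ∑ x ∈ s, trPair (A x ⊗ₖ B) ρ := by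
  simp only [← trPair_condFst, trPair_sum_left]

lemma trPair_kronecker_sum (s : Finset X) (A : Matrix ι ι ℂ) (B : X → Matrix κ κ ℂ) :
    trPair (A ⊗ₖ (∑ x ∈ s, B x)) ρ = ∑ x ∈ s, trPair (A ⊗ₖ B x) ρ := by
  simp only [← trPair_condSnd, trPair_sum_left]

lemma trPair_smul_kronecker (r : ℝ) (A : Matrix ι ι ℂ) (B : Matrix κ κ ℂ)
    (Y : Matrix (ι × κ) (ι × κ) ℂ) :
    trPair ((r • A) ⊗ₖ B) Y = r * trPair (A ⊗ₖ B) Y := by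
  simp only [← trPair_condFst, trPair_smul_left]

lemma trPair_kronecker_smul (r : ℝ) (A : Matrix ι ι ℂ) (B : Matrix κ κ ℂ)
    (Y : Matrix (ι × κ) (ι × κ) ℂ) :
    trPair (A ⊗ₖ (r • B)) Y = r * trPair (A ⊗ₖ B) Y := by
  simp only [← trPair_condSnd, trPair_smul_left]

lemma trPair_add_kronecker (A A' : Matrix ι ι ℂ) (B : Matrix κ κ ℂ) :
    trPair ((A + A') ⊗ₖ B) ρ = trPair (A ⊗ₖ B) ρ + trPair (A' ⊗ₖ B) ρ := by
  simp only [← trPair_condFst, trPair_add_left]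

lemma trPair_kronecker_add (A : Matrix ι ι ℂ) (B B' : Matrix κ κ ℂ) :
    trPair (A ⊗ₖ (B + B')) ρ = trPair (A ⊗ₖ B) ρ + trPair (A ⊗ₖ B') ρ := by
  simp only [← trPair_condSnd, trPair_add_left]

end Kronecker

section Trimmed

open Classical in
/-- The weight outside the set `J` changes little when the measurements are trimmed. -/
lemma IsTrimmed.sum_compl_le {ι κ X W : Type*} [Fintype ι] [DecidableEq ι] [Fintype κ]
    [DecidableEq κ] [Fintype X] [Fintype W] {ρ : Matrix (ι × κ) (ι × κ) ℂ} (hρ : 0 ≤ ρ)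
    {ΛA EA : X → Matrix ι ι ℂ} {ΛB EB : W → Matrix κ κ ℂ} {lamA : X → ℝ} {lamB : W → ℝ}
    {κA κB δA δB : ℝ} (hA : IsTrimmed (trSnd ρ) ΛA EA lamA κA δA)
    (hB : IsTrimmed (trFst ρ) ΛB EB lamB κB δB) (S : X → W → Prop) :
    ∑ x, ∑ w, lamA x * lamB w * (if S x w then 0 else trPair (EA x ⊗ₖ EB w) ρ) ≤
      (∑ x, ∑ w, if S x w then 0 else trPair (ΛA x ⊗ₖ ΛB w) ρ) + δA + δB := by
  have h := trPair_kronecker_close (I := X) (J := W) (ΛA := ΛA) (ΛB := ΛB) (f := id) (g := id)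
    (ΔA := δA) (ΔB := δB) (B := fun w => lamB w • EB w) hρ hB.povm_nonneg hB.sum_povm.le
    (A := fun x => lamA x • EA x)
    (fun x => smul_nonneg_of_nonneg (hA.lam_nonneg x) (hA.nonneg x)) hA.sum_le
    (fun Y hY => by
      rw [← Finset.sum_sub_distrib]
      simpa [trPair_sub_left] using hA.close Y hY)
    (fun Y hY => by
      rw [← Finset.sum_sub_distrib]
      simpa [trPair_sub_left] using hB.close Y hY)
    -- A negative test family, supported outside `S`, turns closeness of the measurements into an
    -- upper bound on the trimmed weight there.
    (Y := fun x w => if S x w then 0 else -ρ)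
    (fun x w => by
      split_ifs
      · exact isDominated_zero hρ
      · exact (isDominated_self hρ).neg)
  simp only [id] at h
  have h1 : ∑ x, ∑ w, trPair (ΛA x ⊗ₖ ΛB w) (if S x w then 0 else -ρ) =
      -∑ x, ∑ w, if S x w then 0 else trPair (ΛA x ⊗ₖ ΛB w) ρ := by
    simp only [← Finset.sum_neg_distrib]
    refine Finset.sum_congr rfl fun x _ => Finset.sum_congr rfl fun w _ => ?_
    split_ifs
    · simp
    · rw [trPair_neg_right]
  have h2 : ∑ x, ∑ w, trPair ((lamA x • EA x) ⊗ₖ (lamB w • EB w)) (if S x w then 0 else -ρ) =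
      -∑ x, ∑ w, lamA x * lamB w * (if S x w then 0 else trPair (EA x ⊗ₖ EB w) ρ) := by
    simp only [← Finset.sum_neg_distrib]
    refine Finset.sum_congr rfl fun x _ => Finset.sum_congr rfl fun w _ => ?_
    split_ifs
    · simp
    · rw [trPair_neg_right, trPair_smul_kronecker, trPair_kronecker_smul, mul_assoc]
  linarith

end Trimmed

/-! ### Binning, and the expected number of decoding errors -/

section Decoding

variable {ι κ X W M₁ M₂ B₁ B₂ J₁ J₂ : Type*} [Fintype ι] [DecidableEq ι] [Fintype κ]
  [DecidableEq κ] [Fintype X] [DecidableEq X] [Fintype W] [DecidableEq W] [Fintype M₁]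
  [DecidableEq M₁] [Fintype M₂] [DecidableEq M₂] [Fintype B₁] [DecidableEq B₁] [Fintype B₂]
  [DecidableEq B₂] [Fintype J₁] [DecidableEq J₁] [Fintype J₂] [DecidableEq J₂]

open Classical in
/-- The decoder looks in a pair of bins for a pair of codewords that satisfies `S`. -/
def binDecode (S : X → W → Prop) (c₁ : M₁ × (B₁ × J₁) → X) (c₂ : M₂ × (B₂ × J₂) → W)
    (x₀ : X × W) (μ₁ : M₁) (μ₂ : M₂) (b₁ : B₁) (b₂ : B₂) : X × W :=
  if h : ∃ j : J₁ × J₂, S (c₁ (μ₁, b₁, j.1)) (c₂ (μ₂, b₂, j.2)) then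
    (c₁ (μ₁, b₁, h.choose.1), c₂ (μ₂, b₂, h.choose.2)) else x₀

open Classical in
/-- An upper bound for the indicator of a decoding error. -/
def errCount (S : X → W → Prop) (c₁ : M₁ × (B₁ × J₁) → X) (c₂ : M₂ × (B₂ × J₂) → W)
    (μ₁ : M₁) (μ₂ : M₂) (l₁ : B₁ × J₁) (l₂ : B₂ × J₂) : ℝ :=
  (if S (c₁ (μ₁, l₁)) (c₂ (μ₂, l₂)) then 0 else 1) +
    ∑ j₁, ∑ j₂, if (j₁, j₂) ≠ (l₁.2, l₂.2) ∧ S (c₁ (μ₁, l₁.1, j₁)) (c₂ (μ₂, l₂.1, j₂))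
      then 1 else 0

lemma errCount_nonneg (S : X → W → Prop) (c₁ : M₁ × (B₁ × J₁) → X) (c₂ : M₂ × (B₂ × J₂) → W)
    (μ₁ : M₁) (μ₂ : M₂) (l₁ : B₁ × J₁) (l₂ : B₂ × J₂) : 0 ≤ errCount S c₁ c₂ μ₁ μ₂ l₁ l₂ :=
  add_nonneg (by split_ifs <;> norm_num) (Finset.sum_nonneg fun _ _ => Finset.sum_nonneg
    fun _ _ => by split_ifs <;> norm_num)

lemma one_le_errCount {S : X → W → Prop} {c₁ : M₁ × (B₁ × J₁) → X} {c₂ : M₂ × (B₂ × J₂) → W}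
    {x₀ : X × W} {μ₁ : M₁} {μ₂ : M₂} {l₁ : B₁ × J₁} {l₂ : B₂ × J₂}
    (h : binDecode S c₁ c₂ x₀ μ₁ μ₂ l₁.1 l₂.1 ≠ (c₁ (μ₁, l₁), c₂ (μ₂, l₂))) :
    1 ≤ errCount S c₁ c₂ μ₁ μ₂ l₁ l₂ := by
  classical
  rw [errCount]
  have h0 : (0 : ℝ) ≤ ∑ j₁, ∑ j₂, if (j₁, j₂) ≠ (l₁.2, l₂.2) ∧
      S (c₁ (μ₁, l₁.1, j₁)) (c₂ (μ₂, l₂.1, j₂)) then 1 else 0 :=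
    Finset.sum_nonneg fun _ _ => Finset.sum_nonneg fun _ _ => by split_ifs <;> norm_num
  by_cases hS : S (c₁ (μ₁, l₁)) (c₂ (μ₂, l₂))
  · have hex : ∃ j : J₁ × J₂, S (c₁ (μ₁, l₁.1, j.1)) (c₂ (μ₂, l₂.1, j.2)) := ⟨(l₁.2, l₂.2), hS⟩
    rw [binDecode, dif_pos hex] at h
    have hne : (hex.choose.1, hex.choose.2) ≠ (l₁.2, l₂.2) := by
      intro he
      apply h
      rw [(Prod.mk.inj he).1, (Prod.mk.inj he).2]
    have h1 : (1 : ℝ) ≤ ∑ j : J₁ × J₂, if (j.1, j.2) ≠ (l₁.2, l₂.2) ∧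
        S (c₁ (μ₁, l₁.1, j.1)) (c₂ (μ₂, l₂.1, j.2)) then 1 else 0 := by
      refine le_trans ?_ (Finset.single_le_sum (fun j _ => by split_ifs <;> norm_num)
        (Finset.mem_univ hex.choose))
      rw [if_pos ⟨hne, hex.choose_spec⟩]
    rw [Fintype.sum_prod_type] at h1
    rw [if_pos hS]
    linarith
  · rw [if_neg hS]
    linarith

variable {ρ : Matrix (ι × κ) (ι × κ) ℂ} {ΛA EA : X → Matrix ι ι ℂ} {ΛB EB : W → Matrix κ κ ℂ}
  {lamA : X → ℝ} {lamB : W → ℝ} {κA κB δA δB : ℝ}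

open Classical in
/-- The expected number of wrong pairs of codewords in a pair of bins. -/
lemma expect_wrong_pair_le (hρ : 0 ≤ ρ) (hA : IsTrimmed (trSnd ρ) ΛA EA lamA κA δA)
    (hB : IsTrimmed (trFst ρ) ΛB EB lamB κB δB) (S : X → W → Prop) {I₁ I₂ : Type*} [Fintype I₁]
    [DecidableEq I₁] [Fintype I₂] [DecidableEq I₂] (i₁ i₁' : I₁) (i₂ i₂' : I₂)
    (hne : i₁' ≠ i₁ ∨ i₂' ≠ i₂) :
    expect lamA (fun c₁ : I₁ → X => expect lamB (fun c₂ : I₂ → W =>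
      (if S (c₁ i₁') (c₂ i₂') then 1 else 0) * trPair (EA (c₁ i₁) ⊗ₖ EB (c₂ i₂)) ρ)) ≤
      ∑ x, ∑ w, lamA x * lamB w * (if S x w then 1 else 0) := by
  have hTB (x : X) : ∑ w, lamB w * trPair (EA x ⊗ₖ EB w) ρ ≤ 1 := by
    have h1 : ∑ w, lamB w * trPair (EA x ⊗ₖ EB w) ρ =
        trPair (EA x ⊗ₖ ∑ w, lamB w • EB w) ρ := by
      rw [trPair_kronecker_sum]
      simp only [trPair_kronecker_smul]
    rw [h1]
    refine (trPair_kronecker_mono_right hρ (hA.nonneg x) hB.sum_le).trans ?_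
    rw [trPair_kronecker_one]
    exact hA.trPair_le x
  have hTA (w : W) : ∑ x, lamA x * trPair (EA x ⊗ₖ EB w) ρ ≤ 1 := by
    have h1 : ∑ x, lamA x * trPair (EA x ⊗ₖ EB w) ρ =
        trPair ((∑ x, lamA x • EA x) ⊗ₖ EB w) ρ := by
      rw [trPair_sum_kronecker]
      simp only [trPair_smul_kronecker]
    rw [h1]
    refine (trPair_kronecker_mono_left hρ hA.sum_le (hB.nonneg w)).trans ?_
    rw [trPair_one_kronecker]
    exact hB.trPair_le w
  -- The wrong pair differs from the right one in some coordinate. In that coordinate the codeword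
  -- inside the operator is independent of the tested pair, and averaging over it leaves at most the
  -- identity. The other codeword may coincide with the tested one, but then the remaining weight
  -- `Tr(E ρ)` is at most one for every codeword, so no separate condition on a single bin rate
  -- arises.
  by_cases h2 : i₂' = i₂
  · have h1 : i₁' ≠ i₁ := by simpa [h2] using hne
    subst h2
    have e1 (c₁ : I₁ → X) : expect lamB (fun c₂ : I₂ → W =>
        (if S (c₁ i₁') (c₂ i₂') then 1 else 0) * trPair (EA (c₁ i₁) ⊗ₖ EB (c₂ i₂')) ρ) =
        ∑ w, lamB w * ((if S (c₁ i₁') w then 1 else 0) * trPair (EA (c₁ i₁) ⊗ₖ EB w) ρ) :=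
      expect_apply hB.sum_lam i₂'
        (fun w => (if S (c₁ i₁') w then 1 else 0) * trPair (EA (c₁ i₁) ⊗ₖ EB w) ρ)
    simp only [e1]
    rw [expect_apply_pair hA.sum_lam h1 (fun x' x =>
      ∑ w, lamB w * ((if S x' w then 1 else 0) * trPair (EA x ⊗ₖ EB w) ρ))]
    refine Finset.sum_le_sum fun x' _ => ?_
    have e2 : ∑ x, lamA x' * lamA x *
        ∑ w, lamB w * ((if S x' w then 1 else 0) * trPair (EA x ⊗ₖ EB w) ρ) =
        ∑ w, (lamA x' * lamB w * (if S x' w then 1 else 0)) *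
          ∑ x, lamA x * trPair (EA x ⊗ₖ EB w) ρ := by
      simp only [Finset.mul_sum]
      rw [Finset.sum_comm]
      exact Finset.sum_congr rfl fun w _ => Finset.sum_congr rfl fun x _ => by ring
    rw [e2]
    refine Finset.sum_le_sum fun w _ => mul_le_of_le_one_right ?_ (hTA w)
    exact mul_nonneg (mul_nonneg (hA.lam_nonneg _) (hB.lam_nonneg _)) (by split_ifs <;> norm_num)
  · have e1 (c₁ : I₁ → X) : expect lamB (fun c₂ : I₂ → W =>
        (if S (c₁ i₁') (c₂ i₂') then 1 else 0) * trPair (EA (c₁ i₁) ⊗ₖ EB (c₂ i₂)) ρ) ≤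
        ∑ w, lamB w * (if S (c₁ i₁') w then 1 else 0) := by
      rw [expect_apply_pair hB.sum_lam h2 (fun w' w =>
        (if S (c₁ i₁') w' then 1 else 0) * trPair (EA (c₁ i₁) ⊗ₖ EB w) ρ)]
      refine Finset.sum_le_sum fun w' _ => ?_
      have e2 : ∑ w, lamB w' * lamB w *
          ((if S (c₁ i₁') w' then 1 else 0) * trPair (EA (c₁ i₁) ⊗ₖ EB w) ρ) =
          (lamB w' * (if S (c₁ i₁') w' then 1 else 0)) *
            ∑ w, lamB w * trPair (EA (c₁ i₁) ⊗ₖ EB w) ρ := by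
        rw [Finset.mul_sum]
        exact Finset.sum_congr rfl fun w _ => by ring
      rw [e2]
      exact mul_le_of_le_one_right
        (mul_nonneg (hB.lam_nonneg _) (by split_ifs <;> norm_num)) (hTB _)
    refine (expect_mono hA.lam_nonneg e1).trans_eq ?_
    rw [expect_apply hA.sum_lam i₁' (fun x => ∑ w, lamB w * (if S x w then 1 else 0))]
    refine Finset.sum_congr rfl fun x _ => ?_
    rw [Finset.mul_sum]
    exact Finset.sum_congr rfl fun w _ => by ring

-- Either the true pair fails the test `S`, which costs its weight for the original POVMs and the
-- two trimming errors, or one of the other pairs in the two bins passes, each at cost `ω`.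
-- Excluding the true pair gives the `-1`, which matters when the bins are singletons, because `ω`
-- need not be small then.
open Classical in
lemma expect_errCount_le (hρ : 0 ≤ ρ) (hA : IsTrimmed (trSnd ρ) ΛA EA lamA κA δA)
    (hB : IsTrimmed (trFst ρ) ΛB EB lamB κB δB) {S : X → W → Prop} {π ω : ℝ}
    (hπ : (∑ x, ∑ w, if S x w then 0 else trPair (ΛA x ⊗ₖ ΛB w) ρ) ≤ π)
    (hω : ∑ x, ∑ w, lamA x * lamB w * (if S x w then 1 else 0) ≤ ω)
    (μ₁ : M₁) (μ₂ : M₂) (l₁ : B₁ × J₁) (l₂ : B₂ × J₂) :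
    expect lamA (fun c₁ : M₁ × (B₁ × J₁) → X => expect lamB (fun c₂ : M₂ × (B₂ × J₂) → W =>
      errCount S c₁ c₂ μ₁ μ₂ l₁ l₂ * trPair (EA (c₁ (μ₁, l₁)) ⊗ₖ EB (c₂ (μ₂, l₂))) ρ)) ≤
      π + δA + δB + (Fintype.card J₁ * Fintype.card J₂ - 1 : ℝ) * ω := by
  simp only [errCount, add_mul, Finset.sum_mul, expect_add, expect_sum]
  refine add_le_add ?_ ?_
  · have e1 (c₁ : M₁ × (B₁ × J₁) → X) : expect lamB (fun c₂ : M₂ × (B₂ × J₂) → W =>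
        (if S (c₁ (μ₁, l₁)) (c₂ (μ₂, l₂)) then 0 else 1) *
          trPair (EA (c₁ (μ₁, l₁)) ⊗ₖ EB (c₂ (μ₂, l₂))) ρ) =
        ∑ w, lamB w * ((if S (c₁ (μ₁, l₁)) w then 0 else 1) *
          trPair (EA (c₁ (μ₁, l₁)) ⊗ₖ EB w) ρ) :=
      expect_apply hB.sum_lam (μ₂, l₂) (fun w => (if S (c₁ (μ₁, l₁)) w then 0 else 1) *
          trPair (EA (c₁ (μ₁, l₁)) ⊗ₖ EB w) ρ)
    simp only [e1]
    rw [expect_apply hA.sum_lam (μ₁, l₁) (fun x => ∑ w, lamB w * ((if S x w then 0 else 1) *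
          trPair (EA x ⊗ₖ EB w) ρ))]
    refine le_trans (le_of_eq ?_) ((hA.sum_compl_le hρ hB S).trans (by linarith))
    refine Finset.sum_congr rfl fun x _ => ?_
    rw [Finset.mul_sum]
    refine Finset.sum_congr rfl fun w _ => ?_
    split_ifs <;> ring
  · have h0 : ∀ j : J₁ × J₂, expect lamA (fun c₁ : M₁ × (B₁ × J₁) → X =>
        expect lamB (fun c₂ : M₂ × (B₂ × J₂) → W =>
        (if (j.1, j.2) ≠ (l₁.2, l₂.2) ∧ S (c₁ (μ₁, l₁.1, j.1)) (c₂ (μ₂, l₂.1, j.2))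
          then 1 else 0) * trPair (EA (c₁ (μ₁, l₁)) ⊗ₖ EB (c₂ (μ₂, l₂))) ρ)) ≤
        ω - if j = (l₁.2, l₂.2) then ω else 0 := by
      intro j
      by_cases hj : j = (l₁.2, l₂.2)
      · have : (j.1, j.2) = (l₁.2, l₂.2) := hj
        simp [hj, expect_const hA.sum_lam, expect_const hB.sum_lam]
      · have hj' : (j.1, j.2) ≠ (l₁.2, l₂.2) := hj
        simp only [hj', ne_eq, not_false_eq_true, true_and, if_false, sub_zero]
        refine (expect_wrong_pair_le hρ hA hB S (μ₁, l₁) (μ₁, l₁.1, j.1) (μ₂, l₂)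
          (μ₂, l₂.1, j.2) ?_).trans hω
        by_contra! hcon
        apply hj
        have h1 := congrArg (fun p : M₁ × B₁ × J₁ => p.2.2) hcon.1
        have h2 := congrArg (fun p : M₂ × B₂ × J₂ => p.2.2) hcon.2
        exact Prod.ext h1 h2
    have h1 := Finset.sum_le_sum (s := Finset.univ) fun j _ => h0 j
    rw [Fintype.sum_prod_type] at h1
    refine h1.trans_eq ?_
    simp only [Finset.sum_sub_distrib, Finset.sum_const, Finset.card_univ, Fintype.card_prod,
      nsmul_eq_mul, Nat.cast_mul, Finset.sum_ite_eq', Finset.mem_univ, if_true]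
    ring

end Decoding

/-! ### One-shot simulation: averaging all errors over the codebooks -/

section OneShot

variable {ι κ X W M₁ M₂ B₁ B₂ J₁ J₂ : Type*} [Fintype ι] [DecidableEq ι] [Fintype κ]
  [DecidableEq κ] [Fintype X] [DecidableEq X] [Fintype W] [DecidableEq W] [Fintype M₁]
  [DecidableEq M₁] [Fintype M₂] [DecidableEq M₂] [Fintype B₁] [DecidableEq B₁] [Fintype B₂]
  [DecidableEq B₂] [Fintype J₁] [DecidableEq J₁] [Fintype J₂] [DecidableEq J₂]
  {ρ : Matrix (ι × κ) (ι × κ) ℂ} {ΛA EA : X → Matrix ι ι ℂ} {ΛB EB : W → Matrix κ κ ℂ}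
  {lamA : X → ℝ} {lamB : W → ℝ} {κA κB δA δB : ℝ}

/-- The bound on the distance between a POVM and its simulation by a codebook. -/
def bookGap {M L : Type*} [Fintype M] [Fintype L] (ρ : Matrix ι ι ℂ) (E : X → Matrix ι ι ℂ)
    (lam : X → ℝ) (δ t : ℝ) (c : M × L → X) : ℝ :=
  δ + ∑ x, |lam x - freq c x| + t + (t⁻¹ + 1) * bookDefect ρ E c

/-- This combines soft covering of the outcome distribution, which depends on the number of all
codewords, with the mean defect of the renormalization, which depends on the size of a single
codebook. -/
lemma IsTrimmed.expect_bookGap {M L : Type*} [Fintype M] [DecidableEq M] [Nonempty M] [Fintype L]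
    [DecidableEq L] [Nonempty L] {ρ : Matrix ι ι ℂ} {Λ E : X → Matrix ι ι ℂ} {lam : X → ℝ}
    {κ δ : ℝ} (h : IsTrimmed ρ Λ E lam κ δ) {t D q : ℝ} (ht : 0 < t) (S : Finset X)
    (hS : (S.card : ℝ) ≤ D) (hD : 0 < D) (hq : ∑ x ∈ Sᶜ, lam x ≤ q) :
    expect lam (fun c : M × L → X => bookGap ρ E lam δ t c) ≤
      δ + (t + D / (Fintype.card (M × L) * t) + 2 * q) + t +
        (t⁻¹ + 1) * (δ + κ / Fintype.card L) := by
  simp only [bookGap, expect_add, expect_const_mul, expect_const h.sum_lam]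
  have h1 := expect_sum_abs_sub_freq_le (I := M × L) h.lam_nonneg h.sum_lam S hS hD ht
  have h2 := mul_le_mul_of_nonneg_left (h.expect_bookDefect (M := M) (L := L))
    (by positivity : 0 ≤ t⁻¹ + 1)
  linarith

lemma sum_smul_bookMeas_le {M L : Type*} [Fintype M] [DecidableEq M] [Nonempty M] [Fintype L]
    [DecidableEq L] {E : X → Matrix ι ι ℂ} (hE : ∀ x, 0 ≤ E x) (c : M × L → X) :
    ∑ i : M × L, (Fintype.card M : ℝ)⁻¹ • bookMeas E c i.1 i.2 ≤ 1 := by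
  have hM : (Fintype.card M : ℝ) ≠ 0 := by exact_mod_cast Fintype.card_ne_zero
  rw [Fintype.sum_prod_type]
  simp only [← Finset.smul_sum]
  refine (smul_mono_right (by positivity) (Finset.sum_le_sum fun μ _ =>
    sum_bookMeas_le hE c μ)).trans_eq ?_
  rw [Finset.sum_const, Finset.card_univ, ← Nat.cast_smul_eq_nsmul ℝ, smul_smul,
    inv_mul_cancel₀ hM, one_smul]

/-- The contribution of decoding errors on the operators of the codewords. -/
def wrongWeight (ρ : Matrix (ι × κ) (ι × κ) ℂ) (EA : X → Matrix ι ι ℂ) (EB : W → Matrix κ κ ℂ)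
    (S : X → W → Prop) (c₁ : M₁ × (B₁ × J₁) → X) (c₂ : M₂ × (B₂ × J₂) → W) : ℝ :=
  ((Fintype.card (M₁ × (B₁ × J₁)) : ℝ)⁻¹ * (Fintype.card (M₂ × (B₂ × J₂)) : ℝ)⁻¹) *
    ∑ i : M₁ × (B₁ × J₁), ∑ j : M₂ × (B₂ × J₂),
      errCount S c₁ c₂ i.1 j.1 i.2 j.2 * trPair (EA (c₁ i) ⊗ₖ EB (c₂ j)) ρ

/-- The deviation on the first side, seen by the codewords of the second side. -/
def crossDefect (ρ : Matrix (ι × κ) (ι × κ) ℂ) (EA : X → Matrix ι ι ℂ) (EB : W → Matrix κ κ ℂ)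
    (c₁ : M₁ × (B₁ × J₁) → X) (c₂ : M₂ × (B₂ × J₂) → W) : ℝ :=
  ((Fintype.card M₁ : ℝ)⁻¹ * (Fintype.card (M₂ × (B₂ × J₂)) : ℝ)⁻¹) *
    ∑ i : M₁ × (B₁ × J₁), ∑ j : M₂ × (B₂ × J₂),
      trPair (bookDev EA c₁ i.1 i.2 ⊗ₖ EB (c₂ j)) ρ

/-- If decoding is correct, the left side vanishes. Otherwise it is at most twice `Tr((A ⊗ B) ρ)`,
and the factors are unfolded one at a time: first `B` into its codeword operator and deviation, then
`A` in the term that contains Bob's codeword operator. Only that leading term has to be multiplied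
by the error count. -/
lemma trPair_decode_le (hρ : 0 ≤ ρ) (hEA : ∀ x, 0 ≤ EA x) (hEB : ∀ w, 0 ≤ EB w)
    (S : X → W → Prop) (c₁ : M₁ × (B₁ × J₁) → X) (c₂ : M₂ × (B₂ × J₂) → W) (x₀ : X × W)
    {Y : X × W → Matrix (ι × κ) (ι × κ) ℂ} (hY : ∀ p, IsDominated (Y p) ρ)
    (i : M₁ × (B₁ × J₁)) (j : M₂ × (B₂ × J₂)) :
    trPair (bookMeas EA c₁ i.1 i.2 ⊗ₖ bookMeas EB c₂ j.1 j.2) (Y (c₁ i, c₂ j)) -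
      trPair (bookMeas EA c₁ i.1 i.2 ⊗ₖ bookMeas EB c₂ j.1 j.2)
        (Y (binDecode S c₁ c₂ x₀ i.1 j.1 i.2.1 j.2.1)) ≤
    2 * (4 * ((Fintype.card (B₁ × J₁) : ℝ)⁻¹ * (Fintype.card (B₂ × J₂) : ℝ)⁻¹ *
        (errCount S c₁ c₂ i.1 j.1 i.2 j.2 * trPair (EA (c₁ i) ⊗ₖ EB (c₂ j)) ρ)) +
      4 * ((Fintype.card (B₂ × J₂) : ℝ)⁻¹ * trPair (bookDev EA c₁ i.1 i.2 ⊗ₖ EB (c₂ j)) ρ) +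
      2 * trPair (bookMeas EA c₁ i.1 i.2 ⊗ₖ bookDev EB c₂ j.1 j.2) ρ) := by
  set A := bookMeas EA c₁ i.1 i.2
  set B := bookMeas EB c₂ j.1 j.2
  set DA := bookDev EA c₁ i.1 i.2
  set DB := bookDev EB c₂ j.1 j.2
  set r₁ : ℝ := (Fintype.card (B₁ × J₁) : ℝ)⁻¹
  set r₂ : ℝ := (Fintype.card (B₂ × J₂) : ℝ)⁻¹
  have hr₁ : 0 ≤ r₁ := by positivity
  have hr₂ : 0 ≤ r₂ := by positivity
  have hA : 0 ≤ A := bookMeas_nonneg hEA c₁ i.1 i.2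
  have hB : 0 ≤ B := bookMeas_nonneg hEB c₂ j.1 j.2
  have hDA : 0 ≤ DA := bookDev_nonneg hEA c₁ i.1 i.2
  have hDB : 0 ≤ DB := bookDev_nonneg hEB c₂ j.1 j.2
  have hEE := trPair_kronecker_nonneg hρ (hEA (c₁ i)) (hEB (c₂ j))
  have hDE := trPair_kronecker_nonneg hρ hDA (hEB (c₂ j))
  have hAD := trPair_kronecker_nonneg hρ hA hDB
  have hAB : 0 ≤ A ⊗ₖ B := kronecker_nonneg hA hB
  by_cases hd : binDecode S c₁ c₂ x₀ i.1 j.1 i.2.1 j.2.1 = (c₁ i, c₂ j)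
  · rw [hd, sub_self]
    have herr := errCount_nonneg S c₁ c₂ i.1 j.1 i.2 j.2
    have e1 := mul_nonneg (mul_nonneg hr₁ hr₂) (mul_nonneg herr hEE)
    have e2 := mul_nonneg hr₂ hDE
    linarith
  · have herr := one_le_errCount hd
    have e1 : trPair (A ⊗ₖ B) ρ ≤ 2 * r₂ * trPair (A ⊗ₖ EB (c₂ j)) ρ +
        2 * trPair (A ⊗ₖ DB) ρ := by
      refine (trPair_kronecker_mono_right hρ hA (bookMeas_le hEB c₂ j.1 j.2)).trans_eq ?_
      rw [trPair_kronecker_add, trPair_kronecker_smul, trPair_kronecker_smul]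
    have e2 : trPair (A ⊗ₖ EB (c₂ j)) ρ ≤ 2 * r₁ * trPair (EA (c₁ i) ⊗ₖ EB (c₂ j)) ρ +
        2 * trPair (DA ⊗ₖ EB (c₂ j)) ρ := by
      refine (trPair_kronecker_mono_left hρ (bookMeas_le hEA c₁ i.1 i.2) (hEB _)).trans_eq ?_
      rw [trPair_add_kronecker, trPair_smul_kronecker, trPair_smul_kronecker]
    have e3 := trPair_le_self hAB (hY (c₁ i, c₂ j))
    have e4 := trPair_le_self hAB (hY (binDecode S c₁ c₂ x₀ i.1 j.1 i.2.1 j.2.1)).neg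
    rw [trPair_neg_right] at e4
    have e5 : trPair (EA (c₁ i) ⊗ₖ EB (c₂ j)) ρ ≤ errCount S c₁ c₂ i.1 j.1 i.2 j.2 *
        trPair (EA (c₁ i) ⊗ₖ EB (c₂ j)) ρ := le_mul_of_one_le_left hEE herr
    have e6 := mul_le_mul_of_nonneg_left e2 (by positivity : 0 ≤ 2 * r₂)
    have e7 := mul_le_mul_of_nonneg_left e5 (by positivity : 0 ≤ 4 * (r₁ * r₂))
    generalize trPair (A ⊗ₖ B) (Y (c₁ i, c₂ j)) = y₁ at *
    generalize trPair (A ⊗ₖ B) (Y (binDecode S c₁ c₂ x₀ i.1 j.1 i.2.1 j.2.1)) = y₂ at *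
    generalize errCount S c₁ c₂ i.1 j.1 i.2 j.2 * trPair (EA (c₁ i) ⊗ₖ EB (c₂ j)) ρ = y₃ at *
    linarith

lemma sum_trPair_smul {M L : Type*} [Fintype M] [Fintype L] (A : M → L → Matrix ι ι ℂ) (m : ℝ)
    (Y : M × L → Matrix ι ι ℂ) :
    ∑ i : M × L, trPair (m • A i.1 i.2) (Y i) = m * ∑ μ, ∑ l, trPair (A μ l) (Y (μ, l)) := by
  rw [Fintype.sum_prod_type]
  simp only [Finset.mul_sum, trPair_smul_left]

/-- The simulation of a product POVM by a fixed pair of codebooks. -/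
lemma trPair_simulation_le [Nonempty M₁] [Nonempty M₂] [Nonempty B₁] [Nonempty B₂] [Nonempty J₁]
    [Nonempty J₂] (hρ : 0 ≤ ρ) (hA : IsTrimmed (trSnd ρ) ΛA EA lamA κA δA)
    (hB : IsTrimmed (trFst ρ) ΛB EB lamB κB δB) (S : X → W → Prop) {t : ℝ} (ht : 0 < t)
    (c₁ : M₁ × (B₁ × J₁) → X) (c₂ : M₂ × (B₂ × J₂) → W) (x₀ : X × W)
    {Y : X × W → Matrix (ι × κ) (ι × κ) ℂ} (hY : ∀ p, IsDominated (Y p) ρ) :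
    ∑ x, ∑ w, trPair (ΛA x ⊗ₖ ΛB w) (Y (x, w)) -
      ((Fintype.card M₁ : ℝ)⁻¹ * (Fintype.card M₂ : ℝ)⁻¹) *
        ∑ i : M₁ × (B₁ × J₁), ∑ j : M₂ × (B₂ × J₂),
          trPair (bookMeas EA c₁ i.1 i.2 ⊗ₖ bookMeas EB c₂ j.1 j.2)
            (Y (binDecode S c₁ c₂ x₀ i.1 j.1 i.2.1 j.2.1)) ≤
      bookGap (trSnd ρ) EA lamA δA t c₁ + bookGap (trFst ρ) EB lamB δB t c₂ +
        2 * (4 * wrongWeight ρ EA EB S c₁ c₂ + 4 * crossDefect ρ EA EB c₁ c₂ +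
          2 * bookDefect (trFst ρ) EB c₂) := by
  set m₁ : ℝ := (Fintype.card M₁ : ℝ) with hm₁
  set m₂ : ℝ := (Fintype.card M₂ : ℝ) with hm₂
  have hm₁0 : 0 ≤ m₁⁻¹ := by positivity
  have hm₂0 : 0 ≤ m₂⁻¹ := by positivity
  have h1 := trPair_kronecker_close (I := M₁ × (B₁ × J₁)) (J := M₂ × (B₂ × J₂)) (ΛA := ΛA)
    (ΛB := ΛB) (f := c₁) (g := c₂) (A := fun i => m₁⁻¹ • bookMeas EA c₁ i.1 i.2)
    (B := fun j => m₂⁻¹ • bookMeas EB c₂ j.1 j.2) hρ hB.povm_nonneg hB.sum_povm.le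
    (fun i => smul_nonneg_of_nonneg hm₁0 (bookMeas_nonneg hA.nonneg c₁ i.1 i.2))
    (sum_smul_bookMeas_le hA.nonneg c₁)
    (fun Y hY => by
      rw [sum_trPair_smul (bookMeas EA c₁) m₁⁻¹ (fun i => Y (c₁ i))]
      exact hA.close_bookMeas c₁ ht hY)
    (fun Y hY => by
      rw [sum_trPair_smul (bookMeas EB c₂) m₂⁻¹ (fun i => Y (c₂ i))]
      exact hB.close_bookMeas c₂ ht hY)
    (Y := fun x w => Y (x, w)) (fun x w => hY (x, w))
  simp only [trPair_smul_kronecker, trPair_kronecker_smul] at h1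
  have h2 : ∑ i : M₁ × (B₁ × J₁), ∑ j : M₂ × (B₂ × J₂), m₂⁻¹ * (m₁⁻¹ *
      trPair (bookMeas EA c₁ i.1 i.2 ⊗ₖ bookMeas EB c₂ j.1 j.2) (Y (c₁ i, c₂ j))) =
      (m₁⁻¹ * m₂⁻¹) * ∑ i : M₁ × (B₁ × J₁), ∑ j : M₂ × (B₂ × J₂),
        trPair (bookMeas EA c₁ i.1 i.2 ⊗ₖ bookMeas EB c₂ j.1 j.2) (Y (c₁ i, c₂ j)) := by
    rw [mul_comm m₁⁻¹]
    simp only [Finset.mul_sum, mul_assoc]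
  rw [h2] at h1
  have h3 : (m₁⁻¹ * m₂⁻¹) * ∑ i : M₁ × (B₁ × J₁), ∑ j : M₂ × (B₂ × J₂),
        trPair (bookMeas EA c₁ i.1 i.2 ⊗ₖ bookMeas EB c₂ j.1 j.2) (Y (c₁ i, c₂ j)) -
      (m₁⁻¹ * m₂⁻¹) * ∑ i : M₁ × (B₁ × J₁), ∑ j : M₂ × (B₂ × J₂),
        trPair (bookMeas EA c₁ i.1 i.2 ⊗ₖ bookMeas EB c₂ j.1 j.2)
          (Y (binDecode S c₁ c₂ x₀ i.1 j.1 i.2.1 j.2.1)) ≤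
      2 * (4 * wrongWeight ρ EA EB S c₁ c₂ + 4 * crossDefect ρ EA EB c₁ c₂ +
        2 * ((m₁⁻¹ * m₂⁻¹) * ∑ i : M₁ × (B₁ × J₁), ∑ j : M₂ × (B₂ × J₂),
          trPair (bookMeas EA c₁ i.1 i.2 ⊗ₖ bookDev EB c₂ j.1 j.2) ρ)) := by
    rw [← mul_sub, ← Finset.sum_sub_distrib]
    simp only [← Finset.sum_sub_distrib]
    refine (mul_le_mul_of_nonneg_left (Finset.sum_le_sum fun i _ => Finset.sum_le_sum fun j _ =>
      trPair_decode_le hρ hA.nonneg hB.nonneg S c₁ c₂ x₀ hY i j) (by positivity)).trans_eq ?_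
    simp only [wrongWeight, crossDefect, Finset.sum_add_distrib, ← Finset.mul_sum]
    simp only [Fintype.card_prod, Nat.cast_mul, mul_inv, ← hm₁, ← hm₂]
    ring
  -- Alice's operators, averaged over her common randomness, sum to at most the identity, so Bob's
  -- deviation is seen on his marginal alone.
  have h4 : (m₁⁻¹ * m₂⁻¹) * ∑ i : M₁ × (B₁ × J₁), ∑ j : M₂ × (B₂ × J₂),
      trPair (bookMeas EA c₁ i.1 i.2 ⊗ₖ bookDev EB c₂ j.1 j.2) ρ ≤
      bookDefect (trFst ρ) EB c₂ := by
    have e1 : (m₁⁻¹ * m₂⁻¹) * ∑ i : M₁ × (B₁ × J₁), ∑ j : M₂ × (B₂ × J₂),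
        trPair (bookMeas EA c₁ i.1 i.2 ⊗ₖ bookDev EB c₂ j.1 j.2) ρ =
        m₂⁻¹ * ∑ j : M₂ × (B₂ × J₂),
          trPair ((∑ i : M₁ × (B₁ × J₁), m₁⁻¹ • bookMeas EA c₁ i.1 i.2) ⊗ₖ
            bookDev EB c₂ j.1 j.2) ρ := by
      simp only [trPair_sum_kronecker, trPair_smul_kronecker]
      rw [Finset.sum_comm]
      simp only [Finset.mul_sum]
      exact Finset.sum_congr rfl fun j _ => Finset.sum_congr rfl fun i _ => by ring
    rw [e1, bookDefect, ← hm₂]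
    refine mul_le_mul_of_nonneg_left ?_ hm₂0
    rw [Fintype.sum_prod_type]
    refine Finset.sum_le_sum fun μ _ => Finset.sum_le_sum fun l _ => ?_
    refine (trPair_kronecker_mono_left hρ (sum_smul_bookMeas_le hA.nonneg c₁)
      (bookDev_nonneg hB.nonneg c₂ μ l)).trans_eq ?_
    rw [trPair_one_kronecker]
  have h5 : bookGap (trSnd ρ) EA lamA δA t c₁ = δA + ∑ x, |lamA x - freq c₁ x| + t +
    (t⁻¹ + 1) * bookDefect (trSnd ρ) EA c₁ := rfl
  have h6 : bookGap (trFst ρ) EB lamB δB t c₂ = δB + ∑ x, |lamB x - freq c₂ x| + t +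
    (t⁻¹ + 1) * bookDefect (trFst ρ) EB c₂ := rfl
  rw [h5, h6]
  linarith

/-- Alice's deviation does not depend on Bob's codebook, and the mean of Bob's codeword operators is
at most the identity. -/
lemma expect_crossDefect_le [Nonempty M₂] [Nonempty B₂] [Nonempty J₂] (hρ : 0 ≤ ρ)
    (hEA : ∀ x, 0 ≤ EA x) (hB : IsTrimmed (trFst ρ) ΛB EB lamB κB δB)
    (c₁ : M₁ × (B₁ × J₁) → X) :
    expect lamB (fun c₂ : M₂ × (B₂ × J₂) → W => crossDefect ρ EA EB c₁ c₂) ≤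
      bookDefect (trSnd ρ) EA c₁ := by
  simp only [crossDefect, expect_const_mul, expect_sum]
  have h1 (i : M₁ × (B₁ × J₁)) (j : M₂ × (B₂ × J₂)) :
      expect lamB (fun c₂ : M₂ × (B₂ × J₂) → W =>
        trPair (bookDev EA c₁ i.1 i.2 ⊗ₖ EB (c₂ j)) ρ) ≤
      trPair (bookDev EA c₁ i.1 i.2) (trSnd ρ) := by
    rw [expect_apply hB.sum_lam j (fun w => trPair (bookDev EA c₁ i.1 i.2 ⊗ₖ EB w) ρ)]
    simp only [← trPair_kronecker_smul]
    rw [← trPair_kronecker_sum, ← trPair_kronecker_one]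
    exact trPair_kronecker_mono_right hρ (bookDev_nonneg hEA c₁ i.1 i.2) hB.sum_le
  refine (mul_le_mul_of_nonneg_left (Finset.sum_le_sum fun i _ => Finset.sum_le_sum fun j _ =>
    h1 i j) (by positivity)).trans_eq ?_
  have h2 : (Fintype.card (M₂ × (B₂ × J₂)) : ℝ) ≠ 0 := by exact_mod_cast Fintype.card_ne_zero
  simp only [Finset.sum_const, Finset.card_univ, nsmul_eq_mul, ← Finset.mul_sum, bookDefect]
  rw [Fintype.sum_prod_type]
  field_simp

open Classical in
lemma expect_wrongWeight_le [Nonempty M₁] [Nonempty M₂] [Nonempty B₁] [Nonempty B₂] [Nonempty J₁]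
    [Nonempty J₂] (hρ : 0 ≤ ρ) (hA : IsTrimmed (trSnd ρ) ΛA EA lamA κA δA)
    (hB : IsTrimmed (trFst ρ) ΛB EB lamB κB δB) {S : X → W → Prop} {π ω : ℝ}
    (hπ : (∑ x, ∑ w, if S x w then 0 else trPair (ΛA x ⊗ₖ ΛB w) ρ) ≤ π)
    (hω : ∑ x, ∑ w, lamA x * lamB w * (if S x w then 1 else 0) ≤ ω) :
    expect lamA (fun c₁ : M₁ × (B₁ × J₁) → X => expect lamB (fun c₂ : M₂ × (B₂ × J₂) → W =>
      wrongWeight ρ EA EB S c₁ c₂)) ≤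
      π + δA + δB + (Fintype.card J₁ * Fintype.card J₂ - 1 : ℝ) * ω := by
  simp only [wrongWeight, expect_const_mul, expect_sum]
  refine (mul_le_mul_of_nonneg_left (Finset.sum_le_sum fun i _ => Finset.sum_le_sum fun j _ =>
    expect_errCount_le hρ hA hB hπ hω i.1 j.1 i.2 j.2) (by positivity)).trans_eq ?_
  have h1 : (Fintype.card (M₁ × (B₁ × J₁)) : ℝ) ≠ 0 := by exact_mod_cast Fintype.card_ne_zero
  have h2 : (Fintype.card (M₂ × (B₂ × J₂)) : ℝ) ≠ 0 := by exact_mod_cast Fintype.card_ne_zero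
  simp only [Finset.sum_const, Finset.card_univ, nsmul_eq_mul]
  field_simp

open Classical in
/-- One-shot distributed measurement simulation. -/
theorem exists_codebooks [Nonempty M₁] [Nonempty M₂] [Nonempty B₁] [Nonempty B₂] [Nonempty J₁]
    [Nonempty J₂] (hρ : 0 ≤ ρ) (hA : IsTrimmed (trSnd ρ) ΛA EA lamA κA δA)
    (hB : IsTrimmed (trFst ρ) ΛB EB lamB κB δB) {S : X → W → Prop} {π ω : ℝ}
    (hπ : (∑ x, ∑ w, if S x w then 0 else trPair (ΛA x ⊗ₖ ΛB w) ρ) ≤ π)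
    (hω : ∑ x, ∑ w, lamA x * lamB w * (if S x w then 1 else 0) ≤ ω)
    {SA : Finset X} {SB : Finset W} {DA DB qA qB : ℝ} (hSA : (SA.card : ℝ) ≤ DA)
    (hSB : (SB.card : ℝ) ≤ DB) (hDA : 0 < DA) (hDB : 0 < DB) (hqA : ∑ x ∈ SAᶜ, lamA x ≤ qA)
    (hqB : ∑ w ∈ SBᶜ, lamB w ≤ qB) {t : ℝ} (ht : 0 < t) :
    ∃ (c₁ : M₁ × (B₁ × J₁) → X) (c₂ : M₂ × (B₂ × J₂) → W), ∀ (x₀ : X × W)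
      (Y : X × W → Matrix (ι × κ) (ι × κ) ℂ), (∀ p, IsDominated (Y p) ρ) →
      ∑ x, ∑ w, trPair (ΛA x ⊗ₖ ΛB w) (Y (x, w)) -
        ((Fintype.card M₁ : ℝ)⁻¹ * (Fintype.card M₂ : ℝ)⁻¹) *
          ∑ i : M₁ × (B₁ × J₁), ∑ j : M₂ × (B₂ × J₂),
            trPair (bookMeas EA c₁ i.1 i.2 ⊗ₖ bookMeas EB c₂ j.1 j.2)
              (Y (binDecode S c₁ c₂ x₀ i.1 j.1 i.2.1 j.2.1)) ≤
      (δA + (t + DA / (Fintype.card (M₁ × (B₁ × J₁)) * t) + 2 * qA) + t +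
        (t⁻¹ + 1) * (δA + κA / Fintype.card (B₁ × J₁))) +
      (δB + (t + DB / (Fintype.card (M₂ × (B₂ × J₂)) * t) + 2 * qB) + t +
        (t⁻¹ + 1) * (δB + κB / Fintype.card (B₂ × J₂))) +
      2 * (4 * (π + δA + δB + (Fintype.card J₁ * Fintype.card J₂ - 1 : ℝ) * ω) +
        4 * (δA + κA / Fintype.card (B₁ × J₁)) + 2 * (δB + κB / Fintype.card (B₂ × J₂))) := by
  -- This bound involves neither the test family `Y` nor the default value `x₀`, so the codebooks
  -- can be fixed before those are quantified.
  set Φ : (M₁ × (B₁ × J₁) → X) → (M₂ × (B₂ × J₂) → W) → ℝ := fun c₁ c₂ =>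
    bookGap (trSnd ρ) EA lamA δA t c₁ + bookGap (trFst ρ) EB lamB δB t c₂ +
        2 * (4 * wrongWeight ρ EA EB S c₁ c₂ + 4 * crossDefect ρ EA EB c₁ c₂ +
          2 * bookDefect (trFst ρ) EB c₂) with hΦ
  have hE1 (c₁ : M₁ × (B₁ × J₁) → X) : expect lamB (Φ c₁) ≤
      bookGap (trSnd ρ) EA lamA δA t c₁ +
        (δB + (t + DB / (Fintype.card (M₂ × (B₂ × J₂)) * t) + 2 * qB) + t +
          (t⁻¹ + 1) * (δB + κB / Fintype.card (B₂ × J₂))) +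
        2 * (4 * expect lamB (fun c₂ : M₂ × (B₂ × J₂) → W => wrongWeight ρ EA EB S c₁ c₂) +
          4 * bookDefect (trSnd ρ) EA c₁ + 2 * (δB + κB / Fintype.card (B₂ × J₂))) := by
    simp only [hΦ, expect_add, expect_const_mul, expect_const hB.sum_lam]
    have h1 := hB.expect_bookGap (M := M₂) (L := B₂ × J₂) ht SB hSB hDB hqB
    have h2 := expect_crossDefect_le (M₂ := M₂) (B₂ := B₂) (J₂ := J₂) hρ hA.nonneg hB c₁
    have h3 := hB.expect_bookDefect (M := M₂) (L := B₂ × J₂)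
    linarith
  have hE2 := expect_mono hA.lam_nonneg hE1
  simp only [expect_add, expect_const_mul, expect_const hA.sum_lam] at hE2
  have h1 := hA.expect_bookGap (M := M₁) (L := B₁ × J₁) ht SA hSA hDA hqA
  have h2 := hA.expect_bookDefect (M := M₁) (L := B₁ × J₁)
  have h3 := expect_wrongWeight_le (M₁ := M₁) (M₂ := M₂) (B₁ := B₁) (B₂ := B₂) (J₁ := J₁)
    (J₂ := J₂) hρ hA hB hπ hω
  -- The iterated mean is derandomized from outside: first Alice's codebook, then Bob's given hers.
  obtain ⟨c₁, hc₁⟩ := exists_le_of_expect_le hA.lam_nonneg hA.sum_lam (le_refl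
    (expect lamA (fun c₁ : M₁ × (B₁ × J₁) → X => expect lamB (Φ c₁))))
  obtain ⟨c₂, hc₂⟩ := exists_le_of_expect_le hB.lam_nonneg hB.sum_lam hc₁
  refine ⟨c₁, c₂, fun x₀ Y hY => ?_⟩
  refine (trPair_simulation_le hρ hA hB S ht c₁ c₂ x₀ hY).trans (hc₂.trans ?_)
  linarith

end OneShot

/-! ### Tensor powers -/

section TensorPower

variable {ι X : Type*} [Fintype ι] [DecidableEq ι] [Fintype X] [DecidableEq X] {n : ℕ}

/-- The operator `F 0 ⊗ ⋯ ⊗ F (n - 1)`. -/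
def piTensor (F : Fin n → Matrix ι ι ℂ) : Matrix (Fin n → ι) (Fin n → ι) ℂ :=
  Matrix.of fun p q => ∏ k, F k (p k) (q k)

lemma piTensor_mul (F G : Fin n → Matrix ι ι ℂ) :
    piTensor F * piTensor G = piTensor (fun k => F k * G k) := by
  ext p q
  simp only [piTensor, Matrix.mul_apply, Matrix.of_apply, ← Finset.prod_mul_distrib]
  rw [Finset.prod_univ_sum, Fintype.piFinset_univ]

lemma conjTranspose_piTensor (F : Fin n → Matrix ι ι ℂ) :
    (piTensor F)ᴴ = piTensor (fun k => (F k)ᴴ) := by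
  ext p q
  simp [piTensor, Matrix.conjTranspose_apply]

lemma piTensor_diagonal (d : Fin n → ι → ℂ) :
    piTensor (fun k => Matrix.diagonal (d k)) = Matrix.diagonal (fun p => ∏ k, d k (p k)) := by
  ext p q
  simp only [piTensor, Matrix.of_apply, Matrix.diagonal_apply]
  by_cases h : p = q
  · subst h
    simp
  · obtain ⟨k, hk⟩ := Function.ne_iff.mp h
    rw [if_neg h]
    exact Finset.prod_eq_zero (Finset.mem_univ k) (if_neg hk)

lemma piTensor_one : piTensor (fun _ : Fin n => (1 : Matrix ι ι ℂ)) = 1 := by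
  simp only [← Matrix.diagonal_one, piTensor_diagonal]
  simp

lemma sum_piTensor (M : X → Matrix ι ι ℂ) :
    ∑ x : Fin n → X, piTensor (fun k => M (x k)) = piTensor (fun _ => ∑ x, M x) := by
  ext p q
  simp only [Matrix.sum_apply, piTensor, Matrix.of_apply]
  rw [Finset.prod_univ_sum, Fintype.piFinset_univ]

lemma trace_piTensor (F : Fin n → Matrix ι ι ℂ) :
    (piTensor F).trace = ∏ k, (F k).trace := by
  simp only [Matrix.trace, Matrix.diag_apply, piTensor, Matrix.of_apply]
  rw [Finset.prod_univ_sum, Fintype.piFinset_univ]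

lemma piTensor_nonneg {F : Fin n → Matrix ι ι ℂ} (hF : ∀ k, 0 ≤ F k) : 0 ≤ piTensor F := by
  choose G hG using fun k => exists_conjTranspose_mul_self (hF k)
  have : piTensor F = (piTensor G)ᴴ * piTensor G := by
    rw [conjTranspose_piTensor, piTensor_mul]
    congr 1
    exact funext hG
  rw [this]
  exact conjTranspose_mul_self_nonneg _

lemma piTensor_diagIn (V : Fin n → Matrix ι ι ℂ) (d : Fin n → ι → ℝ) :
    piTensor (fun k => diagIn (V k) (d k)) =
      diagIn (piTensor V) (fun p => ∏ k, d k (p k)) := by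
  simp only [diagIn, ← piTensor_mul, piTensor_diagonal, conjTranspose_piTensor,
    Complex.ofReal_prod]

lemma piTensor_isometry {V : Fin n → Matrix ι ι ℂ} (hV : ∀ k, (V k)ᴴ * V k = 1) :
    (piTensor V)ᴴ * piTensor V = 1 := by
  rw [conjTranspose_piTensor, piTensor_mul]
  simp only [hV, piTensor_one]

end TensorPower

section TensorAB

variable {a b U V Z : Type*} [Fintype a] [DecidableEq a] [Fintype b] [DecidableEq b]
  [Fintype U] [DecidableEq U] [Fintype V] [DecidableEq V] [Fintype Z] [DecidableEq Z] {n : ℕ}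

lemma tensorAB_eq_submatrix (F : Fin n → Matrix (a × b) (a × b) ℂ) :
    tensorAB F = (piTensor F).submatrix (Equiv.arrowProdEquivProdArrow (Fin n) (fun _ => a)
      (fun _ => b)).symm (Equiv.arrowProdEquivProdArrow (Fin n) (fun _ => a) (fun _ => b)).symm :=
  rfl

lemma tensorAB_nonneg {F : Fin n → Matrix (a × b) (a × b) ℂ} (hF : ∀ k, 0 ≤ F k) :
    0 ≤ tensorAB F := by
  rw [tensorAB_eq_submatrix]
  exact ((posSemidef_of_nonneg (piTensor_nonneg hF)).submatrix _).nonneg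

lemma trace_tensorAB_mul (F G : Fin n → Matrix (a × b) (a × b) ℂ) :
    (tensorAB F * tensorAB G).trace = ∏ k, (F k * G k).trace := by
  rw [tensorAB_eq_submatrix, tensorAB_eq_submatrix, Matrix.submatrix_mul_equiv, piTensor_mul,
    ← trace_piTensor]
  exact Fintype.sum_equiv (Equiv.arrowProdEquivProdArrow (Fin n) (fun _ => a) (fun _ => b)).symm
    _ _ fun p => rfl

lemma tensorAB_kronecker (F : Fin n → Matrix a a ℂ) (G : Fin n → Matrix b b ℂ) :
    tensorAB (fun k => F k ⊗ₖ G k) = piTensor F ⊗ₖ piTensor G := by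
  ext p q
  simp [tensorAB, piTensor, Finset.prod_mul_distrib]

lemma trSnd_tensorAB (F : Fin n → Matrix (a × b) (a × b) ℂ) :
    trSnd (tensorAB F) = piTensor (fun k => trSnd (F k)) := by
  ext p q
  simp only [trSnd, tensorAB, piTensor, Matrix.of_apply]
  rw [Finset.prod_univ_sum, Fintype.piFinset_univ]

lemma trFst_tensorAB (F : Fin n → Matrix (a × b) (a × b) ℂ) :
    trFst (tensorAB F) = piTensor (fun k => trFst (F k)) := by
  ext p q
  simp only [trFst, tensorAB, piTensor, Matrix.of_apply]
  rw [Finset.prod_univ_sum, Fintype.piFinset_univ]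

lemma measPow_eq_sum {M : Z → Matrix (a × b) (a × b) ℂ} {MA : U → Matrix a a ℂ}
    {MB : V → Matrix b b ℂ} {g : U × V → Z} (hg : IsDeterministicIntegration M MA MB g)
    (z : Fin n → Z) :
    measPow M n z = ∑ x : Fin n → U, ∑ w : Fin n → V,
      if (fun k => g (x k, w k)) = z then
        piTensor (fun k => MA (x k)) ⊗ₖ piTensor (fun k => MB (w k)) else 0 := by
  ext p q
  have h1 (k : Fin n) : M (z k) (p.1 k, p.2 k) (q.1 k, q.2 k) = ∑ u : U × V,
      if g u = z k then MA u.1 (p.1 k) (q.1 k) * MB u.2 (p.2 k) (q.2 k) else 0 := by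
    rw [hg (z k), Matrix.sum_apply, Fintype.sum_prod_type]
    refine Finset.sum_congr rfl fun u _ => ?_
    rw [Matrix.sum_apply]
    refine Finset.sum_congr rfl fun v _ => ?_
    split_ifs <;> simp
  simp only [measPow, tensorAB, Matrix.of_apply, h1]
  rw [Finset.prod_univ_sum, Fintype.piFinset_univ, Matrix.sum_apply]
  simp only [Matrix.sum_apply]
  rw [← Fintype.sum_prod_type' (f := fun (x : Fin n → U) (w : Fin n → V) =>
    (if (fun k => g (x k, w k)) = z then
        piTensor (fun k => MA (x k)) ⊗ₖ piTensor (fun k => MB (w k)) else 0) p q)]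
  refine Fintype.sum_equiv (Equiv.arrowProdEquivProdArrow (Fin n) (fun _ => U) (fun _ => V)) _ _
    fun f => ?_
  change _ = (if (fun k => g ((f k).1, (f k).2)) = z then
    piTensor (fun k => MA (f k).1) ⊗ₖ piTensor (fun k => MB (f k).2) else 0) p q
  by_cases hz : (fun k => g ((f k).1, (f k).2)) = z
  · rw [if_pos hz]
    have hz' (k : Fin n) : g (f k) = z k := congrFun hz k
    simp [hz', piTensor, Finset.prod_mul_distrib]
  · rw [if_neg hz]
    obtain ⟨k, hk⟩ := Function.ne_iff.mp hz
    exact Finset.prod_eq_zero (Finset.mem_univ k) (if_neg hk)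

lemma sum_trPair_measPow {M : Z → Matrix (a × b) (a × b) ℂ} {MA : U → Matrix a a ℂ}
    {MB : V → Matrix b b ℂ} {g : U × V → Z} (hg : IsDeterministicIntegration M MA MB g)
    (Y : (Fin n → Z) → Matrix ((Fin n → a) × (Fin n → b)) ((Fin n → a) × (Fin n → b)) ℂ) :
    ∑ z, trPair (measPow M n z) (Y z) = ∑ x : Fin n → U, ∑ w : Fin n → V,
      trPair (piTensor (fun k => MA (x k)) ⊗ₖ piTensor (fun k => MB (w k)))
        (Y fun k => g (x k, w k)) := by
  simp only [measPow_eq_sum hg, trPair_sum_left]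
  rw [Finset.sum_comm]
  refine Finset.sum_congr rfl fun x _ => ?_
  rw [Finset.sum_comm]
  refine Finset.sum_congr rfl fun w _ => ?_
  rw [Finset.sum_eq_single (fun k => g (x k, w k))]
  · rw [if_pos rfl]
  · intro z _ hz
    rw [if_neg hz.symm, trPair_zero_left]
  · simp

end TensorAB

/-! ### Faithfulness from dominated families -/

section Faithful

variable {ι X : Type*} [Fintype ι] [DecidableEq ι] [Fintype X]

/-- The hypothesis is spent twice, with `ε/2` each time: on the family that attains the trace norms,
and on the constant family `ρ`, which gives the missing weight of the sub-POVM. -/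
lemma isFaithful_of_trPair_le {ρ : Matrix ι ι ℂ} (hρ : 0 ≤ ρ) {M M' : X → Matrix ι ι ℂ}
    (hM : ∀ x, (M x).IsHermitian) (hM' : ∀ x, (M' x).IsHermitian) (hM1 : ∑ x, M x = 1) {ε : ℝ}
    (h : ∀ Y : X → Matrix ι ι ℂ, (∀ x, IsDominated (Y x) ρ) →
      ∑ x, trPair (M x) (Y x) - ∑ x, trPair (M' x) (Y x) ≤ ε / 2) :
    IsFaithful ε M M' ρ := by
  choose Y hY hYn using fun x => exists_dominated_traceNorm hρ ((hM x).sub (hM' x))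
  have h1 := h Y hY
  have h2 := h (fun _ => ρ) (fun _ => isDominated_self hρ)
  rw [← trPair_sum_left, ← trPair_sum_left, hM1] at h2
  have h3 : ((1 - ∑ x, M' x) * ρ).trace.re = trPair 1 ρ - trPair (∑ x, M' x) ρ := by
    rw [← trPair_sub_left, trPair]
  rw [IsFaithful, h3]
  simp only [hYn, trPair_sub_left, Finset.sum_sub_distrib]
  linarith

end Faithful

/-! ### The protocol of a pair of binned codebooks -/

section Protocol

variable {a b U V Z : Type*} [Fintype a] [DecidableEq a] [Fintype b] [DecidableEq b]
  [Fintype U] [DecidableEq U] [Fintype V] [DecidableEq V] [Fintype Z] [DecidableEq Z]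

/-- The labels below `Θ`, as elements of `Fin Θ`. -/
def rangeEquivFin (Θ : ℕ) : Finset.range Θ ≃ Fin Θ where
  toFun l := ⟨l.1, Finset.mem_range.mp l.2⟩
  invFun i := ⟨i.1, Finset.mem_range.mpr i.2⟩
  left_inv _ := rfl
  right_inv _ := rfl

lemma sum_bin_bookMeas_isSubPOVM {ι X M B J : Type*} [Fintype ι] [DecidableEq ι] [Fintype X]
    [DecidableEq X] [Fintype M] [DecidableEq M] [Fintype B] [DecidableEq B] [Fintype J]
    [DecidableEq J] {E : X → Matrix ι ι ℂ} (hE : ∀ x, 0 ≤ E x) (c : M × (B × J) → X) (μ : M)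
    {L : Type*} [Fintype L] (e : L ≃ B) :
    IsSubPOVM (fun l : L => ∑ j, bookMeas E c μ (e l, j)) := by
  refine ⟨fun l => posSemidef_of_nonneg (Finset.sum_nonneg fun j _ => bookMeas_nonneg hE c μ _), ?_⟩
  refine Matrix.le_iff.mp ?_
  rw [Fintype.sum_equiv e _ (fun b => ∑ j, bookMeas E c μ (b, j)) fun _ => rfl,
    ← Fintype.sum_prod_type]
  exact sum_bookMeas_le hE c μ

/-- The protocol in which both sides send the bin of their codeword. -/
def bookProtocol {n Θ₁ Θ₂ N₁ N₂ K₁ K₂ : ℕ} {EA : (Fin n → U) → Matrix (Fin n → a) (Fin n → a) ℂ}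
    {EB : (Fin n → V) → Matrix (Fin n → b) (Fin n → b) ℂ} (hEA : ∀ x, 0 ≤ EA x)
    (hEB : ∀ w, 0 ≤ EB w) (c₁ : Fin N₁ × (Fin Θ₁ × Fin K₁) → (Fin n → U))
    (c₂ : Fin N₂ × (Fin Θ₂ × Fin K₂) → (Fin n → V))
    (dec : Fin N₁ → Fin N₂ → Fin Θ₁ → Fin Θ₂ → (Fin n → Z)) :
    Protocol a b Z n Θ₁ Θ₂ (N₁ * N₂) where
  L₁ := Finset.range Θ₁
  L₂ := Finset.range Θ₂
  card_L₁ := by simp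
  card_L₂ := by simp
  alice μ l := ∑ j, bookMeas EA c₁ (finProdFinEquiv.symm μ).1 (rangeEquivFin Θ₁ l, j)
  bob μ l := ∑ j, bookMeas EB c₂ (finProdFinEquiv.symm μ).2 (rangeEquivFin Θ₂ l, j)
  alice_subPOVM μ := sum_bin_bookMeas_isSubPOVM hEA c₁ _ _
  bob_subPOVM μ := sum_bin_bookMeas_isSubPOVM hEB c₂ _ _
  decode μ l₁ l₂ := dec (finProdFinEquiv.symm μ).1 (finProdFinEquiv.symm μ).2
    (rangeEquivFin Θ₁ l₁) (rangeEquivFin Θ₂ l₂)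

lemma Protocol.overall_nonneg {n Θ₁ Θ₂ N : ℕ} (P : Protocol a b Z n Θ₁ Θ₂ N) (z : Fin n → Z) :
    0 ≤ P.overall z := by
  have h : P.overall z = (1 / (N : ℝ)) • ∑ μ, ∑ l₁, ∑ l₂,
      if P.decode μ l₁ l₂ = z then P.alice μ l₁ ⊗ₖ P.bob μ l₂ else 0 := by
    ext p q
    simp [Protocol.overall]
  rw [h]
  refine smul_nonneg_of_nonneg (by positivity) (Finset.sum_nonneg fun μ _ =>
    Finset.sum_nonneg fun l₁ _ => Finset.sum_nonneg fun l₂ _ => ?_)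
  split_ifs
  · exact kronecker_nonneg ((P.alice_subPOVM μ).1 l₁).nonneg ((P.bob_subPOVM μ).1 l₂).nonneg
  · exact le_rfl

lemma Protocol.sum_trPair_overall {n Θ₁ Θ₂ N : ℕ} (P : Protocol a b Z n Θ₁ Θ₂ N)
    (Y : (Fin n → Z) → Matrix ((Fin n → a) × (Fin n → b)) ((Fin n → a) × (Fin n → b)) ℂ) :
    ∑ z, trPair (P.overall z) (Y z) = (N : ℝ)⁻¹ * ∑ μ, ∑ l₁, ∑ l₂,
      trPair (P.alice μ l₁ ⊗ₖ P.bob μ l₂) (Y (P.decode μ l₁ l₂)) := by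
  have h (z : Fin n → Z) : P.overall z = (N : ℝ)⁻¹ • ∑ μ, ∑ l₁, ∑ l₂,
      if P.decode μ l₁ l₂ = z then P.alice μ l₁ ⊗ₖ P.bob μ l₂ else 0 := by
    ext p q
    simp [Protocol.overall]
  simp only [h, trPair_smul_left, trPair_sum_left, ← Finset.mul_sum]
  congr 1
  rw [Finset.sum_comm]
  refine Finset.sum_congr rfl fun μ _ => ?_
  rw [Finset.sum_comm]
  refine Finset.sum_congr rfl fun l₁ _ => ?_
  rw [Finset.sum_comm]
  refine Finset.sum_congr rfl fun l₂ _ => ?_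
  rw [Finset.sum_eq_single (P.decode μ l₁ l₂)]
  · rw [if_pos rfl]
  · intro z _ hz
    rw [if_neg hz.symm, trPair_zero_left]
  · simp

/-- The decoder sees only the bins, so the operators within a bin may be summed before or after
tensoring; the common randomness is a pair, one component for each party. -/
lemma sum_trPair_bookProtocol {n Θ₁ Θ₂ N₁ N₂ K₁ K₂ : ℕ}
    {EA : (Fin n → U) → Matrix (Fin n → a) (Fin n → a) ℂ}
    {EB : (Fin n → V) → Matrix (Fin n → b) (Fin n → b) ℂ} (hEA : ∀ x, 0 ≤ EA x)
    (hEB : ∀ w, 0 ≤ EB w) (c₁ : Fin N₁ × (Fin Θ₁ × Fin K₁) → (Fin n → U))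
    (c₂ : Fin N₂ × (Fin Θ₂ × Fin K₂) → (Fin n → V))
    (dec : Fin N₁ → Fin N₂ → Fin Θ₁ → Fin Θ₂ → (Fin n → Z))
    (Y : (Fin n → Z) → Matrix ((Fin n → a) × (Fin n → b)) ((Fin n → a) × (Fin n → b)) ℂ) :
    ∑ z, trPair ((bookProtocol hEA hEB c₁ c₂ dec).overall z) (Y z) =
      ((N₁ : ℝ)⁻¹ * (N₂ : ℝ)⁻¹) *
        ∑ i : Fin N₁ × (Fin Θ₁ × Fin K₁), ∑ j : Fin N₂ × (Fin Θ₂ × Fin K₂),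
          trPair (bookMeas EA c₁ i.1 i.2 ⊗ₖ bookMeas EB c₂ j.1 j.2)
            (Y (dec i.1 j.1 i.2.1 j.2.1)) := by
  rw [Protocol.sum_trPair_overall, Nat.cast_mul, mul_inv]
  congr 1
  rw [← Fintype.sum_equiv finProdFinEquiv (fun μ : Fin N₁ × Fin N₂ => ∑ b₁ : Fin Θ₁, ∑ b₂ : Fin Θ₂,
    trPair ((∑ j, bookMeas EA c₁ μ.1 (b₁, j)) ⊗ₖ (∑ j, bookMeas EB c₂ μ.2 (b₂, j)))
      (Y (dec μ.1 μ.2 b₁ b₂))) _ (fun μ => ?_)]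
  · simp only [trPair_sum_kronecker, trPair_kronecker_sum, Fintype.sum_prod_type]
    refine Finset.sum_congr rfl fun μ₁ _ => ?_
    rw [Finset.sum_comm]
    refine Finset.sum_congr rfl fun b₁ _ => ?_
    simp only [Finset.sum_comm (s := (Finset.univ : Finset (Fin K₁)))]
  · refine (Fintype.sum_equiv (rangeEquivFin Θ₁) _ _ fun l₁ => ?_).symm
    refine Fintype.sum_equiv (rangeEquivFin Θ₂) _ _ fun l₂ => ?_
    simp [bookProtocol]

end Protocol

/-! ### Trimming a POVM -/

section Trim

variable {ι X : Type*} [Fintype ι] [DecidableEq ι] [Fintype X]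

lemma mul_self_le_smul {A : Matrix ι ι ℂ} {r : ℝ} (hA : 0 ≤ A) (h : A ≤ r • 1) :
    A * A ≤ r • A := by
  obtain ⟨V, d, hV, rfl⟩ := exists_eq_diagIn (posSemidef_of_nonneg hA).1
  have h0 := nonneg_of_diagIn_nonneg hV hA
  rw [← sub_nonneg, ← diagIn_one hV, smul_diagIn, diagIn_sub] at h
  have h1 := nonneg_of_diagIn_nonneg hV h
  rw [diagIn_mul hV, smul_diagIn]
  exact diagIn_mono fun i => mul_le_mul_of_nonneg_right (by linarith [h1 i]) (h0 i)

/-- Conjugating the hypothesis by `G` gives `(Gᴴ G)² ≤ r Gᴴ G`, and `d² ≤ r d` forces `d ≤ r` for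
each eigenvalue `d ≥ 0`. -/
lemma gram_le_of_gram_conjTranspose_le {G : Matrix ι ι ℂ} {r : ℝ} (hr : 0 ≤ r)
    (h : G * Gᴴ ≤ r • 1) : Gᴴ * G ≤ r • 1 := by
  have h1 := conj_mono h G
  have h2 : Gᴴ * (G * Gᴴ) * G = (Gᴴ * G) * (Gᴴ * G) := by simp only [Matrix.mul_assoc]
  rw [h2, Matrix.mul_smul, Matrix.smul_mul, Matrix.mul_one] at h1
  have h0 := conjTranspose_mul_self_nonneg G
  generalize Gᴴ * G = A at h0 h1
  obtain ⟨V, d, hV, rfl⟩ := exists_eq_diagIn (posSemidef_of_nonneg h0).1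
  have e0 := nonneg_of_diagIn_nonneg hV h0
  rw [← sub_nonneg, smul_diagIn, diagIn_mul hV, diagIn_sub] at h1
  have e1 := nonneg_of_diagIn_nonneg hV h1
  rw [← diagIn_one hV, smul_diagIn]
  refine diagIn_mono fun i => ?_
  rw [mul_one]
  by_contra! hlt
  have := e1 i
  nlinarith [e0 i]

/-- The spectral data of a state and of a POVM that are used to trim the POVM. -/
structure SpectralData (ρ : Matrix ι ι ℂ) (Λ : X → Matrix ι ι ℂ) (V : Matrix ι ι ℂ) (q : ι → ℝ)
    (F B : X → Matrix ι ι ℂ) (e : X → ι → ℝ) : Prop where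
  isometry : Vᴴ * V = 1
  state_eq : ρ = diagIn V q
  eig_nonneg : ∀ i, 0 ≤ q i
  sum_eig : ∑ i, q i = 1
  povm_eq : ∀ x, Λ x = (F x)ᴴ * F x
  sum_povm : ∑ x, Λ x = 1
  isometry_post : ∀ x, (B x)ᴴ * B x = 1
  post_eq : ∀ x, F x * ρ * (F x)ᴴ = diagIn (B x) (e x)
  post_nonneg : ∀ x i, 0 ≤ e x i

lemma exists_spectralData {ρ : Matrix ι ι ℂ} {Λ : X → Matrix ι ι ℂ} (hρ : 0 ≤ ρ)
    (hρ1 : ρ.trace = 1) (hΛ : ∀ x, 0 ≤ Λ x) (hΛ1 : ∑ x, Λ x = 1) :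
    ∃ V q F B e, SpectralData ρ Λ V q F B e := by
  obtain ⟨V, q, hV, hq⟩ := exists_eq_diagIn (posSemidef_of_nonneg hρ).1
  choose F hF using fun x => exists_conjTranspose_mul_self (hΛ x)
  have hH (x : X) : 0 ≤ F x * ρ * (F x)ᴴ := conj_nonneg' hρ (F x)
  choose B e hB he using fun x => exists_eq_diagIn (posSemidef_of_nonneg (hH x)).1
  refine ⟨V, q, F, B, e, hV, hq, nonneg_of_diagIn_nonneg hV (hq ▸ hρ), ?_, hF, hΛ1, hB, he,
    fun x => nonneg_of_diagIn_nonneg (hB x) (he x ▸ hH x)⟩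
  rw [hq, trace_diagIn hV] at hρ1
  exact_mod_cast hρ1

variable {ρ : Matrix ι ι ℂ} {Λ : X → Matrix ι ι ℂ} {V : Matrix ι ι ℂ} {q : ι → ℝ}
  {F B : X → Matrix ι ι ℂ} {e : X → ι → ℝ}

lemma SpectralData.state_nonneg (h : SpectralData ρ Λ V q F B e) : 0 ≤ ρ := by
  rw [h.state_eq]
  exact diagIn_nonneg h.eig_nonneg

lemma SpectralData.trPair_one (h : SpectralData ρ Λ V q F B e) : trPair 1 ρ = 1 := by
  rw [h.state_eq, ← diagIn_one h.isometry, trPair_diagIn h.isometry]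
  simpa using h.sum_eig

lemma trPair_conj (G P ρ : Matrix ι ι ℂ) :
    trPair (Gᴴ * P * G) ρ = trPair P (G * ρ * Gᴴ) := by
  rw [trPair, trPair, Matrix.mul_assoc, Matrix.mul_assoc, Matrix.trace_mul_comm]
  simp only [Matrix.mul_assoc]

lemma SpectralData.trPair_povm (h : SpectralData ρ Λ V q F B e) (x : X) :
    trPair (Λ x) ρ = ∑ i, e x i := by
  have h1 : Λ x = (F x)ᴴ * 1 * F x := by rw [Matrix.mul_one, h.povm_eq]
  rw [h1, trPair_conj, h.post_eq, ← diagIn_one (h.isometry_post x),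
    trPair_diagIn (h.isometry_post x)]
  simp

open Classical in
/-- The indicator of a set, as a real-valued function. -/
def ind {Y : Type*} (S : Y → Prop) (y : Y) : ℝ := if S y then 1 else 0

lemma ind_nonneg {Y : Type*} (S : Y → Prop) (y : Y) : 0 ≤ ind S y := by
  rw [ind]
  split_ifs <;> norm_num

lemma ind_le_one {Y : Type*} (S : Y → Prop) (y : Y) : ind S y ≤ 1 := by
  rw [ind]
  split_ifs <;> norm_num

lemma ind_mul_self {Y : Type*} (S : Y → Prop) (y : Y) : ind S y * ind S y = ind S y := by
  rw [ind]
  split_ifs <;> norm_num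

/-- The operators of a POVM, restricted to typical eigenvectors on both sides. -/
def trim (V : Matrix ι ι ℂ) (F B : X → Matrix ι ι ℂ) (S : ι → Prop) (R : X → ι → Prop) (x : X) :
    Matrix ι ι ℂ :=
  (diagIn (B x) (ind (R x)) * F x * diagIn V (ind S))ᴴ *
    (diagIn (B x) (ind (R x)) * F x * diagIn V (ind S))

lemma trim_eq {S : ι → Prop} {R : X → ι → Prop} {x : X} (hB : (B x)ᴴ * B x = 1) :
    trim V F B S R x =
      (diagIn V (ind S))ᴴ * ((F x)ᴴ * diagIn (B x) (ind (R x)) * F x) * diagIn V (ind S) := by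
  have h1 : diagIn (B x) (ind (R x)) * diagIn (B x) (ind (R x)) = diagIn (B x) (ind (R x)) := by
    rw [diagIn_mul hB]
    simp only [ind_mul_self]
  have h2 : trim V F B S R x = (diagIn V (ind S))ᴴ * ((F x)ᴴ * (diagIn (B x) (ind (R x)) *
      diagIn (B x) (ind (R x))) * F x) * diagIn V (ind S) := by
    simp only [trim, Matrix.conjTranspose_mul, conjTranspose_diagIn, Matrix.mul_assoc]
  rw [h2, h1]

lemma SpectralData.conj_diag_le (h : SpectralData ρ Λ V q F B e) (R : X → ι → Prop) (x : X) :
    (F x)ᴴ * diagIn (B x) (ind (R x)) * F x ≤ Λ x := by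
  have h1 : diagIn (B x) (ind (R x)) ≤ 1 := by
    rw [← diagIn_one (h.isometry_post x)]
    exact diagIn_mono fun i => ind_le_one _ _
  refine (conj_mono h1 (F x)).trans_eq ?_
  rw [Matrix.mul_one, h.povm_eq]

lemma SpectralData.sum_trim_le (h : SpectralData ρ Λ V q F B e) (S : ι → Prop)
    (R : X → ι → Prop) : ∑ x, trim V F B S R x ≤ 1 := by
  have h1 : ∑ x, trim V F B S R x ≤ ∑ x, (diagIn V (ind S))ᴴ * Λ x * diagIn V (ind S) := by
    refine Finset.sum_le_sum fun x _ => ?_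
    rw [trim_eq (h.isometry_post x)]
    exact conj_mono (h.conj_diag_le R x) _
  refine h1.trans ?_
  rw [← Finset.sum_mul, ← Finset.mul_sum, h.sum_povm, Matrix.mul_one, conjTranspose_diagIn,
    diagIn_mul h.isometry, ← diagIn_one h.isometry]
  refine diagIn_mono fun i => ?_
  rw [ind_mul_self]
  exact ind_le_one _ _

lemma SpectralData.trPair_trim_le (h : SpectralData ρ Λ V q F B e) (S : ι → Prop)
    (R : X → ι → Prop) (x : X) : trPair (trim V F B S R x) ρ ≤ ∑ i, e x i := by
  rw [trim_eq (h.isometry_post x), trPair_conj, conjTranspose_diagIn, ← h.trPair_povm]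
  have h1 : diagIn V (ind S) * ρ * diagIn V (ind S) ≤ ρ := by
    rw [h.state_eq, diagIn_mul h.isometry, diagIn_mul h.isometry]
    refine diagIn_mono fun i => ?_
    rw [mul_right_comm, ind_mul_self]
    exact mul_le_of_le_one_left (h.eig_nonneg i) (ind_le_one _ _)
  have h2 : 0 ≤ (F x)ᴴ * diagIn (B x) (ind (R x)) * F x :=
    conj_nonneg (diagIn_nonneg fun i => ind_nonneg _ _) _
  exact (trPair_mono_right h1 h2).trans (trPair_mono_left (h.conj_diag_le R x) h.state_nonneg)

/-- With `G = P F Q` it is enough to bound `G Gᴴ`. On the support of `Q` the state is at least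
`1/c`, so `Q ≤ c ρ` and `G Gᴴ ≤ c P (F ρ Fᴴ) P`; the projection `P` keeps only eigenvalues of `F ρ
Fᴴ` that are at most `r`. -/
lemma SpectralData.trim_le (h : SpectralData ρ Λ V q F B e) {S : ι → Prop} {R : X → ι → Prop}
    {x : X} {c r : ℝ} (hc : 0 ≤ c) (hr : 0 ≤ r) (hS : ∀ i, S i → 1 ≤ c * q i)
    (hR : ∀ i, R x i → e x i ≤ r) : trim V F B S R x ≤ (c * r) • 1 := by
  refine gram_le_of_gram_conjTranspose_le (by positivity) ?_
  set P := diagIn (B x) (ind (R x)) with hP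
  set Q := diagIn V (ind S) with hQ
  have h1 : Q * Qᴴ ≤ c • ρ := by
    rw [hQ, conjTranspose_diagIn, diagIn_mul h.isometry, h.state_eq, smul_diagIn]
    refine diagIn_mono fun i => ?_
    rw [ind_mul_self, ind]
    split_ifs with hi
    · exact hS i hi
    · exact mul_nonneg hc (h.eig_nonneg i)
  have h2 := conj_mono h1 ((P * F x)ᴴ)
  rw [Matrix.conjTranspose_conjTranspose] at h2
  have h3 : P * F x * Q * (P * F x * Q)ᴴ = P * F x * (Q * Qᴴ) * (P * F x)ᴴ := by
    simp only [Matrix.conjTranspose_mul, Matrix.mul_assoc]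
  have h4 : P * F x * (c • ρ) * (P * F x)ᴴ = c • (P * (F x * ρ * (F x)ᴴ) * P) := by
    rw [Matrix.mul_smul, Matrix.smul_mul, Matrix.conjTranspose_mul, hP, conjTranspose_diagIn]
    simp only [Matrix.mul_assoc]
  rw [h3]
  refine h2.trans ?_
  rw [h4, mul_smul]
  refine smul_mono_right hc ?_
  rw [h.post_eq, hP, diagIn_mul (h.isometry_post x), diagIn_mul (h.isometry_post x),
    ← diagIn_one (h.isometry_post x), smul_diagIn]
  refine diagIn_mono fun i => ?_
  rw [mul_right_comm, ind_mul_self, ind, mul_one]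
  split_ifs with hi
  · rw [one_mul]
    exact hR i hi
  · rw [zero_mul]
    exact hr

/-- The root changes by `F - P F Q = (1 - P) F + P F (1 - Q)`. The first part weighs the eigenvalues
of the post-measurement states removed by `P`; the second, summed over the outcomes, weighs at most
the eigenvalues of the state removed by `Q`. The perturbation bound for `Fᴴ F` does the rest. -/
lemma SpectralData.trim_close (h : SpectralData ρ Λ V q F B e) (S : ι → Prop)
    (R : X → ι → Prop) {ε₁ ε₂ t : ℝ} (h₁ : ∑ x, ∑ i, (1 - ind (R x) i) * e x i ≤ ε₁)
    (h₂ : ∑ i, (1 - ind S i) * q i ≤ ε₂) (ht : 0 < t) {Y : X → Matrix ι ι ℂ}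
    (hY : ∀ x, IsDominated (Y x) ρ) :
    ∑ x, trPair (Λ x - trim V F B S R x) (Y x) ≤ t + (t⁻¹ + 1) * (2 * ε₁ + 2 * ε₂) := by
  set P : X → Matrix ι ι ℂ := fun x => diagIn (B x) (ind (R x)) with hP
  set Q := diagIn V (ind S) with hQ
  have hQ1 : 1 - Q = diagIn V (fun i => 1 - ind S i) := by
    rw [hQ, ← diagIn_one h.isometry, diagIn_sub]
  have hP1 (x : X) : 1 - P x = diagIn (B x) (fun i => 1 - ind (R x) i) := by
    rw [hP, ← diagIn_one (h.isometry_post x), diagIn_sub]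
  have hsq (S : ι → Prop) (i : ι) : (1 - ind S i) * (1 - ind S i) = 1 - ind S i := by
    have := ind_mul_self S i
    linarith
  have key (x : X) : trPair (Λ x - trim V F B S R x) (Y x) ≤ t * trPair (Λ x) ρ + (t⁻¹ + 1) *
      (2 * ∑ i, (1 - ind (R x) i) * e x i + 2 * trPair (Λ x) ((1 - Q) * ρ * (1 - Q)ᴴ)) := by
    set D₁ := (1 - P x) * F x with hD₁
    set D₂ := P x * F x * (1 - Q) with hD₂
    have hD : F x - (D₁ + D₂) = P x * F x * Q := by
      rw [hD₁, hD₂, Matrix.sub_mul, Matrix.mul_sub, Matrix.one_mul, Matrix.mul_one]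
      abel
    have e1 := trPair_le_of_dominated (isDominated_gram_sub (F x) (D₁ + D₂) ht) (hY x)
    rw [hD, ← h.povm_eq, trPair_add_left, trPair_smul_left, trPair_smul_left] at e1
    refine e1.trans (add_le_add_right (mul_le_mul_of_nonneg_left ?_ (by positivity)) _)
    refine (trPair_mono_left (conj_le_two_smul D₁ D₂) h.state_nonneg).trans ?_
    rw [trPair_add_left, trPair_smul_left, trPair_smul_left]
    refine add_le_add (le_of_eq ?_) (mul_le_mul_of_nonneg_left ?_ (by norm_num))
    · have : D₁ᴴ * D₁ = (F x)ᴴ * ((1 - P x)ᴴ * (1 - P x)) * F x := by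
        simp only [hD₁, Matrix.conjTranspose_mul, Matrix.mul_assoc]
      rw [this, trPair_conj, h.post_eq, hP1, conjTranspose_diagIn, diagIn_mul (h.isometry_post x),
        trPair_diagIn (h.isometry_post x)]
      simp only [hsq]
    · have : D₂ᴴ * D₂ = (1 - Q)ᴴ * ((F x)ᴴ * P x * F x) * (1 - Q) := by
        have hPP : P x * P x = P x := by
          simp only [hP]
          rw [diagIn_mul (h.isometry_post x)]
          simp only [ind_mul_self]
        have hPh : (P x)ᴴ = P x := conjTranspose_diagIn _
        calc D₂ᴴ * D₂ = (1 - Q)ᴴ * ((F x)ᴴ * (P x * P x) * F x) * (1 - Q) := by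
              simp only [hD₂, Matrix.conjTranspose_mul, hPh, Matrix.mul_assoc]
          _ = _ := by rw [hPP]
      rw [this, trPair_conj]
      exact trPair_mono_left (h.conj_diag_le R x) (conj_nonneg' h.state_nonneg _)
  refine (Finset.sum_le_sum fun x _ => key x).trans ?_
  have e2 : ∑ x, trPair (Λ x) ρ = 1 := by
    rw [← trPair_sum_left, h.sum_povm, h.trPair_one]
  have e3 : ∑ x, trPair (Λ x) ((1 - Q) * ρ * (1 - Q)ᴴ) = ∑ i, (1 - ind S i) * q i := by
    rw [← trPair_sum_left, h.sum_povm, hQ1, conjTranspose_diagIn, h.state_eq,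
      diagIn_mul h.isometry, diagIn_mul h.isometry, ← diagIn_one h.isometry,
      trPair_diagIn h.isometry]
    refine Finset.sum_congr rfl fun i _ => ?_
    rw [one_mul, mul_right_comm, hsq]
  rw [Finset.sum_add_distrib, ← Finset.mul_sum, ← Finset.mul_sum, Finset.sum_add_distrib,
    ← Finset.mul_sum, ← Finset.mul_sum, e2, e3, mul_one]
  gcongr

/-- Trimming a POVM gives operators of bounded norm that stay close to it. -/
lemma SpectralData.isTrimmed (h : SpectralData ρ Λ V q F B e) {S : ι → Prop} {R : X → ι → Prop}
    {c s ε₁ ε₂ t : ℝ} (hc : 0 ≤ c) (hs : 0 ≤ s) (hS : ∀ i, S i → 1 ≤ c * q i)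
    (hR : ∀ x i, R x i → 0 < e x i ∧ e x i ≤ (∑ j, e x j) * s)
    (h₁ : ∑ x, ∑ i, (1 - ind (R x) i) * e x i ≤ ε₁)
    (h₂ : ∑ i, (1 - ind S i) * q i ≤ ε₂) (ht : 0 < t) :
    IsTrimmed ρ Λ (fun x => (∑ i, e x i)⁻¹ • trim V F B S R x) (fun x => ∑ i, e x i) (c * s)
        (t + (t⁻¹ + 1) * (2 * ε₁ + 2 * ε₂)) ∧
      ∀ x, (∑ i, e x i)⁻¹ • trim V F B S R x ≤ (c * s) • 1 := by
  have hlam (x : X) : 0 ≤ ∑ i, e x i := Finset.sum_nonneg fun i _ => h.post_nonneg x i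
  have hsum : ∑ x, ∑ i, e x i = 1 := by
    simp only [← h.trPair_povm]
    rw [← trPair_sum_left, h.sum_povm, h.trPair_one]
  have htn (x : X) : 0 ≤ trim V F B S R x := conjTranspose_mul_self_nonneg _
  have hnn (x : X) : 0 ≤ (∑ i, e x i)⁻¹ • trim V F B S R x :=
    smul_nonneg_of_nonneg (inv_nonneg.mpr (hlam x)) (htn x)
  have hle (x : X) : trim V F B S R x ≤ (c * ((∑ i, e x i) * s)) • 1 :=
    h.trim_le hc (mul_nonneg (hlam x) hs) hS fun i hi => (hR x i hi).2
  have hscale (x : X) : (∑ i, e x i) • ((∑ i, e x i)⁻¹ • trim V F B S R x) =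
      trim V F B S R x := by
    -- For an outcome of probability zero the norm bound makes the trimmed operator vanish, so the
    -- value `0⁻¹ = 0` does no harm.
    rcases (hlam x).eq_or_lt with h0 | h0
    · rw [← h0, zero_smul]
      have := hle x
      rw [← h0, zero_mul, mul_zero, zero_smul] at this
      exact le_antisymm (htn x) this
    · rw [smul_smul, mul_inv_cancel₀ h0.ne', one_smul]
  have hbound (x : X) : (∑ i, e x i)⁻¹ • trim V F B S R x ≤ (c * s) • 1 := by
    refine (smul_mono_right (inv_nonneg.mpr (hlam x)) (hle x)).trans ?_
    rw [smul_smul]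
    refine smul_mono_left ?_ (Matrix.PosSemidef.one.nonneg)
    rcases (hlam x).eq_or_lt with h0 | h0
    · rw [← h0]
      simpa using mul_nonneg hc hs
    · exact le_of_eq (by field_simp)
  have htr (x : X) : trPair ((∑ i, e x i)⁻¹ • trim V F B S R x) ρ ≤ 1 := by
    rw [trPair_smul_left]
    refine (mul_le_mul_of_nonneg_left (h.trPair_trim_le S R x)
      (inv_nonneg.mpr (hlam x))).trans ?_
    exact inv_mul_le_one
  refine ⟨⟨h.state_nonneg, h.trPair_one, fun x => ?_, h.sum_povm, hlam, hsum, hnn, ?_, htr, ?_,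
    fun Y hY => ?_⟩, hbound⟩
  · rw [h.povm_eq]
    exact conjTranspose_mul_self_nonneg _
  · simp only [hscale]
    exact h.sum_trim_le S R
  · have hcs : 0 ≤ c * s := mul_nonneg hc hs
    refine (Finset.sum_le_sum (g := fun x => (∑ i, e x i) * (c * s)) fun x _ =>
      mul_le_mul_of_nonneg_left ?_ (hlam x)).trans_eq ?_
    · refine (trPair_mono_left (mul_self_le_smul (hnn x) (hbound x)) h.state_nonneg).trans ?_
      rw [trPair_smul_left]
      exact mul_le_of_le_one_right hcs (htr x)
    · rw [← Finset.sum_mul, hsum, one_mul]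
  · simp only [hscale]
    exact h.trim_close S R h₁ h₂ ht hY

end Trim

/-! ### Typicality -/

section Typicality

variable {X : Type*} [Fintype X] [DecidableEq X]

lemma sum_prod_eq_one {p : X → ℝ} (hp1 : ∑ x, p x = 1) (n : ℕ) :
    ∑ c : Fin n → X, ∏ k, p (c k) = 1 := by
  simpa [expect] using expect_const (I := Fin n) hp1 1

/-- Events of large deviation have small probability. -/
lemma exists_forall_deviation_le {p : X → ℝ} (hp : ∀ x, 0 ≤ p x) (hp1 : ∑ x, p x = 1)
    (h : X → ℝ) {δ η : ℝ} (hδ : 0 < δ) (hη : 0 < η) :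
    ∃ n₀ : ℕ, ∀ n, n₀ ≤ n → ∀ bad : (Fin n → X) → Prop,
      (∀ c, (∀ k, 0 < p (c k)) → bad c →
        n * δ ≤ |∑ k, h (c k) - n * ∑ x, p x * h x|) →
      ∑ c, ind bad c * ∏ k, p (c k) ≤ η := by
  set v := ∑ x, p x * (h x - ∑ y, p y * h y) ^ 2 with hv
  -- Chebyshev's bound `v / (n δ²)` is at most `η` from here on; the `+ 1` keeps `Fin n` inhabited.
  refine ⟨⌈v / (δ ^ 2 * η)⌉₊ + 1, fun n hn bad hbad => ?_⟩
  have hn0 : 0 < n := by omega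
  have : Nonempty (Fin n) := ⟨⟨0, hn0⟩⟩
  have hnr : (0 : ℝ) < n := by exact_mod_cast hn0
  have h1 := expect_deviation_le (I := Fin n) hp hp1 h hδ
  rw [Fintype.card_fin, ← hv] at h1
  have h2 : v / (n * δ ^ 2) ≤ η := by
    rw [div_le_iff₀ (by positivity)]
    have h3 : v / (δ ^ 2 * η) ≤ n := (Nat.le_ceil _).trans (by exact_mod_cast (by omega))
    rw [div_le_iff₀ (by positivity)] at h3
    linarith
  refine le_trans (Finset.sum_le_sum fun c _ => ?_) (h1.trans h2)
  have hprod : 0 ≤ ∏ k, p (c k) := Finset.prod_nonneg fun k _ => hp _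
  rw [mul_comm]
  -- Sequences with a letter of probability zero carry no weight. The event therefore has to be
  -- controlled only where the logarithms of the letter probabilities have their usual meaning.
  by_cases hpos : ∀ k, 0 < p (c k)
  · refine mul_le_mul_of_nonneg_left ?_ hprod
    dsimp only
    rw [ind]
    by_cases hb : bad c
    · rw [if_pos hb, if_pos (hbad c hpos hb)]
    · rw [if_neg hb]
      split_ifs <;> norm_num
  · obtain ⟨k, hk⟩ := not_forall.mp hpos
    have : ∏ k, p (c k) = 0 :=
      Finset.prod_eq_zero (Finset.mem_univ k) (le_antisymm (not_lt.mp hk) (hp _))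
    rw [this, zero_mul, zero_mul]

lemma prod_eq_rpow_sum_logb {n : ℕ} {f : Fin n → ℝ} (hf : ∀ k, 0 < f k) :
    ∏ k, f k = (2 : ℝ) ^ (∑ k, Real.logb 2 (f k)) := by
  rw [Real.rpow_sum_of_pos (by norm_num)]
  exact Finset.prod_congr rfl fun k _ =>
    (Real.rpow_logb (by norm_num) (by norm_num) (hf k)).symm

lemma rpow_two_le {x y : ℝ} : (2 : ℝ) ^ x ≤ 2 ^ y ↔ x ≤ y :=
  Real.rpow_le_rpow_left_iff (by norm_num)

lemma rpow_two_pos (x : ℝ) : (0 : ℝ) < 2 ^ x := Real.rpow_pos_of_pos (by norm_num) x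

/-- The entropy of a distribution, in bits. -/
def shannon (p : X → ℝ) : ℝ := -∑ x, p x * Real.logb 2 (p x)

/-- The sequences that are not too unlikely. -/
def typical (p : X → ℝ) (δ : ℝ) (n : ℕ) (c : Fin n → X) : Prop :=
  1 ≤ (2 : ℝ) ^ (n * (shannon p + δ)) * ∏ k, p (c k)

lemma one_sub_ind {Y : Type*} (S : Y → Prop) (y : Y) : 1 - ind S y = ind (fun y => ¬ S y) y := by
  by_cases h : S y <;> simp [ind, h]

lemma exists_typical {p : X → ℝ} (hp : ∀ x, 0 ≤ p x) (hp1 : ∑ x, p x = 1) {δ η : ℝ}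
    (hδ : 0 < δ) (hη : 0 < η) :
    ∃ n₀ : ℕ, ∀ n, n₀ ≤ n →
      ∑ c : Fin n → X, (1 - ind (typical p δ n) c) * ∏ k, p (c k) ≤ η := by
  obtain ⟨n₀, h⟩ := exists_forall_deviation_le hp hp1 (fun x => Real.logb 2 (p x)) hδ hη
  refine ⟨n₀, fun n hn => ?_⟩
  simp only [one_sub_ind]
  refine h n hn _ fun c hpos hc => ?_
  rw [typical, prod_eq_rpow_sum_logb hpos, ← Real.rpow_add (by norm_num), not_le] at hc
  have h0 : ((2 : ℝ) ^ (0 : ℝ)) = 1 := Real.rpow_zero 2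
  rw [← h0, Real.rpow_lt_rpow_left_iff (by norm_num), shannon] at hc
  have h1 := neg_le_abs (∑ k, Real.logb 2 (p (c k)) - n * ∑ x, p x * Real.logb 2 (p x))
  linarith

-- Each typical sequence has probability at least `2^{-n(H+δ)}`, and the total is one. Only this
-- lower bound on probabilities is used, hence the one-sided notion of typicality.
open Classical in
lemma card_typical_le {p : X → ℝ} (hp : ∀ x, 0 ≤ p x) (hp1 : ∑ x, p x = 1) (δ : ℝ) (n : ℕ) :
    ((Finset.univ.filter (typical p δ n)).card : ℝ) ≤ 2 ^ (n * (shannon p + δ)) := by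
  have h1 : ∑ c ∈ Finset.univ.filter (typical p δ n), (1 : ℝ) ≤
      ∑ c ∈ Finset.univ.filter (typical p δ n),
        (2 : ℝ) ^ (n * (shannon p + δ)) * ∏ k, p (c k) :=
    Finset.sum_le_sum fun c hc => (Finset.mem_filter.mp hc).2
  rw [Finset.sum_const, nsmul_eq_mul, mul_one, ← Finset.mul_sum] at h1
  refine h1.trans (mul_le_of_le_one_right (rpow_two_pos _).le ?_)
  rw [← sum_prod_eq_one hp1 n]
  exact Finset.sum_le_univ_sum_of_nonneg fun c => Finset.prod_nonneg fun k _ => hp _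

open Classical in
lemma sum_compl_typical (p : X → ℝ) (δ : ℝ) (n : ℕ) :
    ∑ c ∈ (Finset.univ.filter (typical p δ n))ᶜ, ∏ k, p (c k) =
      ∑ c : Fin n → X, (1 - ind (typical p δ n) c) * ∏ k, p (c k) := by
  rw [Finset.compl_filter, Finset.sum_filter]
  refine Finset.sum_congr rfl fun c _ => ?_
  by_cases h : typical p δ n c <;> simp [ind, h]

end Typicality

/-! ### Joint typicality of pairs of sequences -/

section JointlyTypical

variable {U V : Type*} [Fintype U] [DecidableEq U] [Fintype V] [DecidableEq V]

/-- The pairs of sequences that are much more likely jointly than independently. -/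
def jointTypical (p : U × V → ℝ) (lamA : U → ℝ) (lamB : V → ℝ) (r : ℝ) (n : ℕ) (x : Fin n → U)
    (w : Fin n → V) : Prop :=
  (2 : ℝ) ^ (n * r) * ((∏ k, lamA (x k)) * ∏ k, lamB (w k)) ≤ ∏ k, p (x k, w k)

/-- The mutual information of a joint distribution with given marginals. -/
def jointInfo (p : U × V → ℝ) (lamA : U → ℝ) (lamB : V → ℝ) : ℝ :=
  ∑ z, p z * Real.logb 2 (p z / (lamA z.1 * lamB z.2))

open Classical in
lemma exists_jointTypical {p : U × V → ℝ} {lamA : U → ℝ} {lamB : V → ℝ} (hp : ∀ z, 0 ≤ p z)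
    (hp1 : ∑ z, p z = 1) (hA : ∀ z, 0 < p z → 0 < lamA z.1) (hB : ∀ z, 0 < p z → 0 < lamB z.2)
    {δ η : ℝ} (hδ : 0 < δ) (hη : 0 < η) :
    ∃ n₀ : ℕ, ∀ n, n₀ ≤ n →
      (∑ x : Fin n → U, ∑ w : Fin n → V,
        if jointTypical p lamA lamB (jointInfo p lamA lamB - δ) n x w then 0
          else ∏ k, p (x k, w k)) ≤ η := by
  obtain ⟨n₀, h⟩ := exists_forall_deviation_le hp hp1
    (fun z => Real.logb 2 (p z / (lamA z.1 * lamB z.2))) hδ hη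
  refine ⟨n₀, fun n hn => ?_⟩
  have h1 := h n hn (fun c => ¬ jointTypical p lamA lamB (jointInfo p lamA lamB - δ) n
    (fun k => (c k).1) (fun k => (c k).2)) fun c hpos hc => ?_
  · refine le_trans (le_of_eq ?_) h1
    rw [← Fintype.sum_prod_type' (f := fun (x : Fin n → U) (w : Fin n → V) =>
      if jointTypical p lamA lamB (jointInfo p lamA lamB - δ) n x w then 0
          else ∏ k, p (x k, w k))]
    refine Fintype.sum_equiv (Equiv.arrowProdEquivProdArrow (Fin n) (fun _ => U)
      (fun _ => V)).symm _ _ fun f => ?_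
    change (if jointTypical p lamA lamB (jointInfo p lamA lamB - δ) n f.1 f.2 then (0 : ℝ) else
      ∏ k, p (f.1 k, f.2 k)) = ind (fun f : (Fin n → U) × (Fin n → V) =>
        ¬ jointTypical p lamA lamB (jointInfo p lamA lamB - δ) n f.1 f.2) f *
          ∏ k, p (f.1 k, f.2 k)
    by_cases hf : jointTypical p lamA lamB (jointInfo p lamA lamB - δ) n f.1 f.2 <;>
      simp [ind, hf]
  · have hpos' (k : Fin n) : 0 < p (c k) / (lamA (c k).1 * lamB (c k).2) :=
      div_pos (hpos k) (mul_pos (hA _ (hpos k)) (hB _ (hpos k)))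
    have hlam : 0 < (∏ k, lamA (c k).1) * ∏ k, lamB (c k).2 :=
      mul_pos (Finset.prod_pos fun k _ => hA _ (hpos k)) (Finset.prod_pos fun k _ => hB _ (hpos k))
    rw [jointTypical, not_le, ← div_lt_iff₀ hlam, ← Finset.prod_mul_distrib,
      ← Finset.prod_div_distrib, prod_eq_rpow_sum_logb hpos',
      Real.rpow_lt_rpow_left_iff (by norm_num)] at hc
    have h2 := neg_le_abs (∑ k, Real.logb 2 (p (c k) / (lamA (c k).1 * lamB (c k).2)) -
      n * ∑ z, p z * Real.logb 2 (p z / (lamA z.1 * lamB z.2)))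
    rw [jointInfo] at hc
    linarith

-- Change of measure: on the tested set the product weight is at most `2^{-nr}` times the joint
-- weight, whose total is one.
open Classical in
lemma sum_jointTypical_le {p : U × V → ℝ} {lamA : U → ℝ} {lamB : V → ℝ} (hp : ∀ z, 0 ≤ p z)
    (hp1 : ∑ z, p z = 1) (r : ℝ) (n : ℕ) :
    ∑ x : Fin n → U, ∑ w : Fin n → V, (∏ k, lamA (x k)) * (∏ k, lamB (w k)) *
      (if jointTypical p lamA lamB r n x w then 1 else 0) ≤ 2 ^ (-(n * r)) := by
  have h1 (x : Fin n → U) (w : Fin n → V) : (∏ k, lamA (x k)) * (∏ k, lamB (w k)) *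
      (if jointTypical p lamA lamB r n x w then 1 else 0) ≤
      2 ^ (-(n * r)) * ∏ k, p (x k, w k) := by
    have hpn : 0 ≤ ∏ k, p (x k, w k) := Finset.prod_nonneg fun k _ => hp _
    split_ifs with h
    · rw [mul_one, Real.rpow_neg (by norm_num), ← div_eq_inv_mul, le_div_iff₀' (rpow_two_pos _)]
      exact h
    · rw [mul_zero]
      exact mul_nonneg (rpow_two_pos _).le hpn
  refine (Finset.sum_le_sum fun x _ => Finset.sum_le_sum fun w _ => h1 x w).trans_eq ?_
  simp only [← Finset.mul_sum]
  rw [← Fintype.sum_prod_type' (f := fun (x : Fin n → U) (w : Fin n → V) => ∏ k, p (x k, w k))]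
  have h2 : ∑ x : (Fin n → U) × (Fin n → V), ∏ k, p (x.1 k, x.2 k) = 1 :=
    (Fintype.sum_equiv (Equiv.arrowProdEquivProdArrow (Fin n) (fun _ => U) (fun _ => V)).symm _
      (fun f => ∏ k, p (f k)) (fun f => rfl)).trans (sum_prod_eq_one hp1 n)
  rw [h2, mul_one]

end JointlyTypical

/-! ### Typical spectra of tensor powers -/

section SideTypicality

variable {ι X : Type*} [Fintype ι] [DecidableEq ι] [Fintype X] [DecidableEq X]
  {ρ : Matrix ι ι ℂ} {Λ : X → Matrix ι ι ℂ} {V : Matrix ι ι ℂ} {q : ι → ℝ}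
  {F B : X → Matrix ι ι ℂ} {e : X → ι → ℝ}

/-- The roots and eigenbases for `n` letters are chosen as tensor products, so all spectra are
product weights and typicality becomes a classical question. -/
lemma SpectralData.pow (h : SpectralData ρ Λ V q F B e) (n : ℕ) :
    SpectralData (piTensor fun _ : Fin n => ρ) (fun x : Fin n → X => piTensor fun k => Λ (x k))
      (piTensor fun _ : Fin n => V) (fun p => ∏ k, q (p k)) (fun x => piTensor fun k => F (x k))
      (fun x => piTensor fun k => B (x k)) (fun x p => ∏ k, e (x k) (p k)) where
  isometry := piTensor_isometry fun _ => h.isometry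
  state_eq := by
    rw [← piTensor_diagIn, h.state_eq]
  eig_nonneg p := Finset.prod_nonneg fun k _ => h.eig_nonneg _
  sum_eig := sum_prod_eq_one h.sum_eig n
  povm_eq x := by
    rw [conjTranspose_piTensor, piTensor_mul]
    simp only [h.povm_eq]
  sum_povm := by
    rw [sum_piTensor, h.sum_povm, piTensor_one]
  isometry_post x := piTensor_isometry fun k => h.isometry_post _
  post_eq x := by
    rw [conjTranspose_piTensor, piTensor_mul, piTensor_mul, ← piTensor_diagIn]
    simp only [h.post_eq]
  post_nonneg x p := Finset.prod_nonneg fun k _ => h.post_nonneg _ _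

lemma sum_prod_post (e : X → ι → ℝ) {n : ℕ} (x : Fin n → X) :
    ∑ p : Fin n → ι, ∏ k, e (x k) (p k) = ∏ k, ∑ i, e (x k) i := by
  rw [Finset.prod_univ_sum, Fintype.piFinset_univ]

/-- The information that the outcome of a POVM carries about the rest of a pure state. -/
def postInfo (q : ι → ℝ) (e : X → ι → ℝ) : ℝ :=
  shannon q + shannon (fun x => ∑ i, e x i) - shannon (fun z : X × ι => e z.1 z.2)

lemma SpectralData.sum_post (h : SpectralData ρ Λ V q F B e) : ∑ x, ∑ i, e x i = 1 := by
  simp only [← h.trPair_povm]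
  rw [← trPair_sum_left, h.sum_povm, h.trPair_one]

/-- This is minus the conditional entropy of the eigenvalue given the outcome, and the mean that
decides how large a typical eigenvalue of a normalized post-measurement state is. -/
lemma SpectralData.sum_mul_logb (h : SpectralData ρ Λ V q F B e) :
    ∑ z : X × ι, e z.1 z.2 * Real.logb 2 (e z.1 z.2 / ∑ i, e z.1 i) =
      shannon (fun x => ∑ i, e x i) - shannon (fun z : X × ι => e z.1 z.2) := by
  have h1 (z : X × ι) : e z.1 z.2 * Real.logb 2 (e z.1 z.2 / ∑ i, e z.1 i) =
      e z.1 z.2 * Real.logb 2 (e z.1 z.2) - e z.1 z.2 * Real.logb 2 (∑ i, e z.1 i) := by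
    rcases (h.post_nonneg z.1 z.2).eq_or_lt with h0 | h0
    · rw [← h0]
      simp
    · have hpos : 0 < ∑ i, e z.1 i := h0.trans_le
        (Finset.single_le_sum (fun i _ => h.post_nonneg z.1 i) (Finset.mem_univ z.2))
      rw [Real.logb_div h0.ne' hpos.ne']
      ring
  simp only [h1, Finset.sum_sub_distrib, shannon]
  have h2 : ∑ z : X × ι, e z.1 z.2 * Real.logb 2 (∑ i, e z.1 i) =
      ∑ x, (∑ i, e x i) * Real.logb 2 (∑ i, e x i) := by
    rw [Fintype.sum_prod_type]
    simp only [Finset.sum_mul]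
  rw [h2]
  ring

/-- The trimmed tensor powers of a POVM. -/
lemma SpectralData.exists_isTrimmed (h : SpectralData ρ Λ V q F B e) {δ η : ℝ} (hδ : 0 < δ)
    (hη : 0 < η) :
    ∃ n₀ : ℕ, ∀ n, n₀ ≤ n → ∃ E : (Fin n → X) → Matrix (Fin n → ι) (Fin n → ι) ℂ,
      IsTrimmed (piTensor fun _ : Fin n => ρ) (fun x : Fin n → X => piTensor fun k => Λ (x k)) E
        (fun x => ∏ k, ∑ i, e (x k) i) (2 ^ (n * (postInfo q e + 2 * δ))) η ∧
      ∀ x, E x ≤ ((2 : ℝ) ^ (n * (postInfo q e + 2 * δ))) • 1 := by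
  -- The values of `t` and `ε` are chosen so that the closeness bound `t + (t⁻¹ + 1)(2ε + 2ε)`
  -- equals `2t = η`.
  set t := η / 2 with ht
  have htpos : 0 < t := by positivity
  set ε := t / (4 * (t⁻¹ + 1)) with hε
  have hεpos : 0 < ε := by positivity
  have hp1 : ∑ z : X × ι, e z.1 z.2 = 1 := by
    rw [Fintype.sum_prod_type]
    exact h.sum_post
  obtain ⟨n₁, h₁⟩ := exists_typical h.eig_nonneg h.sum_eig hδ hεpos
  obtain ⟨n₂, h₂⟩ := exists_forall_deviation_le (p := fun z : X × ι => e z.1 z.2)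
    (fun z => h.post_nonneg z.1 z.2) hp1
    (fun z => Real.logb 2 (e z.1 z.2 / ∑ i, e z.1 i)) hδ hεpos
  refine ⟨max n₁ n₂, fun n hn => ?_⟩
  set m := shannon (fun x => ∑ i, e x i) - shannon (fun z : X × ι => e z.1 z.2) with hm
  set R : (Fin n → X) → (Fin n → ι) → Prop := fun x p => 0 < ∏ k, e (x k) (p k) ∧
    ∏ k, e (x k) (p k) ≤ (∑ p' : Fin n → ι, ∏ k, e (x k) (p' k)) * 2 ^ (n * (m + δ)) with hR
  have hε₁ : ∑ x : Fin n → X, ∑ p : Fin n → ι, (1 - ind (R x) p) * ∏ k, e (x k) (p k) ≤ ε := by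
    have h3 := h₂ n (le_trans (le_max_right _ _) hn)
      (fun c => ¬ R (fun k => (c k).1) (fun k => (c k).2)) fun c hpos hc => ?_
    · refine le_trans (le_of_eq ?_) h3
      rw [← Fintype.sum_prod_type' (f := fun (x : Fin n → X) (p : Fin n → ι) =>
        (1 - ind (R x) p) * ∏ k, e (x k) (p k))]
      refine Fintype.sum_equiv (Equiv.arrowProdEquivProdArrow (Fin n) (fun _ => X)
        (fun _ => ι)).symm _ _ fun f => ?_
      rw [one_sub_ind]
      rfl
    · have hlpos (k : Fin n) : 0 < ∑ i, e (c k).1 i := (hpos k).trans_le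
        (Finset.single_le_sum (fun i _ => h.post_nonneg (c k).1 i) (Finset.mem_univ (c k).2))
      have hprod : 0 < ∏ k, e (c k).1 (c k).2 := Finset.prod_pos fun k _ => hpos k
      have hlt : (∑ p' : Fin n → ι, ∏ k, e (c k).1 (p' k)) * 2 ^ (n * (m + δ)) <
          ∏ k, e (c k).1 (c k).2 := by
        by_contra! hle
        exact hc ⟨hprod, hle⟩
      rw [sum_prod_post e (fun k => (c k).1), mul_comm,
        ← lt_div_iff₀ (Finset.prod_pos fun k _ => hlpos k), ← Finset.prod_div_distrib,
        prod_eq_rpow_sum_logb (fun k => div_pos (hpos k) (hlpos k)),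
        Real.rpow_lt_rpow_left_iff (by norm_num)] at hlt
      have h4 := le_abs_self (∑ k, Real.logb 2 (e (c k).1 (c k).2 / ∑ i, e (c k).1 i) -
        n * ∑ z : X × ι, e z.1 z.2 * Real.logb 2 (e z.1 z.2 / ∑ i, e z.1 i))
      have h5 := h.sum_mul_logb
      rw [← hm] at h5
      rw [h5] at h4 ⊢
      linarith
  -- The two exponents add up to `postInfo q e + 2δ`: the inverse size of a typical eigenvalue of
  -- the state, times the size of a typical eigenvalue of a normalized post-measurement state.
  have hmain := (h.pow n).isTrimmed (S := typical q δ n) (R := R)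
    (c := 2 ^ (n * (shannon q + δ))) (s := 2 ^ (n * (m + δ))) (rpow_two_pos _).le
    (rpow_two_pos _).le (fun p hp => hp) (fun x p hp => hp) hε₁
    (h₁ n (le_trans (le_max_left _ _) hn)) htpos
  have hexp : (2 : ℝ) ^ (n * (shannon q + δ)) * 2 ^ (n * (m + δ)) =
      2 ^ (n * (postInfo q e + 2 * δ)) := by
    rw [← Real.rpow_add (by norm_num), postInfo]
    congr 1
    rw [hm]
    ring
  have hδ' : t + (t⁻¹ + 1) * (2 * ε + 2 * ε) = η := by
    have : 0 < t⁻¹ + 1 := by positivity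
    rw [hε]
    field_simp
    rw [ht]
    ring
  rw [hexp, hδ'] at hmain
  refine ⟨_, ?_, hmain.2⟩
  have h6 := hmain.1
  simp only [sum_prod_post] at h6 ⊢
  exact h6

end SideTypicality

/-! ### Entropy inequalities -/

section Gibbs

variable {X U V : Type*} [Fintype X] [Fintype U] [DecidableEq U] [Fintype V] [DecidableEq V]

/-- Gibbs' inequality. -/
lemma sum_mul_logb_div_nonneg {p r : X → ℝ} (hp : ∀ x, 0 ≤ p x) (hr : ∀ x, 0 ≤ r x)
    (hpr : ∀ x, 0 < p x → 0 < r x) (hsum : ∑ x, r x ≤ ∑ x, p x) :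
    0 ≤ ∑ x, p x * Real.logb 2 (p x / r x) := by
  have hlog : 0 < Real.log 2 := Real.log_pos (by norm_num)
  have h1 (x : X) : (p x - r x) / Real.log 2 ≤ p x * Real.logb 2 (p x / r x) := by
    rw [Real.logb, ← mul_div_assoc]
    refine div_le_div_of_nonneg_right ?_ hlog.le
    rcases (hp x).eq_or_lt with h0 | h0
    · rw [← h0]
      simpa using hr x
    · have hrx := hpr x h0
      have h2 := Real.log_le_sub_one_of_pos (div_pos hrx h0)
      have h3 : Real.log (p x / r x) = -Real.log (r x / p x) := by
        rw [← Real.log_inv, inv_div]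
      rw [h3]
      have h4 := mul_le_mul_of_nonneg_left h2 h0.le
      have h5 : p x * (r x / p x - 1) = r x - p x := by field_simp
      linarith
  refine le_trans ?_ (Finset.sum_le_sum fun x _ => h1 x)
  rw [← Finset.sum_div, Finset.sum_sub_distrib]
  exact div_nonneg (by linarith) hlog.le

variable {p : U × V → ℝ} {lamA : U → ℝ} {lamB : V → ℝ}

lemma jointInfo_nonneg (hp : ∀ z, 0 ≤ p z) (hp1 : ∑ z, p z = 1) (hA : ∀ u, 0 ≤ lamA u)
    (hB : ∀ v, 0 ≤ lamB v) (hA1 : ∑ u, lamA u = 1) (hB1 : ∑ v, lamB v = 1)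
    (hpA : ∀ z, 0 < p z → 0 < lamA z.1) (hpB : ∀ z, 0 < p z → 0 < lamB z.2) :
    0 ≤ jointInfo p lamA lamB := by
  refine sum_mul_logb_div_nonneg hp (fun z => mul_nonneg (hA _) (hB _))
    (fun z hz => mul_pos (hpA z hz) (hpB z hz)) ?_
  rw [hp1, Fintype.sum_prod_type]
  simp only [← Finset.mul_sum, hB1, mul_one, hA1, le_refl]

lemma jointInfo_eq (hp : ∀ z, 0 ≤ p z) (hA : ∀ u, ∑ v, p (u, v) = lamA u)
    (hB : ∀ v, ∑ u, p (u, v) = lamB v) (hpA : ∀ z, 0 < p z → 0 < lamA z.1)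
    (hpB : ∀ z, 0 < p z → 0 < lamB z.2) :
    jointInfo p lamA lamB = shannon lamA + shannon lamB - shannon p := by
  have h1 (z : U × V) : p z * Real.logb 2 (p z / (lamA z.1 * lamB z.2)) =
      p z * Real.logb 2 (p z) - p z * Real.logb 2 (lamA z.1) - p z * Real.logb 2 (lamB z.2) := by
    rcases (hp z).eq_or_lt with h0 | h0
    · rw [← h0]
      simp
    · rw [Real.logb_div h0.ne' (mul_pos (hpA z h0) (hpB z h0)).ne',
        Real.logb_mul (hpA z h0).ne' (hpB z h0).ne']
      ring
  have h2 : ∑ z, p z * Real.logb 2 (lamA z.1) = ∑ u, lamA u * Real.logb 2 (lamA u) := by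
    rw [Fintype.sum_prod_type]
    simp only [← Finset.sum_mul, hA]
  have h3 : ∑ z, p z * Real.logb 2 (lamB z.2) = ∑ v, lamB v * Real.logb 2 (lamB v) := by
    rw [Fintype.sum_prod_type_right]
    simp only [← Finset.sum_mul, hB]
  simp only [jointInfo, h1, Finset.sum_sub_distrib, h2, h3, shannon]
  ring

lemma jointInfo_swap : jointInfo (fun z : V × U => p (z.2, z.1)) lamB lamA =
    jointInfo p lamA lamB := by
  rw [jointInfo, jointInfo]
  refine Fintype.sum_equiv (Equiv.prodComm V U) _ _ fun z => ?_
  simp only [Equiv.prodComm_apply, Prod.fst_swap, Prod.snd_swap, mul_comm (lamB z.1)]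
  rfl

end Gibbs

section PostEntropy

variable {ι X : Type*} [Fintype ι] [DecidableEq ι] [Fintype X] [DecidableEq X]
  {ρ : Matrix ι ι ℂ} {Λ : X → Matrix ι ι ℂ} {V : Matrix ι ι ℂ} {q : ι → ℝ}
  {F B : X → Matrix ι ι ℂ} {e : X → ι → ℝ}

/-- Diagonal entries in another basis are mixtures of the eigenvalues, with squared moduli as
transition weights. -/
lemma diagIn_conj_apply (C W : Matrix ι ι ℂ) (d : ι → ℝ) (i : ι) :
    (C * diagIn W d * Cᴴ) i i = ((∑ j, d j * Complex.normSq ((C * W) i j) : ℝ) : ℂ) := by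
  have h1 : C * diagIn W d * Cᴴ =
      (C * W) * Matrix.diagonal (fun j => (d j : ℂ)) * (C * W)ᴴ := by
    simp only [diagIn, Matrix.conjTranspose_mul, Matrix.mul_assoc]
  rw [h1, Matrix.mul_apply, Complex.ofReal_sum]
  refine Finset.sum_congr rfl fun j _ => ?_
  rw [Matrix.mul_diagonal, Matrix.conjTranspose_apply, Complex.ofReal_mul,
    Complex.normSq_eq_conj_mul_self]
  simp only [Complex.star_def]
  ring

lemma apply_le_one_of_le_one {A : Matrix ι ι ℂ} (h : A ≤ 1) (i : ι) : (A i i).re ≤ 1 := by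
  have := (posSemidef_of_nonneg (sub_nonneg.mpr h)).diag_nonneg (i := i)
  have h2 := (Complex.le_def.mp this).1
  simp only [Matrix.sub_apply, Matrix.one_apply_eq, Complex.zero_re, Complex.sub_re,
    Complex.one_re] at h2
  linarith

/-- A measurement cannot decrease the entropy of the state together with the outcome. -/
lemma SpectralData.shannon_le (h : SpectralData ρ Λ V q F B e) :
    shannon q ≤ shannon (fun z : X × ι => e z.1 z.2) := by
  -- The transition weights from eigenvalues of the state to eigenvalues of the post-measurement
  -- states. Rows sum to at most one since `F Fᴴ ≤ 1`, columns to one by completeness of the POVM;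
  -- such a kernel cannot decrease entropy.
  set m : X × ι → ι → ℝ := fun z j => Complex.normSq (((B z.1)ᴴ * F z.1 * V) z.2 j) with hm
  have hm0 (z : X × ι) (j : ι) : 0 ≤ m z j := Complex.normSq_nonneg _
  have hΛ0 (x : X) : 0 ≤ Λ x := by
    rw [h.povm_eq]
    exact conjTranspose_mul_self_nonneg _
  have he (z : X × ι) : e z.1 z.2 = ∑ j, q j * m z j := by
    have h1 := diagIn_conj_apply ((B z.1)ᴴ * F z.1) V q z.2
    have h2 : (B z.1)ᴴ * F z.1 * diagIn V q * ((B z.1)ᴴ * F z.1)ᴴ =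
        (B z.1)ᴴ * diagIn (B z.1) (e z.1) * ((B z.1)ᴴ)ᴴ := by
      rw [← h.post_eq, ← h.state_eq]
      simp only [Matrix.conjTranspose_mul, Matrix.mul_assoc]
    rw [h2, diagIn_conj_apply, h.isometry_post] at h1
    have h3 := Complex.ofReal_injective h1
    rw [← h3, Finset.sum_eq_single z.2 (fun j _ hj => by simp [Matrix.one_apply_ne hj.symm])
      (by simp)]
    simp
  have hrow (z : X × ι) : ∑ j, m z j ≤ 1 := by
    have h1 := diagIn_conj_apply ((B z.1)ᴴ * F z.1) V (fun _ => 1) z.2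
    rw [diagIn_one h.isometry, Matrix.mul_one] at h1
    simp only [one_mul] at h1
    have h2 : (B z.1)ᴴ * F z.1 * ((B z.1)ᴴ * F z.1)ᴴ ≤ 1 := by
      have h3 : (F z.1)ᴴ * F z.1 ≤ (1 : ℝ) • 1 := by
        rw [← h.povm_eq, one_smul, ← h.sum_povm]
        exact Finset.single_le_sum (fun x _ => hΛ0 x) (Finset.mem_univ z.1)
      have h4 : F z.1 * (F z.1)ᴴ ≤ (1 : ℝ) • 1 := by
        have := gram_le_of_gram_conjTranspose_le (G := (F z.1)ᴴ) zero_le_one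
          (by rwa [Matrix.conjTranspose_conjTranspose])
        rwa [Matrix.conjTranspose_conjTranspose] at this
      rw [one_smul] at h4
      have h5 := conj_mono h4 (B z.1)
      rw [Matrix.mul_one, h.isometry_post] at h5
      simpa only [Matrix.conjTranspose_mul, Matrix.conjTranspose_conjTranspose,
        Matrix.mul_assoc] using h5
    have h6 := apply_le_one_of_le_one h2 z.2
    rw [h1, Complex.ofReal_re] at h6
    exact h6
  have hcol (j : ι) : ∑ z, m z j = 1 := by
    have h1 (x : X) : ((Vᴴ * Λ x * V) j j).re = ∑ i, m (x, i) j := by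
      have h2 : Vᴴ * Λ x * V = (Vᴴ * (F x)ᴴ) * diagIn (B x) (fun _ => 1) *
          (Vᴴ * (F x)ᴴ)ᴴ := by
        rw [diagIn_one (h.isometry_post x), h.povm_eq]
        simp only [Matrix.conjTranspose_mul, Matrix.conjTranspose_conjTranspose, Matrix.mul_one,
          Matrix.mul_assoc]
      rw [h2, diagIn_conj_apply, Complex.ofReal_re]
      refine Finset.sum_congr rfl fun i _ => ?_
      have h3 : Vᴴ * (F x)ᴴ * B x = ((B x)ᴴ * F x * V)ᴴ := by
        simp only [Matrix.conjTranspose_mul, Matrix.conjTranspose_conjTranspose, Matrix.mul_assoc]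
      rw [h3, Matrix.conjTranspose_apply, one_mul]
      exact Complex.normSq_conj _
    rw [Fintype.sum_prod_type]
    simp only [← h1]
    rw [← Complex.re_sum, ← Matrix.sum_apply, ← Finset.sum_mul, ← Finset.mul_sum, h.sum_povm,
      Matrix.mul_one, h.isometry]
    simp
  -- In Gibbs' inequality for `q m` against `e m` the factor `m` cancels inside the logarithm, and
  -- the column and row sums leave the two entropies. Sub-stochastic rows are enough because the
  -- inequality only needs the second total not to exceed the first.
  have hgibbs := sum_mul_logb_div_nonneg (X := (X × ι) × ι) (p := fun y => q y.2 * m y.1 y.2)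
    (r := fun y => e y.1.1 y.1.2 * m y.1 y.2)
    (fun y => mul_nonneg (h.eig_nonneg _) (hm0 _ _))
    (fun y => mul_nonneg (h.post_nonneg _ _) (hm0 _ _)) (fun y hy => ?_) ?_
  · have h1 (y : (X × ι) × ι) : q y.2 * m y.1 y.2 * Real.logb 2 (q y.2 * m y.1 y.2 /
        (e y.1.1 y.1.2 * m y.1 y.2)) = q y.2 * m y.1 y.2 * Real.logb 2 (q y.2) -
        q y.2 * m y.1 y.2 * Real.logb 2 (e y.1.1 y.1.2) := by
      rcases (mul_nonneg (h.eig_nonneg y.2) (hm0 y.1 y.2)).eq_or_lt with h0 | h0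
      · rw [← h0]
        simp
      · have hq : q y.2 ≠ 0 := left_ne_zero_of_mul h0.ne'
        have hmz : m y.1 y.2 ≠ 0 := right_ne_zero_of_mul h0.ne'
        have hez : e y.1.1 y.1.2 ≠ 0 := by
          rw [he]
          exact (h0.trans_le (Finset.single_le_sum (f := fun j => q j * m y.1 j)
            (fun j _ => mul_nonneg (h.eig_nonneg j) (hm0 _ _)) (Finset.mem_univ y.2))).ne'
        rw [mul_div_mul_right _ _ hmz, Real.logb_div hq hez]
        ring
    simp only [h1, Finset.sum_sub_distrib] at hgibbs
    have h2 : ∑ y : (X × ι) × ι, q y.2 * m y.1 y.2 * Real.logb 2 (q y.2) =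
        ∑ j, q j * Real.logb 2 (q j) := by
      rw [Fintype.sum_prod_type_right]
      refine Finset.sum_congr rfl fun j _ => ?_
      dsimp only
      rw [← Finset.sum_mul, ← Finset.mul_sum, hcol, mul_one]
    have h3 : ∑ y : (X × ι) × ι, q y.2 * m y.1 y.2 * Real.logb 2 (e y.1.1 y.1.2) =
        ∑ z : X × ι, e z.1 z.2 * Real.logb 2 (e z.1 z.2) := by
      rw [Fintype.sum_prod_type]
      refine Finset.sum_congr rfl fun z _ => ?_
      dsimp only
      rw [← Finset.sum_mul, ← he]
    rw [h2, h3] at hgibbs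
    simp only [shannon]
    linarith
  · have hmz : 0 < m y.1 y.2 := lt_of_le_of_ne (hm0 _ _) (right_ne_zero_of_mul hy.ne').symm
    refine mul_pos ?_ hmz
    rw [he]
    exact hy.trans_le (Finset.single_le_sum (f := fun j => q j * m y.1 j)
      (fun j _ => mul_nonneg (h.eig_nonneg j) (hm0 _ _)) (Finset.mem_univ y.2))
  · have h1 : ∑ y : (X × ι) × ι, q y.2 * m y.1 y.2 = 1 := by
      rw [Fintype.sum_prod_type_right]
      simp only [← Finset.mul_sum, hcol, mul_one, h.sum_eig]
    have h2 : ∑ z : X × ι, e z.1 z.2 = 1 := by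
      rw [Fintype.sum_prod_type]
      exact h.sum_post
    rw [h1, ← h2, Fintype.sum_prod_type]
    simp only [← Finset.mul_sum]
    exact Finset.sum_le_sum fun z _ => mul_le_of_le_one_right (h.post_nonneg _ _) (hrow z)

lemma SpectralData.postInfo_le (h : SpectralData ρ Λ V q F B e) :
    postInfo q e ≤ shannon (fun x => ∑ i, e x i) := by
  have := h.shannon_le
  rw [postInfo]
  linarith

end PostEntropy

/-! ### Holevo's bound from trimmed operators and joint typicality -/

section Holevo

variable {ι X W : Type*} [Fintype ι] [DecidableEq ι] [Fintype X] [DecidableEq X] [Fintype W]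
  [DecidableEq W] {ρ : Matrix ι ι ℂ} {Λ : X → Matrix ι ι ℂ} {V : Matrix ι ι ℂ} {q : ι → ℝ}
  {F B : X → Matrix ι ι ℂ} {e : X → ι → ℝ}

/-- Real parts are not multiplicative, so factorizing the pairing over tensor products needs the
traces themselves to be real; positivity supplies this. -/
lemma trace_mul_eq_trPair {A C : Matrix ι ι ℂ} (hA : 0 ≤ A) (hC : 0 ≤ C) :
    (A * C).trace = (trPair A C : ℂ) := by
  obtain ⟨G, rfl⟩ := exists_conjTranspose_mul_self hA
  have h1 : (Gᴴ * G * C).trace = (G * C * Gᴴ).trace := by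
    rw [Matrix.mul_assoc, Matrix.trace_mul_comm]
  have h2 := (Complex.le_def.mp (posSemidef_of_nonneg (conj_nonneg' hC G)).trace_nonneg).2
  rw [← h1] at h2
  exact Complex.ext (by simp [trPair]) (by simpa using h2.symm)

lemma trPair_piTensor {n : ℕ} {A C : Fin n → Matrix ι ι ℂ} (hA : ∀ k, 0 ≤ A k)
    (hC : ∀ k, 0 ≤ C k) :
    trPair (piTensor A) (piTensor C) = ∏ k, trPair (A k) (C k) := by
  rw [trPair, piTensor_mul, trace_piTensor]
  simp only [trace_mul_eq_trPair (hA _) (hC _)]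
  rw [← Complex.ofReal_prod, Complex.ofReal_re]

/-- Holevo's bound: decomposing the state `ρ` into `N` gives no more information about the outcome
of `Λ` than the rest of a purification has. -/
lemma SpectralData.jointInfo_le_postInfo (h : SpectralData ρ Λ V q F B e)
    {N : W → Matrix ι ι ℂ} (hN : ∀ w, 0 ≤ N w) (hN1 : ∑ w, N w = ρ) :
    jointInfo (fun z : X × W => trPair (Λ z.1) (N z.2)) (fun x => ∑ i, e x i)
      (fun w => trPair 1 (N w)) ≤ postInfo q e := by
  classical
  set p : X × W → ℝ := fun z => trPair (Λ z.1) (N z.2) with hp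
  set lamA : X → ℝ := fun x => ∑ i, e x i with hlamA
  set lamB : W → ℝ := fun w => trPair 1 (N w) with hlamB
  have hΛ0 (x : X) : 0 ≤ Λ x := by
    rw [h.povm_eq]
    exact conjTranspose_mul_self_nonneg _
  have hp0 (z : X × W) : 0 ≤ p z := trPair_nonneg (hΛ0 _) (hN _)
  have hpA (x : X) : ∑ w, p (x, w) = lamA x := by
    simp only [hp]
    rw [← trPair_sum_right, hN1, h.trPair_povm]
  have hpB (w : W) : ∑ x, p (x, w) = lamB w := by
    simp only [hp]
    rw [← trPair_sum_left, h.sum_povm]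
  have hp1 : ∑ z, p z = 1 := by
    rw [Fintype.sum_prod_type]
    simp only [hpA]
    exact h.sum_post
  have hposA (z : X × W) (hz : 0 < p z) : 0 < lamA z.1 := by
    rw [← hpA]
    exact hz.trans_le (Finset.single_le_sum (f := fun w => p (z.1, w)) (fun w _ => hp0 _)
      (Finset.mem_univ z.2))
  have hposB (z : X × W) (hz : 0 < p z) : 0 < lamB z.2 := by
    rw [← hpB]
    exact hz.trans_le (Finset.single_le_sum (f := fun x => p (x, z.2)) (fun x _ => hp0 _)
      (Finset.mem_univ z.1))
  refine le_of_forall_pos_le_add fun ε hε => ?_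
  -- Trimming costs `2δ`, joint typicality costs `δ`, and the last `δ` absorbs the constant factor
  -- `2` once `n δ ≥ 1`.
  set δ := ε / 4 with hδ
  have hδ0 : 0 < δ := by positivity
  obtain ⟨n₁, h₁⟩ := h.exists_isTrimmed hδ0 (η := 1 / 4) (by norm_num)
  obtain ⟨n₂, h₂⟩ := exists_jointTypical hp0 hp1 hposA hposB hδ0 (η := 1 / 4) (by norm_num)
  set n := max (max n₁ n₂) (⌈δ⁻¹⌉₊ + 1) with hn
  obtain ⟨E, hE, hEle⟩ := h₁ n (by omega)
  have h3 := h₂ n (by omega)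
  have h4 := sum_jointTypical_le (lamA := lamA) (lamB := lamB) hp0 hp1
    (jointInfo p lamA lamB - δ) n
  set S := jointTypical p lamA lamB (jointInfo p lamA lamB - δ) n with hS
  set K : ℝ := 2 ^ (n * (postInfo q e + 2 * δ)) with hK
  set N' : (Fin n → W) → Matrix (Fin n → ι) (Fin n → ι) ℂ := fun w => piTensor fun k => N (w k)
    with hN'
  have hN'0 (w : Fin n → W) : 0 ≤ N' w := piTensor_nonneg fun k => hN _
  have hpn (x : Fin n → X) (w : Fin n → W) :
      trPair (piTensor fun k => Λ (x k)) (N' w) = ∏ k, p (x k, w k) :=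
    trPair_piTensor (fun k => hΛ0 _) (fun k => hN _)
  have hlam (w : Fin n → W) : trPair 1 (N' w) = ∏ k, lamB (w k) := by
    rw [← piTensor_one]
    exact trPair_piTensor (fun k => Matrix.PosSemidef.one.nonneg) (fun k => hN _)
  -- The test operator for `x` collects the parts `N' w` of the state that are jointly typical with
  -- `x`; since all parts sum to the state, it is dominated.
  have hclose := hE.close (fun x => ∑ w, if S x w then N' w else 0) (fun x => by
    have h0 : 0 ≤ ∑ w, if S x w then N' w else 0 :=
      Finset.sum_nonneg fun w _ => by split_ifs; exacts [hN'0 w, le_rfl]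
    refine ⟨(neg_nonpos.mpr hE.state_nonneg).trans h0, ?_⟩
    have h1 : (piTensor fun _ : Fin n => ρ) = ∑ w, N' w := by
      rw [hN', sum_piTensor, hN1]
    rw [h1]
    exact Finset.sum_le_sum fun w _ => by split_ifs; exacts [le_rfl, hN'0 w])
  simp only [trPair_sub_left, Finset.sum_sub_distrib, trPair_sum_right] at hclose
  have h5 : ∑ x : Fin n → X, ∑ w : Fin n → W,
      trPair (piTensor fun k => Λ (x k)) (if S x w then N' w else 0) =
      1 - ∑ x : Fin n → X, ∑ w : Fin n → W, (if S x w then 0 else ∏ k, p (x k, w k)) := by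
    have e1 : ∑ x : Fin n → X, ∑ w : Fin n → W, ∏ k, p (x k, w k) = 1 := by
      simp only [← hpn]
      have e2 : ∑ w, N' w = piTensor fun _ : Fin n => ρ := by
        rw [hN', sum_piTensor, hN1]
      simp only [← trPair_sum_right, e2]
      rw [← trPair_sum_left, hE.sum_povm, hE.trace_state]
    rw [← e1, ← Finset.sum_sub_distrib]
    simp only [← Finset.sum_sub_distrib]
    refine Finset.sum_congr rfl fun x _ => Finset.sum_congr rfl fun w _ => ?_
    split_ifs
    · rw [hpn, sub_zero]
    · rw [trPair_zero_right, sub_self]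
  have h6 : ∑ x : Fin n → X, ∑ w : Fin n → W,
      trPair ((∏ k, lamA (x k)) • E x) (if S x w then N' w else 0) ≤
      K * ∑ x : Fin n → X, ∑ w : Fin n → W, (∏ k, lamA (x k)) * (∏ k, lamB (w k)) *
        (if S x w then 1 else 0) := by
    simp only [Finset.mul_sum]
    refine Finset.sum_le_sum fun x _ => Finset.sum_le_sum fun w _ => ?_
    rw [trPair_smul_left]
    split_ifs
    · have e1 := trPair_mono_left (hEle x) (hN'0 w)
      rw [trPair_smul_left, hlam] at e1
      have e2 := mul_le_mul_of_nonneg_left e1 (hE.lam_nonneg x)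
      linarith
    · simp
  rw [h5] at hclose
  -- The jointly typical pairs carry weight at least `3/4`, hence at least `1/2` after trimming. On
  -- the other hand `E x ≤ K` bounds that weight by `K` times the weight of the same pairs under the
  -- product distribution.
  have h7 : (1 : ℝ) / 2 ≤ K * 2 ^ (-(n * (jointInfo p lamA lamB - δ))) := by
    have := mul_le_mul_of_nonneg_left h4 (rpow_two_pos (n * (postInfo q e + 2 * δ))).le
    rw [← hK] at this
    linarith
  rw [hK, ← Real.rpow_add (by norm_num)] at h7
  have h8 : (1 : ℝ) / 2 = 2 ^ (-1 : ℝ) := by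
    rw [Real.rpow_neg_one]
    norm_num
  rw [h8, rpow_two_le] at h7
  have hn1 : δ⁻¹ ≤ n := (Nat.le_ceil _).trans (by exact_mod_cast (by omega))
  have hnpos : (0 : ℝ) < n := lt_of_lt_of_le (inv_pos.mpr hδ0) hn1
  have h9 : 1 ≤ n * δ := by
    rw [inv_le_iff_one_le_mul₀ hδ0] at hn1
    exact hn1
  have h10 : n * jointInfo p lamA lamB ≤ n * (postInfo q e + ε) := by
    rw [hδ] at h7 h9
    linarith
  exact le_of_mul_le_mul_left h10 hnpos

end Holevo

/-! ### Entropies of the auxiliary states -/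

section Spectrum

variable {m k : Type*} [Fintype m] [DecidableEq m] [Fintype k] [DecidableEq k]

/-- The entropy of the multiset of roots of the characteristic polynomial. -/
def rootEntropy (A : Matrix m m ℂ) : ℝ :=
  (A.charpoly.roots.map fun z => -(z.re * Real.logb 2 z.re)).sum

lemma entropy_eq_rootEntropy {A : Matrix m m ℂ} (hA : A.IsHermitian) :
    entropy A = rootEntropy A := by
  rw [entropy, dif_pos hA, rootEntropy, hA.roots_charpoly_eq_eigenvalues, Multiset.map_map,
    ← Finset.sum_neg_distrib]
  simp

/-- The characteristic polynomials of `AB` and `BA` differ only by powers of the variable, that is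
by zero roots, which contribute nothing to the entropy. -/
lemma rootEntropy_mul_comm (A : Matrix m k ℂ) (B : Matrix k m ℂ) :
    rootEntropy (A * B) = rootEntropy (B * A) := by
  have h := congrArg (fun P => (P.roots.map fun z : ℂ => -(z.re * Real.logb 2 z.re)).sum)
    (Matrix.charpoly_mul_comm' A B)
  have h0 (j : ℕ) (P : Polynomial ℂ) (hP : P.Monic) :
      ((Polynomial.X ^ j * P).roots.map fun z : ℂ => -(z.re * Real.logb 2 z.re)).sum =
      (P.roots.map fun z : ℂ => -(z.re * Real.logb 2 z.re)).sum := by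
    rw [Polynomial.roots_mul (mul_ne_zero (pow_ne_zero _ Polynomial.X_ne_zero) hP.ne_zero),
      Polynomial.roots_X_pow]
    simp [Multiset.nsmul_singleton]
  simp only [h0 _ _ (Matrix.charpoly_monic _)] at h
  exact h

lemma rootEntropy_transpose (A : Matrix m m ℂ) : rootEntropy Aᵀ = rootEntropy A := by
  rw [rootEntropy, Matrix.charpoly_transpose, rootEntropy]

lemma rootEntropy_diagonal (d : m → ℝ) :
    rootEntropy (Matrix.diagonal fun i => (d i : ℂ)) = shannon d := by
  rw [rootEntropy, Matrix.charpoly_diagonal, Polynomial.roots_prod]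
  · simp [shannon]
  · simp [Finset.prod_ne_zero_iff, Polynomial.X_sub_C_ne_zero]

lemma entropy_diagonal (d : m → ℝ) :
    entropy (Matrix.diagonal fun i => (d i : ℂ)) = shannon d := by
  rw [entropy_eq_rootEntropy, rootEntropy_diagonal]
  rw [Matrix.IsHermitian, Matrix.diagonal_conjTranspose]
  congr 1
  ext i
  simp

lemma rootEntropy_diagIn {V : Matrix m m ℂ} (hV : Vᴴ * V = 1) (d : m → ℝ) :
    rootEntropy (diagIn V d) = shannon d := by
  rw [diagIn, rootEntropy_mul_comm, ← Matrix.mul_assoc, hV, Matrix.one_mul, rootEntropy_diagonal]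

lemma entropy_mul_conjTranspose (G : Matrix m k ℂ) :
    entropy (G * Gᴴ) = rootEntropy (Gᴴ * G) := by
  rw [entropy_eq_rootEntropy (Matrix.isHermitian_mul_conjTranspose_self G), rootEntropy_mul_comm]

end Spectrum

section Blocks

variable {X m k l : Type*} [Fintype X] [DecidableEq X] [Fintype m] [Fintype k] [Fintype l]

/-- The block diagonal matrix with blocks `N x`. -/
def blocks (N : X → Matrix m k ℂ) : Matrix (X × m) (X × k) ℂ :=
  ∑ x, Matrix.single x x 1 ⊗ₖ N x

lemma blocks_apply (N : X → Matrix m k ℂ) (p : X × m) (q : X × k) :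
    blocks N p q = if p.1 = q.1 then N p.1 p.2 q.2 else 0 := by
  simp only [blocks, Matrix.sum_apply, Matrix.kroneckerMap_apply, Matrix.single_apply]
  rw [Finset.sum_eq_single p.1 (fun x _ hx => by simp [hx]) (by simp)]
  simp

lemma blocks_mul_blocks (N : X → Matrix m k ℂ) (N' : X → Matrix k l ℂ) :
    blocks N * blocks N' = blocks fun x => N x * N' x := by
  ext p q
  rw [Matrix.mul_apply, blocks_apply, Fintype.sum_prod_type,
    Finset.sum_eq_single p.1 (fun x _ hx => by simp [blocks_apply, hx.symm]) (by simp)]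
  simp only [blocks_apply, if_true]
  split_ifs
  · rw [Matrix.mul_apply]
  · simp

lemma blocks_conjTranspose (N : X → Matrix m k ℂ) : (blocks N)ᴴ = blocks fun x => (N x)ᴴ := by
  ext p q
  rw [Matrix.conjTranspose_apply, blocks_apply, blocks_apply]
  by_cases h : q.1 = p.1
  · rw [if_pos h, if_pos h.symm, h, Matrix.conjTranspose_apply]
  · rw [if_neg h, if_neg (Ne.symm h), star_zero]

lemma blocks_transpose (N : X → Matrix m k ℂ) : (blocks N)ᵀ = blocks fun x => (N x)ᵀ := by
  ext p q
  rw [Matrix.transpose_apply, blocks_apply, blocks_apply]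
  by_cases h : q.1 = p.1
  · rw [if_pos h, if_pos h.symm, h, Matrix.transpose_apply]
  · rw [if_neg h, if_neg (Ne.symm h)]

lemma blocks_diagonal [DecidableEq m] (d : X → m → ℂ) :
    blocks (fun x => Matrix.diagonal (d x)) = Matrix.diagonal fun z : X × m => d z.1 z.2 := by
  ext p q
  rw [blocks_apply, Matrix.diagonal_apply, Matrix.diagonal_apply]
  by_cases h : p.1 = q.1 <;> by_cases h' : p.2 = q.2 <;> simp [h, h', Prod.ext_iff]

lemma blocks_diagIn [DecidableEq m] (B : X → Matrix m m ℂ) (e : X → m → ℝ) :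
    (blocks fun x => diagIn (B x) (e x)) = diagIn (blocks B) fun z => e z.1 z.2 := by
  rw [diagIn, blocks_conjTranspose, ← blocks_diagonal (fun x i => ((e x i : ℝ) : ℂ)),
    blocks_mul_blocks, blocks_mul_blocks]
  rfl

lemma blocks_one [DecidableEq m] : blocks (fun _ : X => (1 : Matrix m m ℂ)) = 1 := by
  rw [← Matrix.diagonal_one, ← Matrix.diagonal_one]
  exact blocks_diagonal fun _ _ => 1

lemma trSnd_blocks (N : X → Matrix m m ℂ) :
    trSnd (blocks N) = Matrix.diagonal fun x => (N x).trace := by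
  ext x y
  simp only [trSnd, Matrix.of_apply, blocks_apply, Matrix.diagonal_apply]
  by_cases h : x = y
  · simp [h, Matrix.trace]
  · simp [h]

lemma trFst_blocks (N : X → Matrix m m ℂ) : trFst (blocks N) = ∑ x, N x := by
  ext i j
  simp [trFst, blocks_apply, Matrix.sum_apply]

end Blocks

/-! ### Spectra of measured pure states -/

section PostMeasurement

variable {T ι X : Type*} [Fintype T] [DecidableEq T] [Fintype ι] [DecidableEq ι] [Fintype X]
  [DecidableEq X]

/-- A vector of `T ⊗ H` as a matrix. -/
def amplitudes (ψ : T × ι → ℂ) : Matrix T ι ℂ := Matrix.of fun t i => ψ (t, i)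

lemma conjTranspose_transpose_comm {m k : Type*} (G : Matrix m k ℂ) : (Gᵀ)ᴴ = (Gᴴ)ᵀ := rfl

lemma trFst_pureState (ψ : T × ι → ℂ) :
    trFst (pureState ψ) = ((amplitudes ψ)ᴴ * amplitudes ψ)ᵀ := by
  ext i j
  simp [trFst, pureState, amplitudes, Matrix.mul_apply, Matrix.vecMulVec_apply, mul_comm]

/-- With the vector read as a matrix, measuring the second factor inserts the effect between the
matrix and its adjoint; the transpose reflects the order of the indices. -/
lemma trSnd_mul_pureState (N : Matrix ι ι ℂ) (ψ : T × ι → ℂ) :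
    trSnd (((1 : Matrix T T ℂ) ⊗ₖ N) * pureState ψ) =
      amplitudes ψ * Nᵀ * (amplitudes ψ)ᴴ := by
  ext s t
  simp only [trSnd, pureState, amplitudes, Matrix.of_apply, Matrix.mul_apply,
    Matrix.vecMulVec_apply, Matrix.kroneckerMap_apply, Matrix.conjTranspose_apply,
    Matrix.transpose_apply, Fintype.sum_prod_type, Matrix.one_apply, Pi.star_apply]
  refine Finset.sum_congr rfl fun i _ => ?_
  rw [Finset.sum_eq_single s (fun r _ hr => by simp [hr.symm]) (by simp), Finset.sum_mul]
  refine Finset.sum_congr rfl fun j _ => ?_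
  simp only [if_true]
  ring

lemma postMeas_pureState (M : X → Matrix ι ι ℂ) (ψ : T × ι → ℂ) :
    postMeas M (pureState ψ) =
      blocks fun x => amplitudes ψ * (M x)ᵀ * (amplitudes ψ)ᴴ := by
  simp only [postMeas, blocks, trSnd_mul_pureState]

lemma trace_amplitudes {ρ : Matrix ι ι ℂ} {ψ : T × ι → ℂ} (hψ : IsPurification ψ ρ)
    {N : Matrix ι ι ℂ} (hN : 0 ≤ N) (hρ : 0 ≤ ρ) :
    (amplitudes ψ * Nᵀ * (amplitudes ψ)ᴴ).trace = (trPair N ρ : ℂ) := by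
  rw [← trace_mul_eq_trPair hN hρ, ← hψ, trFst_pureState, Matrix.trace_mul_comm,
    ← Matrix.mul_assoc, ← Matrix.trace_transpose, Matrix.transpose_mul,
    Matrix.transpose_transpose]

lemma trSnd_postMeas_pureState {ρ : Matrix ι ι ℂ} {ψ : T × ι → ℂ} (hψ : IsPurification ψ ρ)
    {M : X → Matrix ι ι ℂ} (hM : ∀ x, 0 ≤ M x) (hρ : 0 ≤ ρ) :
    trSnd (postMeas M (pureState ψ)) = Matrix.diagonal fun x => (trPair (M x) ρ : ℂ) := by
  rw [postMeas_pureState, trSnd_blocks]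
  simp only [trace_amplitudes hψ (hM _) hρ]

variable {ρ : Matrix ι ι ℂ} {Λ : X → Matrix ι ι ℂ} {V : Matrix ι ι ℂ} {q : ι → ℝ}
  {F B : X → Matrix ι ι ℂ} {e : X → ι → ℝ}

lemma SpectralData.povm_nonneg (h : SpectralData ρ Λ V q F B e) (x : X) : 0 ≤ Λ x := by
  rw [h.povm_eq]
  exact conjTranspose_mul_self_nonneg _

/-- Let `A` be the amplitude matrix, so `Aᴴ A = ρᵀ`. The unmeasured part of block `x` is `G Gᴴ` with
`G = A Fᵀ`, while `Gᴴ G` is the transpose of `F ρ Fᴴ`. All entropies can thus be computed on the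
measured system, whatever the dimension of the purifying one. -/
lemma SpectralData.mutualInfo_postMeas (h : SpectralData ρ Λ V q F B e) {ψ : T × ι → ℂ}
    (hψ : IsPurification ψ ρ) : mutualInfo (postMeas Λ (pureState ψ)) = postInfo q e := by
  have hgram : (amplitudes ψ)ᴴ * amplitudes ψ = ρᵀ := by
    rw [← hψ, trFst_pureState, Matrix.transpose_transpose]
  have h1 : entropy (trSnd (postMeas Λ (pureState ψ))) = shannon fun x => ∑ i, e x i := by
    rw [trSnd_postMeas_pureState hψ h.povm_nonneg h.state_nonneg, entropy_diagonal]
    simp only [h.trPair_povm]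
  have h2 : entropy (trFst (postMeas Λ (pureState ψ))) = shannon q := by
    rw [postMeas_pureState, trFst_blocks, ← Matrix.sum_mul, ← Matrix.mul_sum,
      ← Matrix.transpose_sum, h.sum_povm, Matrix.transpose_one, Matrix.mul_one,
      entropy_mul_conjTranspose, hgram, rootEntropy_transpose, h.state_eq,
      rootEntropy_diagIn h.isometry]
  have h3 : entropy (postMeas Λ (pureState ψ)) = shannon fun z : X × ι => e z.1 z.2 := by
    have h4 (x : X) : amplitudes ψ * (Λ x)ᵀ * (amplitudes ψ)ᴴ =
        (amplitudes ψ * (F x)ᵀ) * (amplitudes ψ * (F x)ᵀ)ᴴ := by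
      rw [h.povm_eq, Matrix.transpose_mul, Matrix.conjTranspose_mul,
        conjTranspose_transpose_comm]
      simp only [Matrix.mul_assoc]
    have h5 (x : X) : (amplitudes ψ * (F x)ᵀ)ᴴ * (amplitudes ψ * (F x)ᵀ) =
        (diagIn (B x) (e x))ᵀ := by
      rw [← h.post_eq, Matrix.conjTranspose_mul, Matrix.transpose_mul, Matrix.transpose_mul,
        ← hgram, conjTranspose_transpose_comm]
      simp only [Matrix.mul_assoc]
    have h6 : (blocks B)ᴴ * blocks B = 1 := by
      rw [blocks_conjTranspose, blocks_mul_blocks]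
      simp only [h.isometry_post, blocks_one]
    rw [postMeas_pureState]
    simp only [h4]
    rw [← blocks_mul_blocks, ← blocks_conjTranspose, entropy_mul_conjTranspose,
      blocks_conjTranspose, blocks_mul_blocks]
    simp only [h5]
    rw [← blocks_transpose, rootEntropy_transpose, blocks_diagIn, rootEntropy_diagIn h6]
  rw [mutualInfo, h1, h2, h3, postInfo]
  ring

end PostMeasurement

section AuxiliaryStates

variable {R a b U V : Type*} [Fintype R] [DecidableEq R] [Fintype a] [DecidableEq a] [Fintype b]
  [DecidableEq b] [Fintype U] [DecidableEq U] [Fintype V] [DecidableEq V]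
  {ρ : Matrix (a × b) (a × b) ℂ} {ψ : R × (a × b) → ℂ}

/-- The reference together with the other party purifies one party's marginal, so the one-sided
entropy computation applies to it. -/
lemma IsPurification.fst (hψ : IsPurification ψ ρ) :
    IsPurification (fun p : (R × b) × a => ψ (p.1.1, (p.2, p.1.2))) (trSnd ρ) := by
  rw [IsPurification, ← hψ]
  ext i j
  simp only [trFst, trSnd, pureState, Matrix.of_apply, Matrix.vecMulVec_apply,
    Fintype.sum_prod_type, Pi.star_apply]
  exact Finset.sum_comm

lemma IsPurification.snd (hψ : IsPurification ψ ρ) :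
    IsPurification (fun p : (R × a) × b => ψ (p.1.1, (p.1.2, p.2))) (trFst ρ) := by
  rw [IsPurification, ← hψ]
  ext i j
  simp only [trFst, pureState, Matrix.of_apply, Matrix.vecMulVec_apply,
    Fintype.sum_prod_type, Pi.star_apply]
  exact Finset.sum_comm

variable {MA : U → Matrix a a ℂ} {MB : V → Matrix b b ℂ}

lemma sigma3UV_eq (hψ : IsPurification ψ ρ) (hρ : 0 ≤ ρ) (hA : ∀ u, 0 ≤ MA u)
    (hB : ∀ v, 0 ≤ MB v) :
    sigma3UV MA MB ψ =
      Matrix.diagonal fun z : U × V => (trPair (MA z.1 ⊗ₖ MB z.2) ρ : ℂ) :=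
  trSnd_postMeas_pureState hψ (fun z => kronecker_nonneg (hA z.1) (hB z.2)) hρ

lemma trSnd_diagonal (d : U × V → ℝ) : trSnd (Matrix.diagonal fun z => (d z : ℂ)) =
    Matrix.diagonal fun u => ((∑ v, d (u, v) : ℝ) : ℂ) := by
  ext u u'
  by_cases h : u = u' <;> simp [trSnd, Matrix.diagonal_apply, h]

lemma trFst_diagonal (d : U × V → ℝ) : trFst (Matrix.diagonal fun z => (d z : ℂ)) =
    Matrix.diagonal fun v => ((∑ u, d (u, v) : ℝ) : ℂ) := by
  ext v v'
  by_cases h : v = v' <;> simp [trFst, Matrix.diagonal_apply, h]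

end AuxiliaryStates

/-! ### Rates and sizes of codebooks -/

section Rates

/-- The inequalities of the rate region split the common randomness between the two parties and
supply rates of binning. -/
lemma exists_rates {R₁ R₂ C I₁ I₂ I S₁ S₂ : ℝ} (hC : 0 ≤ C) (hI : 0 ≤ I) (hS₁ : I₁ ≤ S₁)
    (hS₂ : I₂ ≤ S₂) (h₁ : I₁ - I ≤ R₁) (h₂ : I₂ - I ≤ R₂) (h₁₂ : I₁ + I₂ - I ≤ R₁ + R₂)
    (h₁C : S₁ - I ≤ R₁ + C) (h₂C : S₂ - I ≤ R₂ + C) (h₁₂C : S₁ + S₂ - I ≤ R₁ + R₂ + C) :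
    ∃ c₁ c₂ r₁ r₂ : ℝ, 0 ≤ c₁ ∧ 0 ≤ c₂ ∧ 0 ≤ r₁ ∧ 0 ≤ r₂ ∧ c₁ + c₂ = C ∧ r₁ + r₂ ≤ I ∧
      I₁ ≤ R₁ + r₁ ∧ I₂ ≤ R₂ + r₂ ∧ S₁ ≤ c₁ + (R₁ + r₁) ∧ S₂ ≤ c₂ + (R₂ + r₂) := by
  -- The `a_i` are the least admissible bin rates for the information constraints. The rate `c₁` is
  -- the least one for which Alice's covering constraint can be met while leaving `a₂` of the budget
  -- `I` to Bob. The remaining randomness goes to Bob, and each `r_i` is then the least rate that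
  -- meets both of its constraints.
  set a₁ := max 0 (I₁ - R₁) with ha₁
  set a₂ := max 0 (I₂ - R₂) with ha₂
  set c₁ := max 0 (S₁ - R₁ + a₂ - I) with hc₁
  have e1 : 0 ≤ a₁ := le_max_left _ _
  have e2 : I₁ - R₁ ≤ a₁ := le_max_right _ _
  have e3 : 0 ≤ a₂ := le_max_left _ _
  have e4 : I₂ - R₂ ≤ a₂ := le_max_right _ _
  have e5 : 0 ≤ c₁ := le_max_left _ _
  have e6 : S₁ - R₁ + a₂ - I ≤ c₁ := le_max_right _ _
  refine ⟨c₁, C - c₁, max a₁ (S₁ - R₁ - c₁), max a₂ (S₂ - R₂ - (C - c₁)), e5, ?_,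
    e1.trans (le_max_left _ _), e3.trans (le_max_left _ _), by ring, ?_, ?_, ?_, ?_, ?_⟩
  · rcases max_choice 0 (S₁ - R₁ + a₂ - I) with h | h <;>
    rcases max_choice 0 (I₂ - R₂) with h' | h' <;> linarith
  · rcases max_choice 0 (S₁ - R₁ + a₂ - I) with h | h <;>
    rcases max_choice 0 (I₁ - R₁) with h' | h' <;>
    rcases max_choice 0 (I₂ - R₂) with h'' | h'' <;>
    rcases max_choice a₁ (S₁ - R₁ - c₁) with h3 | h3 <;>
    rcases max_choice a₂ (S₂ - R₂ - (C - c₁)) with h4 | h4 <;> rw [h3, h4] <;> linarith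
  · linarith [le_max_left a₁ (S₁ - R₁ - c₁)]
  · linarith [le_max_left a₂ (S₂ - R₂ - (C - c₁))]
  · linarith [le_max_right a₁ (S₁ - R₁ - c₁)]
  · linarith [le_max_right a₂ (S₂ - R₂ - (C - c₁))]

/-- The least size that is enough for `x` bits. -/
def ceilSize (x : ℝ) : ℕ := ⌈(2 : ℝ) ^ x⌉₊

/-- The greatest positive size that `x` bits allow. -/
def floorSize (x : ℝ) : ℕ := ⌊(2 : ℝ) ^ max x 0⌋₊

lemma ceilSize_pos (x : ℝ) : 0 < ceilSize x := Nat.ceil_pos.mpr (rpow_two_pos x)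

lemma le_ceilSize (x : ℝ) : (2 : ℝ) ^ x ≤ ceilSize x := Nat.le_ceil _

lemma logb_ceilSize_le {x : ℝ} (hx : 0 ≤ x) : Real.logb 2 (ceilSize x) ≤ x + 1 := by
  have h0 : (0 : ℝ) < ceilSize x := by exact_mod_cast ceilSize_pos x
  have h1 : (1 : ℝ) ≤ 2 ^ x := Real.one_le_rpow (by norm_num) hx
  have h2 : (ceilSize x : ℝ) ≤ 2 ^ (x + 1) := by
    have := Nat.ceil_lt_add_one (rpow_two_pos x).le
    rw [Real.rpow_add (by norm_num), Real.rpow_one, ceilSize]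
    linarith
  rw [Real.logb_le_iff_le_rpow (by norm_num) h0]
  exact h2

lemma one_le_rpow_max (x : ℝ) : (1 : ℝ) ≤ 2 ^ max x 0 :=
  Real.one_le_rpow (by norm_num) (le_max_right _ _)

lemma floorSize_pos (x : ℝ) : 0 < floorSize x := Nat.floor_pos.mpr (one_le_rpow_max x)

lemma floorSize_le (x : ℝ) : (floorSize x : ℝ) ≤ 2 ^ max x 0 :=
  Nat.floor_le (zero_le_one.trans (one_le_rpow_max x))

lemma le_floorSize (x : ℝ) : (2 : ℝ) ^ x ≤ 2 * floorSize x := by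
  have h1 : (2 : ℝ) ^ x ≤ 2 ^ max x 0 := rpow_two_le.mpr (le_max_left _ _)
  have h2 := Nat.lt_floor_add_one ((2 : ℝ) ^ max x 0)
  have h3 : (1 : ℝ) ≤ floorSize x := by exact_mod_cast floorSize_pos x
  rw [floorSize] at h3 ⊢
  linarith

/-- If neither exponent is positive, both sizes are one and the left side is zero. This allows a
negative `z`, as occurs when the mutual information is smaller than the slack. -/
lemma floorSize_mul_sub_one_le {x y z : ℝ} (hx : x ≤ z) (hy : y ≤ z) (hxy : x + y ≤ z) :
    (floorSize x * floorSize y - 1 : ℝ) ≤ 2 ^ z := by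
  have h1 : (floorSize x * floorSize y : ℝ) ≤ 2 ^ (max x 0 + max y 0) := by
    rw [Real.rpow_add (by norm_num)]
    exact mul_le_mul (floorSize_le x) (floorSize_le y) (Nat.cast_nonneg _) (rpow_two_pos _).le
  rcases le_total x 0 with hx0 | hx0 <;> rcases le_total y 0 with hy0 | hy0
  · rw [max_eq_right hx0, max_eq_right hy0, add_zero, Real.rpow_zero] at h1
    linarith [rpow_two_pos z]
  all_goals
    refine (sub_le_self _ zero_le_one).trans (h1.trans (rpow_two_le.mpr ?_))
    simp only [max_eq_left, max_eq_right, hx0, hy0]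
    linarith

/-- The factor `2` pays for rounding down; a size forced up to one only helps. -/
lemma div_le_of_le_mul_floorSize {x y Θ s : ℝ} {r : ℝ} (hΘ : (2 : ℝ) ^ y ≤ Θ)
    (h : x - s ≤ y + r) : 2 ^ x / (Θ * floorSize r) ≤ 2 * 2 ^ s := by
  have h0 : (0 : ℝ) < floorSize r := by exact_mod_cast floorSize_pos r
  have h1 : 0 < Θ := (rpow_two_pos y).trans_le hΘ
  rw [div_le_iff₀ (mul_pos h1 h0)]
  have h2 : (2 : ℝ) ^ y * 2 ^ r ≤ Θ * (2 * floorSize r) :=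
    mul_le_mul hΘ (le_floorSize r) (rpow_two_pos r).le h1.le
  have h3 : (2 : ℝ) ^ (x - s) ≤ 2 ^ y * 2 ^ r := by
    rw [← Real.rpow_add (by norm_num)]
    exact rpow_two_le.mpr h
  have h4 : (2 : ℝ) ^ x = 2 ^ (x - s) * 2 ^ s := by
    rw [← Real.rpow_add (by norm_num), sub_add_cancel]
  rw [h4]
  have h5 := mul_le_mul_of_nonneg_right (h3.trans h2) (rpow_two_pos s).le
  linarith

end Rates

/-! ### Faithful protocols -/

section FaithfulProtocol

variable {a b U V Z : Type*} [Fintype a] [DecidableEq a] [Fintype b] [DecidableEq b]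
  [Fintype U] [DecidableEq U] [Fintype V] [DecidableEq V] [Fintype Z] [DecidableEq Z]
  {ρ : Matrix (a × b) (a × b) ℂ} {M : Z → Matrix (a × b) (a × b) ℂ}
  {MA : U → Matrix a a ℂ} {MB : V → Matrix b b ℂ} {g : U × V → Z} {n : ℕ}

lemma statePow_nonneg (hρ : 0 ≤ ρ) (n : ℕ) : 0 ≤ statePow ρ n :=
  tensorAB_nonneg fun _ => hρ

lemma measPow_nonneg (hM : ∀ z, 0 ≤ M z) (z : Fin n → Z) : 0 ≤ measPow M n z :=
  tensorAB_nonneg fun k => hM (z k)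

lemma kronecker_sum {m k X : Type*} (s : Finset X) (A : Matrix m m ℂ) (N : X → Matrix k k ℂ) :
    A ⊗ₖ (∑ x ∈ s, N x) = ∑ x ∈ s, A ⊗ₖ N x := by
  ext p q
  simp [Matrix.sum_apply, Finset.mul_sum]

lemma sum_kronecker {m k X : Type*} (s : Finset X) (N : X → Matrix m m ℂ) (A : Matrix k k ℂ) :
    (∑ x ∈ s, N x) ⊗ₖ A = ∑ x ∈ s, N x ⊗ₖ A := by
  ext p q
  simp [Matrix.sum_apply, Finset.sum_mul]

lemma sum_measPow (hg : IsDeterministicIntegration M MA MB g) (hA : ∑ u, MA u = 1)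
    (hB : ∑ v, MB v = 1) : ∑ z, measPow M n z = 1 := by
  simp only [measPow_eq_sum hg]
  rw [Finset.sum_comm]
  have h1 (x : Fin n → U) : ∑ z : Fin n → Z, ∑ w : Fin n → V,
      (if (fun k => g (x k, w k)) = z then
        piTensor (fun k => MA (x k)) ⊗ₖ piTensor (fun k => MB (w k)) else 0) =
      piTensor (fun k => MA (x k)) ⊗ₖ 1 := by
    rw [Finset.sum_comm]
    simp only [Finset.sum_ite_eq, Finset.mem_univ, if_true]
    rw [← kronecker_sum, sum_piTensor, hB, piTensor_one]
  simp only [h1]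
  rw [← sum_kronecker, sum_piTensor, hA, piTensor_one, Matrix.one_kronecker_one]

lemma trPair_kronecker_statePow (hρ : 0 ≤ ρ) (hA : ∀ u, 0 ≤ MA u) (hB : ∀ v, 0 ≤ MB v)
    (x : Fin n → U) (w : Fin n → V) :
    trPair (piTensor (fun k => MA (x k)) ⊗ₖ piTensor (fun k => MB (w k))) (statePow ρ n) =
      ∏ k, trPair (MA (x k) ⊗ₖ MB (w k)) ρ := by
  rw [← tensorAB_kronecker, trPair, statePow, trace_tensorAB_mul]
  simp only [trace_mul_eq_trPair (kronecker_nonneg (hA _) (hB _)) hρ]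
  rw [← Complex.ofReal_prod, Complex.ofReal_re]

-- The outcome is computed by applying `g` letter by letter to the decoded pair, so the one-shot
-- bound is used with the test family pulled back along `g`. The constants `44` and `36` collect the
-- coefficients of the small errors `θ` and `s` in that bound.
open Classical in
lemma exists_isFaithful_protocol [Nonempty U] [Nonempty V] (hρ : 0 ≤ ρ) (hM : ∀ z, 0 ≤ M z)
    (hA1 : ∑ u, MA u = 1) (hB1 : ∑ v, MB v = 1) (hg : IsDeterministicIntegration M MA MB g)
    {EA : (Fin n → U) → Matrix (Fin n → a) (Fin n → a) ℂ}
    {EB : (Fin n → V) → Matrix (Fin n → b) (Fin n → b) ℂ}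
    {lamA : (Fin n → U) → ℝ} {lamB : (Fin n → V) → ℝ} {κA κB θ ω s t ε DA DB : ℝ}
    (hA : IsTrimmed (trSnd (statePow ρ n)) (fun x => piTensor fun k => MA (x k)) EA lamA κA θ)
    (hB : IsTrimmed (trFst (statePow ρ n)) (fun w => piTensor fun k => MB (w k)) EB lamB κB θ)
    {S : (Fin n → U) → (Fin n → V) → Prop}
    (hπ : (∑ x, ∑ w, if S x w then 0 else
      trPair (piTensor (fun k => MA (x k)) ⊗ₖ piTensor (fun k => MB (w k))) (statePow ρ n)) ≤ θ)
    (hω : ∑ x, ∑ w, lamA x * lamB w * (if S x w then 1 else 0) ≤ ω)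
    {SA : Finset (Fin n → U)} {SB : Finset (Fin n → V)} (hSA : (SA.card : ℝ) ≤ DA)
    (hSB : (SB.card : ℝ) ≤ DB) (hDA : 0 < DA) (hDB : 0 < DB) (hqA : ∑ x ∈ SAᶜ, lamA x ≤ θ)
    (hqB : ∑ w ∈ SBᶜ, lamB w ≤ θ) (ht : 0 < t) {Θ₁ Θ₂ N₁ N₂ K₁ K₂ : ℕ} (hΘ₁ : 0 < Θ₁)
    (hΘ₂ : 0 < Θ₂) (hN₁ : 0 < N₁) (hN₂ : 0 < N₂) (hK₁ : 0 < K₁) (hK₂ : 0 < K₂)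
    (h₁ : κA / (Θ₁ * K₁) ≤ 2 * s) (h₂ : κB / (Θ₂ * K₂) ≤ 2 * s)
    (h₁' : DA / (N₁ * (Θ₁ * K₁)) ≤ 2 * s) (h₂' : DB / (N₂ * (Θ₂ * K₂)) ≤ 2 * s)
    (h₁₂ : (K₁ * K₂ - 1) * ω ≤ s)
    (hε : 4 * t + (44 + 2 * t⁻¹) * θ + (36 + 8 * t⁻¹) * s ≤ ε / 2) :
    ∃ P : Protocol a b Z n Θ₁ Θ₂ (N₁ * N₂),
      IsFaithful ε (measPow M n) P.overall (statePow ρ n) := by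
  have : Nonempty (Fin N₁) := ⟨⟨0, hN₁⟩⟩
  have : Nonempty (Fin N₂) := ⟨⟨0, hN₂⟩⟩
  have : Nonempty (Fin Θ₁) := ⟨⟨0, hΘ₁⟩⟩
  have : Nonempty (Fin Θ₂) := ⟨⟨0, hΘ₂⟩⟩
  have : Nonempty (Fin K₁) := ⟨⟨0, hK₁⟩⟩
  have : Nonempty (Fin K₂) := ⟨⟨0, hK₂⟩⟩
  obtain ⟨c₁, c₂, hc⟩ := exists_codebooks (M₁ := Fin N₁) (M₂ := Fin N₂) (B₁ := Fin Θ₁)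
    (B₂ := Fin Θ₂) (J₁ := Fin K₁) (J₂ := Fin K₂) (statePow_nonneg hρ n) hA hB hπ hω hSA hSB hDA
    hDB hqA hqB ht
  let x₀ : (Fin n → U) × (Fin n → V) :=
    (fun _ => Classical.arbitrary U, fun _ => Classical.arbitrary V)
  let G : (Fin n → U) × (Fin n → V) → (Fin n → Z) := fun p k => g (p.1 k, p.2 k)
  refine ⟨bookProtocol hA.nonneg hB.nonneg c₁ c₂
    fun μ₁ μ₂ l₁ l₂ => G (binDecode S c₁ c₂ x₀ μ₁ μ₂ l₁ l₂),
    isFaithful_of_trPair_le (statePow_nonneg hρ n)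
      (fun z => (posSemidef_of_nonneg (measPow_nonneg hM z)).1)
      (fun z => (posSemidef_of_nonneg (Protocol.overall_nonneg _ z)).1)
      (sum_measPow hg hA1 hB1) fun Y hY => ?_⟩
  rw [sum_trPair_measPow hg, sum_trPair_bookProtocol]
  have h := hc x₀ (fun p => Y (G p)) fun p => hY _
  simp only [Fintype.card_prod, Fintype.card_fin, Nat.cast_mul] at h
  refine h.trans (le_trans ?_ hε)
  have hT : 0 < t⁻¹ := inv_pos.mpr ht
  have e1 : DA / (N₁ * (Θ₁ * K₁) * t) ≤ 2 * s * t⁻¹ := by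
    rw [← div_div, div_eq_mul_inv _ t]
    exact mul_le_mul_of_nonneg_right h₁' hT.le
  have e2 : DB / (N₂ * (Θ₂ * K₂) * t) ≤ 2 * s * t⁻¹ := by
    rw [← div_div, div_eq_mul_inv _ t]
    exact mul_le_mul_of_nonneg_right h₂' hT.le
  have e3 := mul_le_mul_of_nonneg_left h₁ (by linarith : 0 ≤ t⁻¹ + 1)
  have e4 := mul_le_mul_of_nonneg_left h₂ (by linarith : 0 ≤ t⁻¹ + 1)
  linarith

end FaithfulProtocol

/-! ### Choice of the code parameters -/

section Achievability

variable {a b U V Z : Type*} [Fintype a] [DecidableEq a] [Fintype b] [DecidableEq b]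
  [Fintype U] [DecidableEq U] [Fintype V] [DecidableEq V] [Fintype Z] [DecidableEq Z]
  {ρ : Matrix (a × b) (a × b) ℂ} {M : Z → Matrix (a × b) (a × b) ℂ}
  {MA : U → Matrix a a ℂ} {MB : V → Matrix b b ℂ} {g : U × V → Z}
  {VA : Matrix a a ℂ} {qA : a → ℝ} {FA BA : U → Matrix a a ℂ} {eA : U → a → ℝ}
  {VB : Matrix b b ℂ} {qB : b → ℝ} {FB BB : V → Matrix b b ℂ} {eB : V → b → ℝ}

/-- The joint distribution of the outcomes. -/
def outcomes (ρ : Matrix (a × b) (a × b) ℂ) (MA : U → Matrix a a ℂ) (MB : V → Matrix b b ℂ) :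
    U × V → ℝ :=
  fun z => trPair (MA z.1 ⊗ₖ MB z.2) ρ

lemma outcomes_nonneg (hρ : 0 ≤ ρ) (hA : ∀ u, 0 ≤ MA u) (hB : ∀ v, 0 ≤ MB v) (z : U × V) :
    0 ≤ outcomes ρ MA MB z :=
  trPair_nonneg (kronecker_nonneg (hA _) (hB _)) hρ

lemma sum_outcomes_right (hB : ∑ v, MB v = 1) (u : U) :
    ∑ v, outcomes ρ MA MB (u, v) = trPair (MA u) (trSnd ρ) := by
  simp only [outcomes]
  rw [← trPair_kronecker_sum, hB, ← trPair_kronecker_one]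

lemma sum_outcomes_left (hA : ∑ u, MA u = 1) (v : V) :
    ∑ u, outcomes ρ MA MB (u, v) = trPair (MB v) (trFst ρ) := by
  simp only [outcomes]
  rw [← trPair_sum_kronecker, hA, ← trPair_one_kronecker]

lemma SpectralData.sum_outcomes_right (hA : SpectralData (trSnd ρ) MA VA qA FA BA eA)
    (hB : ∑ v, MB v = 1) (u : U) : ∑ v, outcomes ρ MA MB (u, v) = ∑ i, eA u i := by
  rw [DistMeas.sum_outcomes_right hB, hA.trPair_povm]

lemma SpectralData.sum_outcomes_left (hB : SpectralData (trFst ρ) MB VB qB FB BB eB)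
    (hA : ∑ u, MA u = 1) (v : V) : ∑ u, outcomes ρ MA MB (u, v) = ∑ i, eB v i := by
  rw [DistMeas.sum_outcomes_left hA, hB.trPair_povm]

lemma SpectralData.marginal_fst_pos (hρ : 0 ≤ ρ) (hA : SpectralData (trSnd ρ) MA VA qA FA BA eA)
    (hB : SpectralData (trFst ρ) MB VB qB FB BB eB) (z : U × V)
    (hz : 0 < outcomes ρ MA MB z) : 0 < ∑ i, eA z.1 i := by
  rw [← hA.sum_outcomes_right hB.sum_povm]
  exact hz.trans_le (Finset.single_le_sum (f := fun v => outcomes ρ MA MB (z.1, v))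
    (fun v _ => outcomes_nonneg hρ hA.povm_nonneg hB.povm_nonneg _) (Finset.mem_univ z.2))

lemma SpectralData.marginal_snd_pos (hρ : 0 ≤ ρ) (hA : SpectralData (trSnd ρ) MA VA qA FA BA eA)
    (hB : SpectralData (trFst ρ) MB VB qB FB BB eB) (z : U × V)
    (hz : 0 < outcomes ρ MA MB z) : 0 < ∑ i, eB z.2 i := by
  rw [← hB.sum_outcomes_left hA.sum_povm]
  exact hz.trans_le (Finset.single_le_sum (f := fun u => outcomes ρ MA MB (u, z.2))
    (fun u _ => outcomes_nonneg hρ hA.povm_nonneg hB.povm_nonneg _) (Finset.mem_univ z.1))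

lemma SpectralData.sum_outcomes (hA : SpectralData (trSnd ρ) MA VA qA FA BA eA)
    (hB : SpectralData (trFst ρ) MB VB qB FB BB eB) : ∑ z, outcomes ρ MA MB z = 1 := by
  rw [Fintype.sum_prod_type]
  simp only [hA.sum_outcomes_right hB.sum_povm, hA.sum_post]

lemma exists_rpow_neg_le {η θ : ℝ} (hη : 0 < η) (hθ : 0 < θ) :
    ∃ n₀ : ℕ, ∀ n : ℕ, n₀ ≤ n → (2 : ℝ) ^ (-(n * η)) ≤ θ := by
  have h0 : (2 : ℝ) ^ (-η) < 1 := Real.rpow_lt_one_of_one_lt_of_neg (by norm_num) (by linarith)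
  obtain ⟨n₀, hn₀⟩ := exists_pow_lt_of_lt_one hθ h0
  refine ⟨n₀, fun n hn => ?_⟩
  have h1 : (2 : ℝ) ^ (-(n * η)) = ((2 : ℝ) ^ (-η)) ^ n := by
    rw [← Real.rpow_natCast, ← Real.rpow_mul (by norm_num)]
    congr 1
    ring
  rw [h1]
  exact (pow_le_pow_of_le_one (rpow_two_pos _).le h0.le hn).trans hn₀.le

theorem achievable_of_rates (hρ : 0 ≤ ρ) (hM : ∀ z, 0 ≤ M z)
    (hg : IsDeterministicIntegration M MA MB g)
    (hA : SpectralData (trSnd ρ) MA VA qA FA BA eA)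
    (hB : SpectralData (trFst ρ) MB VB qB FB BB eB) {R₁ R₂ c₁ c₂ r₁ r₂ I : ℝ}
    (hI : I = jointInfo (outcomes ρ MA MB) (fun u => ∑ i, eA u i) (fun v => ∑ i, eB v i))
    (hR₁ : 0 ≤ R₁) (hR₂ : 0 ≤ R₂) (hc₁ : 0 ≤ c₁) (hc₂ : 0 ≤ c₂) (hr₁ : 0 ≤ r₁) (hr₂ : 0 ≤ r₂)
    (hr : r₁ + r₂ ≤ I) (h₁ : postInfo qA eA ≤ R₁ + r₁) (h₂ : postInfo qB eB ≤ R₂ + r₂)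
    (h₁' : shannon (fun u => ∑ i, eA u i) ≤ c₁ + (R₁ + r₁))
    (h₂' : shannon (fun v => ∑ i, eB v i) ≤ c₂ + (R₂ + r₂)) :
    Achievable ρ M R₁ R₂ (c₁ + c₂) := by
  classical
  intro ε hε
  have hp0 := outcomes_nonneg hρ hA.povm_nonneg hB.povm_nonneg
  have hp1 := hA.sum_outcomes hB
  have hne : Nonempty (U × V) := by
    by_contra h
    rw [not_nonempty_iff] at h
    simp at hp1
  have hU : Nonempty U := ⟨(Classical.arbitrary (U × V)).1⟩
  have hV : Nonempty V := ⟨(Classical.arbitrary (U × V)).2⟩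
  have hlamA (u : U) : 0 ≤ ∑ i, eA u i := Finset.sum_nonneg fun i _ => hA.post_nonneg u i
  have hlamB (v : V) : 0 ≤ ∑ i, eB v i := Finset.sum_nonneg fun i _ => hB.post_nonneg v i
  -- The errors coming from `t`, `θ` and `s` take `ε/8` each, within the allowed `ε/2`. The message
  -- rates exceed `R_i` by `3η = 3ε/8` and a rounding loss of at most `ε/4`.
  set η := ε / 8 with hη
  have hη0 : 0 < η := by positivity
  set t := ε / 32 with ht
  have ht0 : 0 < t := by positivity
  have hT0 : 0 < t⁻¹ := inv_pos.mpr ht0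
  set θ := ε / 8 / (44 + 2 * t⁻¹) with hθ
  have hθ0 : 0 < θ := by positivity
  obtain ⟨n₁, hn₁⟩ := hA.exists_isTrimmed (half_pos hη0) hθ0
  obtain ⟨n₂, hn₂⟩ := hB.exists_isTrimmed (half_pos hη0) hθ0
  obtain ⟨n₃, hn₃⟩ := exists_typical hlamA hA.sum_post hη0 hθ0
  obtain ⟨n₄, hn₄⟩ := exists_typical hlamB hB.sum_post hη0 hθ0
  obtain ⟨n₅, hn₅⟩ := exists_jointTypical (lamA := fun u => ∑ i, eA u i)
    (lamB := fun v => ∑ i, eB v i) hp0 hp1 (hA.marginal_fst_pos hρ hB)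
    (hA.marginal_snd_pos hρ hB) (half_pos hη0) hθ0
  obtain ⟨n₆, hn₆⟩ := exists_rpow_neg_le (half_pos hη0)
    (show 0 < ε / 8 / (36 + 8 * t⁻¹) by positivity)
  obtain ⟨n₇, hn₇⟩ := exists_nat_gt (4 / ε)
  refine ⟨n₁ + n₂ + n₃ + n₄ + n₅ + n₆ + n₇ + 1, fun n hn => ?_⟩
  obtain ⟨EA, hEA, -⟩ := hn₁ n (by omega)
  obtain ⟨EB, hEB, -⟩ := hn₂ n (by omega)
  have hs := hn₆ n (by omega)
  have hnpos : (0 : ℝ) < n := by exact_mod_cast (by omega : 0 < n)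
  have hn4 : 1 / (n : ℝ) ≤ ε / 4 := by
    have : (n₇ : ℝ) ≤ n := by exact_mod_cast (by omega : n₇ ≤ n)
    rw [div_le_iff₀ hnpos]
    rw [div_lt_iff₀ hε] at hn₇
    nlinarith
  set s := (2 : ℝ) ^ (-(n * (η / 2))) with hsdef
  have hs0 : (2 : ℝ) ^ (-(n * η)) ≤ s := rpow_two_le.mpr (by nlinarith)
  have hnη : 0 < n * η := mul_pos hnpos hη0
  -- Messages gain `3η`, bins lose `η` and the target size exceeds `x` by `η`. The net surplus
  -- `2^{-nη}` serves both for the second moment and for covering.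
  have hsize (x R r : ℝ) (h : x ≤ R + r) (Θ : ℝ) (hΘ : (2 : ℝ) ^ (n * (R + 3 * η)) ≤ Θ) :
      (2 : ℝ) ^ (n * (x + η)) / (Θ * floorSize (n * (r - η))) ≤ 2 * s := by
    refine (div_le_of_le_mul_floorSize (s := -(n * η)) hΘ ?_).trans (by linarith)
    have := mul_le_mul_of_nonneg_left h hnpos.le
    linarith
  have hκ (x : ℝ) : x + 2 * (η / 2) = x + η := by ring
  rw [hκ] at hEA hEB
  have hmul (c R : ℝ) : (2 : ℝ) ^ (n * (c + R + 3 * η)) ≤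
      ceilSize (n * c) * ceilSize (n * (R + 3 * η)) := by
    have e1 : n * (c + R + 3 * η) = n * c + n * (R + 3 * η) := by ring
    rw [e1, Real.rpow_add (by norm_num)]
    exact mul_le_mul (le_ceilSize _) (le_ceilSize _) (rpow_two_pos _).le (Nat.cast_nonneg _)
  -- Shrinking each bin rate by `η` beats the loss `η/2` in the joint typicality exponent, even when
  -- only one of the bins is larger than a single codeword.
  have hbin : ((floorSize (n * (r₁ - η)) * floorSize (n * (r₂ - η)) - 1 : ℝ)) *
      2 ^ (-(n * (I - η / 2))) ≤ s := by
    have e1 := mul_le_mul_of_nonneg_left hr hnpos.le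
    have e2 := mul_nonneg hnpos.le hr₁
    have e3 := mul_nonneg hnpos.le hr₂
    have e4 := floorSize_mul_sub_one_le (x := n * (r₁ - η)) (y := n * (r₂ - η))
      (z := n * (I - η)) (by linarith) (by linarith) (by linarith)
    refine (mul_le_mul_of_nonneg_right e4 (rpow_two_pos _).le).trans ?_
    rw [← Real.rpow_add (by norm_num)]
    exact rpow_two_le.mpr (by linarith)
  have hjoint := hn₅ n (by omega)
  have hjoint' := sum_jointTypical_le (lamA := fun u => ∑ i, eA u i)
    (lamB := fun v => ∑ i, eB v i) hp0 hp1 (I - η / 2) n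
  rw [← hI] at hjoint
  have hπ : (∑ x : Fin n → U, ∑ w : Fin n → V,
      if jointTypical (outcomes ρ MA MB) (fun u => ∑ i, eA u i) (fun v => ∑ i, eB v i)
        (I - η / 2) n x w then 0 else
      trPair (piTensor (fun k => MA (x k)) ⊗ₖ piTensor (fun k => MB (w k))) (statePow ρ n)) ≤
      θ := by
    simp only [trPair_kronecker_statePow hρ hA.povm_nonneg hB.povm_nonneg]
    exact hjoint
  have hqA := hn₃ n (by omega)
  have hqB := hn₄ n (by omega)
  rw [← sum_compl_typical] at hqA hqB
  have hEA' := hEA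
  have hEB' := hEB
  rw [← trSnd_tensorAB (fun _ => ρ)] at hEA'
  rw [← trFst_tensorAB (fun _ => ρ)] at hEB'
  have hbound : 4 * t + (44 + 2 * t⁻¹) * θ + (36 + 8 * t⁻¹) * s ≤ ε / 2 := by
    have e1 : (44 + 2 * t⁻¹) * θ = ε / 8 := by
      rw [hθ]
      field_simp
    have e2 := mul_le_mul_of_nonneg_left hs (by positivity : 0 ≤ 36 + 8 * t⁻¹)
    have e3 : (36 + 8 * t⁻¹) * (ε / 8 / (36 + 8 * t⁻¹)) = ε / 8 := by field_simp
    rw [e3] at e2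
    rw [e1]
    linarith
  obtain ⟨P, hP⟩ := exists_isFaithful_protocol (n := n) hρ hM hA.sum_povm hB.sum_povm hg hEA' hEB'
    hπ hjoint' (card_typical_le hlamA hA.sum_post η n) (card_typical_le hlamB hB.sum_post η n)
    (rpow_two_pos _) (rpow_two_pos _) hqA hqB ht0 (ceilSize_pos (n * (R₁ + 3 * η)))
    (ceilSize_pos (n * (R₂ + 3 * η))) (ceilSize_pos (n * c₁)) (ceilSize_pos (n * c₂))
    (floorSize_pos (n * (r₁ - η))) (floorSize_pos (n * (r₂ - η)))
    (hsize _ _ _ h₁ _ (le_ceilSize _)) (hsize _ _ _ h₂ _ (le_ceilSize _))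
    (by
      rw [← mul_assoc]
      exact hsize _ (c₁ + R₁) _ (by linarith) _ (hmul c₁ R₁))
    (by
      rw [← mul_assoc]
      exact hsize _ (c₂ + R₂) _ (by linarith) _ (hmul c₂ R₂)) hbin hbound
  have hlog (x : ℝ) (hx : 0 ≤ x) :
      1 / (n : ℝ) * Real.logb 2 (ceilSize (n * x)) ≤ x + ε / 4 := by
    have e1 := mul_le_mul_of_nonneg_left (logb_ceilSize_le (mul_nonneg hnpos.le hx))
      (one_div_pos.mpr hnpos).le
    have e2 : 1 / (n : ℝ) * (n * x + 1) = x + 1 / n := by field_simp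
    linarith
  refine ⟨_, _, _, ceilSize_pos _, ceilSize_pos _, Nat.mul_pos (ceilSize_pos _) (ceilSize_pos _),
    P, hP, ?_, ?_, ?_⟩
  · have e1 : ((ceilSize (n * c₁) : ℕ) : ℝ) ≠ 0 := by exact_mod_cast (ceilSize_pos _).ne'
    have e2 : ((ceilSize (n * c₂) : ℕ) : ℝ) ≠ 0 := by exact_mod_cast (ceilSize_pos _).ne'
    rw [Nat.cast_mul, Real.logb_mul e1 e2, mul_add]
    linarith [hlog c₁ hc₁, hlog c₂ hc₂]
  · linarith [hlog (R₁ + 3 * η) (by linarith)]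
  · linarith [hlog (R₂ + 3 * η) (by linarith)]

end Achievability

end DistMeas

end

/-! ### From the entropic inequalities to the code parameters -/

theorem mainTheorem1 {R a b U V Z : Type*}
    [Fintype R] [DecidableEq R] [Fintype a] [DecidableEq a] [Fintype b] [DecidableEq b]
    [Fintype U] [DecidableEq U] [Fintype V] [DecidableEq V] [Fintype Z] [DecidableEq Z]
    (ρ : Matrix (a × b) (a × b) ℂ) (hρ : DistMeas.IsDensity ρ)
    (M : Z → Matrix (a × b) (a × b) ℂ) (hM : DistMeas.IsPOVM M)
    (MA : U → Matrix a a ℂ) (hMA : DistMeas.IsPOVM MA)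
    (MB : V → Matrix b b ℂ) (hMB : DistMeas.IsPOVM MB)
    (g : U × V → Z) (hg : DistMeas.IsDeterministicIntegration M MA MB g)
    (ψ : R × (a × b) → ℂ) (hψ : DistMeas.IsPurification ψ ρ)
    (R₁ R₂ C : ℝ) (hC : 0 ≤ C)
    (h₁ : R₁ ≥ DistMeas.mutualInfo (DistMeas.sigma1 MA ψ)
      - DistMeas.mutualInfo (DistMeas.sigma3UV MA MB ψ))
    (h₂ : R₂ ≥ DistMeas.mutualInfo (DistMeas.sigma2 MB ψ)
      - DistMeas.mutualInfo (DistMeas.sigma3UV MA MB ψ))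
    (h₁₂ : R₁ + R₂ ≥ DistMeas.mutualInfo (DistMeas.sigma1 MA ψ)
      + DistMeas.mutualInfo (DistMeas.sigma2 MB ψ)
      - DistMeas.mutualInfo (DistMeas.sigma3UV MA MB ψ))
    (h₁C : R₁ + C ≥ DistMeas.condEntropyFst (DistMeas.sigma3UV MA MB ψ))
    (h₂C : R₂ + C ≥ DistMeas.condEntropySnd (DistMeas.sigma3UV MA MB ψ))
    (h₁₂C : R₁ + R₂ + C ≥ DistMeas.entropy (DistMeas.sigma3UV MA MB ψ)) :
    DistMeas.Achievable ρ M R₁ R₂ C := by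

  have hρ0 : 0 ≤ ρ := hρ.1.nonneg
  have hA0 (u : U) : 0 ≤ MA u := (hMA.1 u).nonneg
  have hB0 (v : V) : 0 ≤ MB v := (hMB.1 v).nonneg
  have htrA : (DistMeas.trSnd ρ).trace = 1 := by
    rw [← hρ.2, ← Matrix.one_mul (DistMeas.trSnd ρ), DistMeas.trace_mul_trSnd,
      Matrix.one_kronecker_one, Matrix.one_mul]
  have htrB : (DistMeas.trFst ρ).trace = 1 := by
    rw [← hρ.2, ← Matrix.one_mul (DistMeas.trFst ρ), DistMeas.trace_mul_trFst,
      Matrix.one_kronecker_one, Matrix.one_mul]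
  obtain ⟨VA, qA, FA, BA, eA, hA⟩ :=
    DistMeas.exists_spectralData (DistMeas.trSnd_nonneg hρ0) htrA hA0 hMA.2
  obtain ⟨VB, qB, FB, BB, eB, hB⟩ :=
    DistMeas.exists_spectralData (DistMeas.trFst_nonneg hρ0) htrB hB0 hMB.2
  have hp0 := DistMeas.outcomes_nonneg hρ0 hA0 hB0
  have hp1 := hA.sum_outcomes hB
  have hpA := hA.sum_outcomes_right hMB.2
  have hpB := hB.sum_outcomes_left hMA.2
  have hposA := hA.marginal_fst_pos hρ0 hB
  have hposB := hA.marginal_snd_pos hρ0 hB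
  have hI₁ : DistMeas.mutualInfo (DistMeas.sigma1 MA ψ) = DistMeas.postInfo qA eA :=
    hA.mutualInfo_postMeas hψ.fst
  have hI₂ : DistMeas.mutualInfo (DistMeas.sigma2 MB ψ) = DistMeas.postInfo qB eB :=
    hB.mutualInfo_postMeas hψ.snd
  have hσ : DistMeas.sigma3UV MA MB ψ =
      Matrix.diagonal fun z => (DistMeas.outcomes ρ MA MB z : ℂ) :=
    DistMeas.sigma3UV_eq hψ hρ0 hA0 hB0
  have hS : DistMeas.entropy (DistMeas.sigma3UV MA MB ψ) =
      DistMeas.shannon (DistMeas.outcomes ρ MA MB) := by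
    rw [hσ, DistMeas.entropy_diagonal]
  have hS₁ : DistMeas.entropy (DistMeas.trSnd (DistMeas.sigma3UV MA MB ψ)) =
      DistMeas.shannon fun u => ∑ i, eA u i := by
    rw [hσ, DistMeas.trSnd_diagonal, DistMeas.entropy_diagonal]
    simp only [hpA]
  have hS₂ : DistMeas.entropy (DistMeas.trFst (DistMeas.sigma3UV MA MB ψ)) =
      DistMeas.shannon fun v => ∑ i, eB v i := by
    rw [hσ, DistMeas.trFst_diagonal, DistMeas.entropy_diagonal]
    simp only [hpB]
  have hJ := DistMeas.jointInfo_eq hp0 hpA hpB hposA hposB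
  have hJ0 := DistMeas.jointInfo_nonneg hp0 hp1
    (fun u => Finset.sum_nonneg fun i _ => hA.post_nonneg u i)
    (fun v => Finset.sum_nonneg fun i _ => hB.post_nonneg v i) hA.sum_post hB.sum_post hposA hposB
  -- Bob's measurement steers Alice's marginal into the ensemble `condFst (MB v) ρ`, so Holevo's
  -- bound gives `I(U;V) ≤ I(U;RB)`; exchanging the roles gives the other side.
  have hJA := hA.jointInfo_le_postInfo (N := fun v => DistMeas.condFst (MB v) ρ)
    (fun v => DistMeas.condFst_nonneg (hB0 v) hρ0)
    (by rw [← DistMeas.condFst_sum_left, hMB.2, DistMeas.condFst_one])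
  have hJB := hB.jointInfo_le_postInfo (N := fun u => DistMeas.condSnd (MA u) ρ)
    (fun u => DistMeas.condSnd_nonneg (hA0 u) hρ0)
    (by rw [← DistMeas.condSnd_sum_left, hMA.2, DistMeas.condSnd_one])
  simp only [DistMeas.trPair_condFst, DistMeas.trPair_one_kronecker, hB.trPair_povm] at hJA
  simp only [DistMeas.trPair_condSnd, DistMeas.trPair_kronecker_one, hA.trPair_povm] at hJB
  change DistMeas.jointInfo (DistMeas.outcomes ρ MA MB) _ _ ≤ _ at hJA
  have hJB' := (DistMeas.jointInfo_swap (p := DistMeas.outcomes ρ MA MB)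
    (lamA := fun u => ∑ i, eA u i) (lamB := fun v => ∑ i, eB v i)).symm.trans_le hJB
  simp only [DistMeas.mutualInfo, DistMeas.condEntropyFst, DistMeas.condEntropySnd, hS, hS₁,
    hS₂] at hI₁ hI₂ h₁ h₂ h₁₂ h₁C h₂C h₁₂C
  rw [hI₁] at h₁ h₁₂
  rw [hI₂] at h₂ h₁₂
  rw [← hJ] at h₁ h₂ h₁₂
  obtain ⟨c₁, c₂, r₁, r₂, hc₁, hc₂, hr₁, hr₂, rfl, hr, e₁, e₂, e₁', e₂'⟩ :=
    DistMeas.exists_rates hC hJ0 hA.postInfo_le hB.postInfo_le h₁ h₂ h₁₂ (by linarith)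
      (by linarith) (by linarith)
  -- The remaining conditions `0 ≤ R_i` follow from the first two rate inequalities and Holevo's
  -- bound.
  exact DistMeas.achievable_of_rates hρ0 (fun z => (hM.1 z).nonneg) hg hA hB rfl
    (by linarith) (by linarith) hc₁ hc₂ hr₁ hr₂ hr e₁ e₂ e₁' e₂'
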